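/- Let $C$ be a smooth projective geometrically irreducible curve over a finite field $\mathbb{F}_q$ with function field $K$, let $\infty$ be a closed point of $C$, and let $A=H^0(C\setminus\{\infty\},\mathcal{O}_C)$. Let $\mathbb{C}_\infty$ be the completion, at a place above $\infty$, of an algebraic closure of $K$, and let $L$ be a field with $K\subseteq L\subseteq\mathbb{C}_\infty$; write $\ell:A\to L$ for the inclusion and $\otimes=\otimes_{\mathbb{F}_q}$. Let $(E,\phi)$ be an Anderson $A$-module over $L$ of dimension $d$, i.e. $E\cong\mathbb{G}_{a,L}^d$ as $\mathbb{F}_q$-vector space schemes and $\phi:A\to\mathrm{End}_{\mathbb{F}_q\text{-v.s.}}(E)$, $a\mapsto\phi_a$, is a homomorphism of $\mathbb{F}_q$-algebras such that $d\phi_a-\ell(a)$ is nilpotent on $\mathrm{Lie}\,E$ for all $a\in A$. (No abelianness is assumed.) Let $M=\mathrm{Hom}_{\mathbb{F}_q\text{-v.s.}}(E,\mathbb{G}_{a,L})$ be its $A$-motive, an $A\otimes L$-module on which $A$ acts through $\phi$ and $L$ through $\mathbb{G}_{a,L}$, and let $$\mathrm{rk}(M)=\dim_{\mathrm{Quot}(A\otimes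 L)}\bigl(\mathrm{Quot}(A\otimes L)\otimes_{A\otimes L}M\bigr).$$ For a nonzero prime ideal $\mathfrak{p}$ of $A$ let $\mathbb{F}_{\mathfrak p}=A/\mathfrak p$ and $E[\mathfrak p]=\{x\in E(\mathbb{C}_\infty)\mid \phi_a(x)=0\ \text{for all } a\in\mathfrak p\}$. Then $\mathrm{rk}(M)$ is finite, and $$\dim_{\mathbb{F}_{\mathfrak p}}E[\mathfrak p]=\mathrm{rk}(M)$$ for all but finitely many nonzero primes $\mathfrak p$ of $A$. If $E$ is uniformizable, i.e. if its exponential map $\mathrm{Lie}\,E(\mathbb{C}_\infty)\to E(\mathbb{C}_\infty)$ (the everywhere convergent $\mathbb{F}_q$-linear power series $e$ with $de=\mathrm{id}$ and $\phi_a\circ e=e\circ d\phi_a$ for all $a\in A$) is surjective, then this equality holds for all nonzero primes $\mathfrak p$ of $A$. -/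

import Mathlib

open scoped TensorProduct

noncomputable section

/-! ### Function fields, places, and the ring `A` -/

/-- `K` is the function field of a smooth projective geometrically irreducible curve over the
(finite) field `k`: a function field in one variable over `k` with full constant field `k`. -/
structure IsCurveFunctionField (k K : Type*) [Field k] [Field K] [Algebra k K] : Prop where
  exists_transcendental :
    ∃ x : K, Transcendental k x ∧ FiniteDimensional (IntermediateField.adjoin k {x}) K
  constants : ∀ x : K, IsAlgebraic k x → x ∈ Set.range (algebraMap k K)

/-- A place of `K / k`, i.e. a closed point of the smooth projective curve with function field `K`,
given by its local ring: a valuation ring of `K` which contains `k` and is different from `K`. -/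
@[ext]
structure CurvePlace (k K : Type*) [Field k] [Field K] [Algebra k K] where
  ring : ValuationSubring K
  constants_mem : ∀ c : k, algebraMap k K c ∈ ring
  ne_top : ring ≠ ⊤

/-- The ring `A` of rational functions on the curve which are regular at all closed points
different from `P`. -/
def regularAway {k K : Type*} [Field k] [Field K] [Algebra k K] (P : CurvePlace k K) :
    Subalgebra k K where
  carrier := {x | ∀ Q : CurvePlace k K, Q ≠ P → x ∈ Q.ring}
  mul_mem' hx hy Q hQ := mul_mem (hx Q hQ) (hy Q hQ)
  add_mem' hx hy Q hQ := add_mem (hx Q hQ) (hy Q hQ)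
  algebraMap_mem' c Q _ := Q.constants_mem c

/-! ### The field `ℂ_∞` -/

/-- The absolute value `v` on an algebraic closure of `K` lies above the place `P` of `K`: its
restriction to `K` belongs to the class of absolute values given by `P`. -/
def LiesAbovePlace {k K : Type*} [Field k] [Field K] [Algebra k K]
    (v : AbsoluteValue (AlgebraicClosure K) ℝ) (P : CurvePlace k K) : Prop :=
  ∀ x : K, v (algebraMap K (AlgebraicClosure K) x) ≤ 1 ↔ x ∈ P.ring

/-- The completion of the algebraic closure of `K` with respect to `v`. -/
def CInfty {K : Type*} [Field K] (v : AbsoluteValue (AlgebraicClosure K) ℝ) : Type _ :=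
  v.Completion

namespace CInfty

variable {K : Type*} [Field K] (v : AbsoluteValue (AlgebraicClosure K) ℝ)

instance : NormedField (CInfty v) := inferInstanceAs (NormedField v.Completion)

instance : CompleteSpace (CInfty v) := inferInstanceAs (CompleteSpace v.Completion)

/-- The canonical embedding of the algebraic closure of `K` into its completion. -/
def ofAlgebraicClosure : AlgebraicClosure K →+* CInfty v :=
  (UniformSpace.Completion.coeRingHom : WithAbs v →+* UniformSpace.Completion (WithAbs v)).comp
    (WithAbs.equiv v).symm.toRingHom

instance {R : Type*} [CommSemiring R] [Algebra R K] : Algebra R (CInfty v) :=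
  (((ofAlgebraicClosure v).comp (algebraMap K (AlgebraicClosure K))).comp
    (algebraMap R K)).toAlgebra

instance {R : Type*} [CommSemiring R] [Algebra R K] : IsScalarTower R K (CInfty v) :=
  IsScalarTower.of_algebraMap_eq fun _ => rfl

end CInfty

/-! ### `𝔽_q`-linear polynomials: homomorphisms `𝔾_a^d → 𝔾_a` of `𝔽_q`-vector space schemes -/

section LinearPolynomials

variable (k : Type*) {L σ : Type*} [Field k] [Field L] [Algebra k L]

/-- The morphism `𝔾_a^σ → 𝔾_a` given by `f` is a homomorphism of `k`-vector space schemes, i.e.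
`f(X + Y) = f(X) + f(Y)` and `f(cX) = c f(X)` for `c ∈ k`, as identities of polynomials. -/
structure IsLinearPolynomial (f : MvPolynomial σ L) : Prop where
  add : MvPolynomial.bind₁
      (fun i => (MvPolynomial.X (Sum.inl i) + MvPolynomial.X (Sum.inr i) : MvPolynomial (σ ⊕ σ) L)) f
    = MvPolynomial.rename Sum.inl f + MvPolynomial.rename Sum.inr f
  smul : ∀ c : k,
    MvPolynomial.bind₁ (fun i => MvPolynomial.C (algebraMap k L c) * MvPolynomial.X i) f
      = MvPolynomial.C (algebraMap k L c) * f

variable {k}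

theorem IsLinearPolynomial.aeval_add {S : Type*} [CommRing S] [Algebra L S]
    {f : MvPolynomial σ L} (hf : IsLinearPolynomial k f) (x y : σ → S) :
    MvPolynomial.aeval (x + y) f = MvPolynomial.aeval x f + MvPolynomial.aeval y f := by
  have h := congrArg (MvPolynomial.aeval (Sum.elim x y)) hf.add
  rw [MvPolynomial.aeval_bind₁, map_add, MvPolynomial.aeval_rename, MvPolynomial.aeval_rename] at h
  simpa [Pi.add_def, Function.comp_def] using h

theorem IsLinearPolynomial.aeval_smul {S : Type*} [CommRing S] [Algebra L S]
    {f : MvPolynomial σ L} (hf : IsLinearPolynomial k f) (c : k) (x : σ → S) :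
    MvPolynomial.aeval (fun i => algebraMap L S (algebraMap k L c) * x i) f
      = algebraMap L S (algebraMap k L c) * MvPolynomial.aeval x f := by
  have h := congrArg (MvPolynomial.aeval x) (hf.smul c)
  rw [MvPolynomial.aeval_bind₁] at h
  simpa using h

variable (k L σ) in
/-- `Hom(𝔾_a^σ, 𝔾_a)` in the category of `k`-vector space schemes over `L`, as an `L`-vector
space. -/
def linearPolynomials : Submodule L (MvPolynomial σ L) where
  carrier := {f | IsLinearPolynomial k f}
  zero_mem' := ⟨by simp, by simp⟩
  add_mem' {f g} hf hg :=
    ⟨by rw [map_add, hf.add, hg.add, map_add, map_add]; ring,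
     fun c => by rw [map_add, hf.smul, hg.smul]; ring⟩
  smul_mem' c f hf :=
    ⟨by rw [map_smul, hf.add, map_smul, map_smul, smul_add],
     fun b => by rw [map_smul, hf.smul, mul_smul_comm]⟩

theorem IsLinearPolynomial.bind₁ {f : MvPolynomial σ L} (hf : IsLinearPolynomial k f)
    {τ : Type*} {g : σ → MvPolynomial τ L} (hg : ∀ i, IsLinearPolynomial k (g i)) :
    IsLinearPolynomial k (MvPolynomial.bind₁ g f) := by
  refine ⟨?_, fun c => ?_⟩
  · rw [MvPolynomial.bind₁_bind₁, funext fun i => (hg i).add, MvPolynomial.rename_bind₁,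
      MvPolynomial.rename_bind₁]
    exact hf.aeval_add (S := MvPolynomial (τ ⊕ τ) L) _ _
  · rw [MvPolynomial.bind₁_bind₁, funext fun i => (hg i).smul c]
    exact hf.aeval_smul (S := MvPolynomial τ L) c g

end LinearPolynomials

/-! ### Anderson modules -/

/-- An Anderson `A`-module of dimension `d` over the `A`-field `L`, in coordinates, i.e. with
underlying `k`-vector space scheme `𝔾_a^d`: a homomorphism of `k`-algebras `a ↦ φ_a` from `A` to
the endomorphism ring of the `k`-vector space scheme `𝔾_a^d` over `L` such that the Jacobian
matrix of `φ_a` at `0` minus the scalar `ℓ(a)` (the image of `a` in `L`) is nilpotent. The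
endomorphism `φ_a` is given by its components `φ a i`, the sum is the sum of endomorphisms, the
product is composition. -/
structure AndersonModule (k A L : Type*) [Field k] [CommRing A] [Algebra k A] [Field L]
    [Algebra k L] [Algebra A L] (d : ℕ) where
  φ : A → Fin d → MvPolynomial (Fin d) L
  linear : ∀ a i, IsLinearPolynomial k (φ a i)
  map_add : ∀ a b, φ (a + b) = φ a + φ b
  map_mul : ∀ a b i, φ (a * b) i = MvPolynomial.bind₁ (φ b) (φ a i)
  map_const : ∀ (c : k) i,
    φ (algebraMap k A c) i = MvPolynomial.C (algebraMap k L c) * MvPolynomial.X i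
  nilpotent : ∀ a, IsNilpotent
    ((Matrix.of fun i j => MvPolynomial.coeff (Finsupp.single j 1) (φ a i))
      - algebraMap L (Matrix (Fin d) (Fin d) L) (algebraMap A L a))

namespace AndersonModule

variable {k A L : Type*} [Field k] [CommRing A] [Algebra k A] [Field L]
  [Algebra k L] [Algebra A L] {d : ℕ} (E : AndersonModule k A L d)

theorem map_one : E.φ 1 = MvPolynomial.X := by
  funext i
  simpa using E.map_const 1 i

theorem map_zero : E.φ 0 = 0 := by
  simpa using E.map_add 0 0

/-- The endomorphism `dφ_a` of `Lie E = L^d`: the matrix of the coefficients of the linear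
monomials of `φ_a`. -/
def lieAction (a : A) : Matrix (Fin d) (Fin d) L :=
  Matrix.of fun i j => MvPolynomial.coeff (Finsupp.single j 1) (E.φ a i)

/-! #### Points and torsion -/

/-- The `A`-module `E(F)` of points of `E` with values in an extension `F` of `L`; its underlying
group is `F^d`. -/
@[nolint unusedArguments]
def Points (_E : AndersonModule k A L d) (F : Type*) : Type _ := Fin d → F

section Points

variable (F : Type*) [Field F] [Algebra L F]

instance : AddCommGroup (E.Points F) := inferInstanceAs (AddCommGroup (Fin d → F))

instance : SMul A (E.Points F) where
  smul a x := (fun i => MvPolynomial.aeval (R := L) (x : Fin d → F) (E.φ a i) : Fin d → F)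

variable {F} in
theorem points_smul_apply (a : A) (x : E.Points F) (i : Fin d) :
    (a • x : E.Points F) i = MvPolynomial.aeval (R := L) (x : Fin d → F) (E.φ a i) := rfl

variable {F} in
theorem points_add_smul_aux (a : A) (x y : E.Points F) :
    a • (x + y) = a • x + a • y :=
  funext fun i => (E.linear a i).aeval_add (S := F) x y

instance : Module A (E.Points F) where
  one_smul x := funext fun i => by
    rw [points_smul_apply, E.map_one]
    exact MvPolynomial.aeval_X (R := L) (x : Fin d → F) i
  mul_smul a b x := funext fun i => by
    rw [points_smul_apply, points_smul_apply, E.map_mul]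
    exact MvPolynomial.aeval_bind₁ (x : Fin d → F) (E.φ b) (E.φ a i)
  smul_zero a := by
    have h := E.points_add_smul_aux a (0 : E.Points F) 0
    rw [add_zero] at h
    exact left_eq_add.mp h
  smul_add a x y := E.points_add_smul_aux a x y
  add_smul a b x := funext fun i => by
    rw [points_smul_apply, E.map_add, Pi.add_apply, _root_.map_add]
    rfl
  zero_smul x := funext fun i => by
    rw [points_smul_apply, E.map_zero, Pi.zero_apply, _root_.map_zero]
    rfl

/-- The torsion `E[𝔞] = {x ∈ E(F) | φ_a(x) = 0 for all a ∈ 𝔞}`. It is an `A / 𝔞`-module. -/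
abbrev torsion (I : Ideal A) : Submodule A (E.Points F) :=
  Submodule.torsionBySet A (E.Points F) (I : Set A)

/-- The `𝔭`-rank of `E`: the dimension of `E[𝔭]` over `A / 𝔭`. -/
def torsionRank (p : Ideal A) : Cardinal :=
  Module.rank (A ⧸ p) (E.torsion F p)

end Points

/-! #### The motive -/

/-- The `A`-motive `M(E) = Hom(E, 𝔾_a)` of `E` (homomorphisms of `k`-vector space schemes). -/
@[nolint unusedArguments]
def Motive (_E : AndersonModule k A L d) : Type _ := linearPolynomials k L (Fin d)

instance : AddCommGroup E.Motive := inferInstanceAs (AddCommGroup (linearPolynomials k L (Fin d)))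

instance : Module L E.Motive := inferInstanceAs (Module L (linearPolynomials k L (Fin d)))

/-- The polynomial in `d` variables which gives a homomorphism `E → 𝔾_a`. -/
def Motive.toPoly {E : AndersonModule k A L d} (f : E.Motive) : MvPolynomial (Fin d) L := f.1

theorem Motive.ext {E : AndersonModule k A L d} {f g : E.Motive} (h : f.toPoly = g.toPoly) :
    f = g :=
  Subtype.ext h

/-- `a ∈ A` acts on the motive by precomposition with `φ_a`. -/
instance : SMul A E.Motive where
  smul a f := ⟨MvPolynomial.bind₁ (E.φ a) f.toPoly,
    IsLinearPolynomial.bind₁ (k := k) f.2 (E.linear a)⟩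

theorem toPoly_smul (a : A) (f : E.Motive) :
    (a • f).toPoly = MvPolynomial.bind₁ (E.φ a) f.toPoly := rfl

theorem toPoly_add (f g : E.Motive) : (f + g).toPoly = f.toPoly + g.toPoly := rfl

theorem toPoly_zero : (0 : E.Motive).toPoly = 0 := rfl

theorem toPoly_smul' (c : L) (f : E.Motive) : (c • f).toPoly = c • f.toPoly := rfl

instance : Module A E.Motive where
  one_smul f := Motive.ext <| by
    rw [toPoly_smul, E.map_one, MvPolynomial.bind₁_X_left]
    rfl
  mul_smul a b f := Motive.ext <| by
    rw [mul_comm, toPoly_smul, toPoly_smul, toPoly_smul, MvPolynomial.bind₁_bind₁]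
    exact congrArg (fun g => MvPolynomial.bind₁ g f.toPoly) (funext fun i => E.map_mul b a i)
  smul_zero a := Motive.ext <| by rw [toPoly_smul, toPoly_zero, _root_.map_zero]
  smul_add a f g := Motive.ext <| by
    rw [toPoly_smul, toPoly_add, _root_.map_add, toPoly_add, toPoly_smul, toPoly_smul]
  add_smul a b f := Motive.ext <| by
    rw [toPoly_smul, E.map_add, toPoly_add, toPoly_smul, toPoly_smul]
    exact IsLinearPolynomial.aeval_add (k := k) f.2 (E.φ a) (E.φ b)
  zero_smul f := by
    have h : (0 : A) • f = (0 : A) • f + (0 : A) • f := Motive.ext <| by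
      rw [toPoly_add, toPoly_smul, E.map_zero]
      have h := IsLinearPolynomial.aeval_add (k := k) f.2 (0 : Fin d → MvPolynomial (Fin d) L) 0
      rw [add_zero] at h
      exact h
    exact left_eq_add.mp h

/-- The scalar action of `k` through `L`. -/
instance : Module k E.Motive := Module.compHom E.Motive (algebraMap k L)

instance : IsScalarTower k L E.Motive :=
  IsScalarTower.of_algebraMap_smul fun _ _ => rfl

instance : IsScalarTower k A E.Motive :=
  IsScalarTower.of_algebraMap_smul fun c f => Motive.ext <| by
    rw [toPoly_smul, funext (E.map_const c)]
    refine ((show IsLinearPolynomial k f.toPoly from f.2).smul c).trans ?_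
    exact (MvPolynomial.smul_eq_C_mul _ _).symm

instance : SMulCommClass A L E.Motive where
  smul_comm a c f := Motive.ext <| by
    rw [toPoly_smul, toPoly_smul', toPoly_smul', toPoly_smul, map_smul]

/-- The `A ⊗ L`-module structure of the motive, with `(a ⊗ c) • f = a • (c • f)`. -/
instance : Module (A ⊗[k] L) E.Motive := TensorProduct.Algebra.module

theorem tmul_smul (a : A) (c : L) (f : E.Motive) : (a ⊗ₜ[k] c) • f = a • c • f :=
  TensorProduct.Algebra.smul_def a c f

/-- The rank of the motive: the dimension of `Quot(A ⊗ L) ⊗_{A ⊗ L} M` over `Quot(A ⊗ L)`. -/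
def motiveRank : Cardinal :=
  Module.rank (FractionRing (A ⊗[k] L)) (FractionRing (A ⊗[k] L) ⊗[A ⊗[k] L] E.Motive)

/-! #### The exponential map -/

section Exponential

variable {F : Type*} [NormedField F] [Algebra L F]

/-- `e : Lie E → E(F)` is the exponential map of `E`: an everywhere convergent `k`-linear power
series `e(x) = ∑_n c_n x^(q^n)`, where `q = #k`, the `c_n` are `d × d` matrices and `x^(q^n)` is
the coordinatewise power, which has derivative `c_0 = 1` at `0` and satisfies
`φ_a(e(x)) = e(dφ_a(x))` for all `a` and `x`. -/
def IsExponential (e : (Fin d → F) → E.Points F) : Prop :=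
  (∃ c : ℕ → Matrix (Fin d) (Fin d) F, c 0 = 1 ∧
    ∀ (x : Fin d → F) (i : Fin d),
      HasSum (fun n => (c n).mulVec (fun j => x j ^ (Nat.card k ^ n)) i) (e x i)) ∧
  ∀ (a : A) (x : Fin d → F),
    a • e x = e (((E.lieAction a).map (algebraMap L F)).mulVec x)

variable (F) in
/-- `E` is uniformizable (over `F = ℂ_∞`): its exponential map is surjective. -/
def IsUniformizable : Prop :=
  ∃ e : (Fin d → F) → E.Points F, E.IsExponential e ∧ Function.Surjective e

end Exponential

end AndersonModule

end

/-! Write q = #k, F = ℂ_∞ and τ for the map m ↦ m^q on the motive M. Since M is generated by the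
coordinate functions under L and τ, a point of E over F is the same thing as an L-linear map h : M →
F with h(τm) = h(m)^q, and it lies in E[𝔭] exactly when h kills 𝔭M (`torsionEquiv`). For a ∈ 𝔭 with
a ≠ 0 the matrix dφ_a is ℓ(a) ≠ 0 plus a commuting nilpotent, hence invertible, so the image of τ
spans M/𝔭M (`span_range_quotientFrob`). As F is separably closed by Krasner's lemma, the linear form
of Lang's theorem (`LinearMap.span_fixed_eq_top`) gives #E[𝔭] = q^dim_L(M/𝔭M) whenever this
dimension is finite. The claim at 𝔭 becomes dim_L(M/𝔭M) = rk(M) · dim_k(A/𝔭).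

M need not be finitely generated over A ⊗ L. Its rank is finite by growth: the elements of degree <
q^n form an L-space of dimension at most dn, and a nonconstant t ∈ A raises n by a bounded amount.
For a maximal independent family v there is one f ≠ 0 in A ⊗ L which carries the coordinates and all
τ(v_i) into the span of v. If f is a unit modulo 𝔭, then v becomes a basis of M once the elements
that are units modulo 𝔭 are inverted, because the coordinates generate M under τ; this gives the
dimension formula. Since A ⊗ L is a domain integral over L[t], f divides a nonzero element of L[t]
and is a unit modulo almost all 𝔭 (`exists_isUnit_reduction`).

If E is uniformizable, E(F) = Lie E(F)/Λ with Λ discrete. Some power of t acts on Lie E by a scalar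
of absolute value > 1, so Λ meets every finite-dimensional K-subspace spanned by periods in a
finitely generated A-module. For a finitely generated Λ, the 𝔭-torsion is isomorphic to Λ/𝔭Λ and has
(#A/𝔭)^dim(KΛ) elements. A single prime covered by the first part therefore forces dim(KΛ) = rk(M),
and the formula then holds at every prime.

The ring A enters as a Dedekind domain with finite quotients; this rests on a function whose only
pole is P, found by a Riemann-type dimension count
(`IsCurveFunctionField.exists_mem_regularAway_notMem`). -/

noncomputable section

/-! ### Separably closed completions -/

open Polynomial in
/-- A complete nonarchimedean field with a dense algebraically closed subfield is separably
closed. -/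
theorem IsSepClosed.of_denseRange {K L : Type*} [Field K] [NontriviallyNormedField L]
    [CompleteSpace L] [IsUltrametricDist L] [Algebra K L]
    (hi : DenseRange (algebraMap K L)) [IsAlgClosed K] : IsSepClosed L := by
  apply IsSepClosed.of_exists_root
  intro f fmon firr fsep
  have fnatdeg0 : f.natDegree ≠ 0 := (Irreducible.natDegree_pos firr).ne'
  let F := f.SplittingField
  let : NormedField F := spectralNorm.normedField L F
  let : NormedAlgebra L F := spectralNorm.normedAlgebra L F
  let a := rootOfSplits (SplittingField.splits f)
      (by simpa using degree_ne_of_natDegree_ne fnatdeg0)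
  have fa0 : f.aeval a = 0 := by
    rw [← eval_map_algebraMap]
    exact eval_rootOfSplits (Polynomial.SplittingField.splits f)
      (by simpa using degree_ne_of_natDegree_ne fnatdeg0)
  classical
  let S : Finset F := {x ∈ (f.rootSet F).toFinset | x ≠ a}
  -- The number `δ` separates `a` from the other roots of `f`. By Krasner's lemma any `b` with ‖a -
  -- b‖ < δ satisfies a ∈ L(b), so it is enough to find such a `b` in `L`.
  obtain ⟨δ, δpos, hδ⟩ : ∃ δ : ℝ, 0 < δ ∧ ∀ x ∈ S, δ ≤ ‖a - x‖ := by
    rcases S.eq_empty_or_nonempty with hS | hS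
    · exact ⟨1, one_pos, by simp [hS]⟩
    · obtain ⟨x, hx, hmin⟩ := S.exists_min_image (fun x => ‖a - x‖) hS
      refine ⟨‖a - x‖, ?_, hmin⟩
      rw [norm_pos_iff, sub_ne_zero]
      exact (Finset.mem_filter.mp hx).2.symm
  have norm_sub_le : ∀ a' : F, IsConjRoot L a a' → a ≠ a' → δ ≤ ‖a - a'‖ := by
    intro a' conj ne
    apply hδ
    simp only [Finset.mem_filter, Set.mem_toFinset, S]
    have := (isConjRoot_iff_mem_minpoly_rootSet ⟨f, fmon, fa0⟩).mp conj
    rw [← minpoly.eq_of_irreducible_of_monic firr fa0 fmon] at this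
    exact ⟨this, ne.symm⟩
  have hε : (δ / (max ‖a‖ 1)) ^ f.natDegree / (f.natDegree + 1) > 0 := by positivity
  obtain ⟨g, gmon, gdeg, gcoeff⟩ :=
    exists_monic_and_natDegree_eq_and_norm_map_algebraMap_coeff_sub_lt hi fmon hε
  let ⟨b, hb, hab⟩ := exists_aroots_norm_sub_lt_of_norm_coeff_sub_lt
      hε fa0 fmon (gmon.map _) (gdeg ▸ (g.natDegree_map _)) gcoeff
      (by simpa [Polynomial.map_map] using (IsAlgClosed.splits g).map ((algebraMap L F).comp _))
  have hab : ‖a - b‖ < δ := by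
    rw [← Real.rpow_natCast, ← mul_comm_div, div_self, one_mul,
        ← Real.rpow_mul (div_pos δpos (by positivity)).le, mul_inv_cancel₀] at hab
    · simpa [mul_assoc, div_mul_cancel₀ _ (by positivity : (max ‖a‖ 1) > 0).ne'] using hab
    · simp [fnatdeg0]
    · positivity
  -- The approximating polynomial `g` has its coefficients in the dense algebraically closed field,
  -- and so has all its roots there.
  have bbot : b ∈ (⊥ : IntermediateField L F) := by
    rw [Polynomial.aroots_def, Splits.roots_map ((IsAlgClosed.splits g).map _),
        Multiset.mem_map] at hb
    obtain ⟨bCp, _, hbCp⟩ := hb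
    rw [IntermediateField.mem_bot]
    exact ⟨bCp, hbCp⟩
  simp only [Polynomial.mem_roots', ne_eq, Polynomial.map_eq_zero, Polynomial.IsRoot.def,
    Polynomial.eval_map_algebraMap] at hb
  have abot : a ∈ (⊥ : IntermediateField L F) := by
    have masp : ((minpoly L a).map (algebraMap L F)).Splits := by
      simpa [minpoly.eq_of_irreducible_of_monic firr fa0 fmon] using
        (Polynomial.SplittingField.splits f)
    have hs : (minpoly L a).Separable := by
      rwa [← minpoly.eq_of_irreducible_of_monic firr fa0 fmon]
    simpa [IntermediateField.adjoin_simple_eq_bot_iff.mpr bbot] using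
      IsKrasner.krasner hs
        masp ⟨(g.map _), gmon.map _, hb.2⟩ fun a' h1 h2 ↦ lt_of_lt_of_le hab (norm_sub_le a' h1 h2)
  obtain ⟨aCp, haCp⟩ := IntermediateField.mem_bot.mp abot
  use aCp
  apply (algebraMap L F).injective
  rw [← Polynomial.aeval_algebraMap_apply_eq_algebraMap_eval, haCp, map_zero, fa0]

/-! ### Semilinear maps over separably closed fields -/

section Semilinear

variable {F W : Type*} [Field F] [AddCommGroup W] [Module F W] {σ : F →+* F}

theorem LinearMap.linearIndependent_comp_basis_of_span_range_eq_top [FiniteDimensional F W]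
    (f : W →ₛₗ[σ] W) (hf : Submodule.span F (Set.range f) = ⊤) :
    LinearIndependent F (f ∘ Module.finBasis F W) := by
  refine linearIndependent_of_top_le_span_of_card_eq_finrank ?_ (by simp)
  rw [← hf, Submodule.span_le]
  rintro _ ⟨x, rfl⟩
  rw [← (Module.finBasis F W).sum_repr x, map_sum]
  refine Submodule.sum_mem _ fun i _ => ?_
  rw [map_smulₛₗ]
  exact Submodule.smul_mem _ _ (Submodule.subset_span ⟨i, rfl⟩)

theorem LinearMap.injective_of_span_range_eq_top [FiniteDimensional F W]
    (f : W →ₛₗ[σ] W) (hf : Submodule.span F (Set.range f) = ⊤) : Function.Injective f := by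
  have h := f.linearIndependent_comp_basis_of_span_range_eq_top hf
  rw [injective_iff_map_eq_zero]
  intro x hx
  rw [← (Module.finBasis F W).sum_repr x, map_sum] at hx
  simp only [map_smulₛₗ] at hx
  have := Fintype.linearIndependent_iff.mp h _ hx
  apply (Module.finBasis F W).repr.injective
  ext i
  simpa using this i

open Polynomial in
/-- The polynomials which describe a fixed vector `∑ xᵢ fⁱ(v)` in terms of its top coefficient. -/
def fixedVectorPoly (q : ℕ) (a : ℕ → F) : ℕ → F[X]
  | 0 => C (a 0) * X ^ q
  | i + 1 => fixedVectorPoly q a i ^ q + C (a (i + 1)) * X ^ q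

-- With P = `fixedVectorPoly q a m`, the polynomial P - X has derivative -1, hence is separable, and
-- its degree is at least q > 1. Its root 0 is therefore simple and not the only one.
open Polynomial in
theorem exists_root_fixedVectorPoly [IsSepClosed F] (q : ℕ) (hq : 1 < q) (hqF : (q : F) = 0)
    (a : ℕ → F) (m : ℕ) (ha : ∃ i ≤ m, a i ≠ 0) :
    ∃ y : F, y ≠ 0 ∧ (fixedVectorPoly q a m).eval y = y := by
  have hdeg : ∀ m, (∃ i ≤ m, a i ≠ 0) → q ≤ (fixedVectorPoly q a m).natDegree := by
    intro m
    induction m with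
    | zero =>
      rintro ⟨i, hi, h⟩
      obtain rfl : i = 0 := by omega
      rw [fixedVectorPoly, natDegree_C_mul_X_pow _ _ h]
    | succ m ih =>
      rintro ⟨i, hi, h⟩
      rw [fixedVectorPoly]
      by_cases h' : ∃ i ≤ m, a i ≠ 0
      · have h1 := ih h'
        rw [natDegree_add_eq_left_of_natDegree_lt]
        · rw [natDegree_pow]
          nlinarith
        · refine (natDegree_C_mul_X_pow_le _ _).trans_lt ?_
          rw [natDegree_pow]
          nlinarith
      · push Not at h'
        have hz : ∀ j ≤ m, fixedVectorPoly q a j = 0 := by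
          intro j
          induction j with
          | zero => intro _; simp [fixedVectorPoly, h' 0 (by omega)]
          | succ j ihj =>
            intro hj
            rw [fixedVectorPoly, ihj (by omega), h' _ hj]
            simp [show q ≠ 0 by omega]
        have hi' : i = m + 1 := by
          by_contra hne
          exact h (h' i (by omega))
        subst hi'
        rw [hz m le_rfl, zero_pow (by omega), zero_add, natDegree_C_mul_X_pow _ _ h]
  have hder : ∀ m, derivative (fixedVectorPoly q a m) = 0 := by
    intro m
    cases m <;> simp [fixedVectorPoly, derivative_pow, hqF]
  have hev : (fixedVectorPoly q a m).eval 0 = 0 := by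
    induction m with
    | zero => simp [fixedVectorPoly, show q ≠ 0 by omega]
    | succ m ih =>
      have : ∀ m, (fixedVectorPoly q a m).eval 0 = 0 := by
        intro m
        induction m with
        | zero => simp [fixedVectorPoly, show q ≠ 0 by omega]
        | succ m ih => simp [fixedVectorPoly, show q ≠ 0 by omega, ih]
      exact this _
  have h1 := hdeg m ha
  set G := fixedVectorPoly q a m - X with hG
  have hGd : 1 < G.natDegree := by
    rw [hG, natDegree_sub_eq_left_of_natDegree_lt] <;> (try rw [natDegree_X]) <;> omega
  have hsep : G.Separable := by
    rw [Polynomial.Separable, hG, derivative_sub, hder, derivative_X, zero_sub]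
    exact isCoprime_one_right.neg_right
  obtain ⟨H, hH⟩ : X ∣ G := by
    rw [X_dvd_iff, coeff_zero_eq_eval_zero, hG]
    simp [hev]
  have hHd : H.degree ≠ 0 := by
    intro h
    have : G.natDegree ≤ 1 := by
      rw [hH]
      refine natDegree_mul_le.trans ?_
      rw [natDegree_X, natDegree_eq_of_degree_eq_some (n := 0) h]
    omega
  have hXH : IsCoprime X H := by
    rw [hH] at hsep
    exact hsep.isCoprime
  obtain ⟨y, hy⟩ := IsSepClosed.exists_root H hHd (hsep.of_dvd ⟨X, by rw [hH, mul_comm]⟩)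
  refine ⟨y, ?_, ?_⟩
  · rintro rfl
    obtain ⟨u, w, huw⟩ := hXH
    have := congrArg (eval 0) huw
    rw [IsRoot.def] at hy
    simp [hy] at this
  · have : G.eval y = 0 := by rw [hH, eval_mul, hy.eq_zero, mul_zero]
    rw [hG, eval_sub, eval_X, sub_eq_zero] at this
    exact this

-- Let f^(n+1)(v) = ∑ aᵢ fⁱ(v) be the first linear relation among the iterates of v. For w = ∑ xᵢ
-- fⁱ(v) and y = x_n, the equation f(w) = w says x₀ = a₀ y^q and x_(i+1) = x_i^q + a_(i+1) y^q.
-- Eliminating the other unknowns leaves one equation for y.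
open Polynomial in
theorem LinearMap.exists_fixed_ne_zero [IsSepClosed F] [FiniteDimensional F W] [Nontrivial W]
    {q : ℕ} (hq : 1 < q) (hqF : (q : F) = 0) (hσ : ∀ x, σ x = x ^ q)
    (f : W →ₛₗ[σ] W) (hf : Submodule.span F (Set.range f) = ⊤) :
    ∃ w : W, w ≠ 0 ∧ f w = w := by
  have hinj := f.injective_of_span_range_eq_top hf
  obtain ⟨v, hv⟩ := exists_ne (0 : W)
  have hex : ∃ n, ¬ LinearIndependent F (fun i : Fin n => f^[i] v) := by
    refine ⟨Module.finrank F W + 1, fun h => ?_⟩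
    have := h.fintype_card_le_finrank
    simp at this
  classical
  obtain ⟨m, hm⟩ : ∃ m, Nat.find hex = m + 1 := by
    refine Nat.exists_eq_succ_of_ne_zero fun h0 => ?_
    have := Nat.find_spec hex
    rw [h0] at this
    exact this linearIndependent_empty_type
  have hind : LinearIndependent F (fun i : Fin m => f^[i] v) :=
    not_not.mp (Nat.find_min hex (m := m) (by omega))
  have hdep : f^[m] v ∈ Submodule.span F (Set.range fun i : Fin m => f^[i] v) := by
    have h := Nat.find_spec hex
    rw [hm] at h
    by_contra hcon
    refine h ?_
    rw [linearIndependent_finSucc']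
    exact ⟨hind, hcon⟩
  obtain ⟨c, hc⟩ := (Submodule.mem_span_range_iff_exists_fun F).mp hdep
  have hfm : ∀ n, f^[n] v ≠ 0 := by
    intro n
    induction n with
    | zero => exact hv
    | succ n ih =>
      rw [Function.iterate_succ_apply']
      exact fun h => ih (hinj (h.trans (map_zero f).symm))
  let a : ℕ → F := fun i => if h : i < m then c ⟨i, h⟩ else 0
  have hca : ∑ i ∈ Finset.range m, a i • f^[i] v = f^[m] v := by
    rw [← hc, Finset.sum_range]
    refine Finset.sum_congr rfl fun i _ => ?_
    simp [a]
  obtain ⟨n, rfl⟩ : ∃ n, m = n + 1 := by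
    refine Nat.exists_eq_succ_of_ne_zero ?_
    rintro rfl
    exact hfm 0 (by simpa using hca.symm)
  -- Injectivity of `f` keeps all iterates of `v` nonzero, so the relation is not trivial.
  have ha : ∃ i ≤ n, a i ≠ 0 := by
    by_contra! h
    refine hfm (n + 1) ?_
    rw [← hca]
    refine Finset.sum_eq_zero fun i hi => ?_
    rw [h i (by simpa [Nat.lt_succ_iff] using hi), zero_smul]
  obtain ⟨y, hy0, hy⟩ := exists_root_fixedVectorPoly q hq hqF a n ha
  let x : ℕ → F := fun i => (fixedVectorPoly q a i).eval y
  refine ⟨∑ i ∈ Finset.range (n + 1), x i • f^[i] v, fun h0 => ?_, ?_⟩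
  · rw [Finset.sum_range] at h0
    have := Fintype.linearIndependent_iff.mp hind (fun i => x i) h0 (Fin.last n)
    exact hy0 (hy ▸ this)
  · rw [map_sum]
    simp only [map_smulₛₗ, hσ, ← Function.iterate_succ_apply' (f := f)]
    rw [Finset.sum_range_succ, show x n = y from hy, ← hca, Finset.smul_sum,
      Finset.sum_range_succ' (fun i => y ^ q • a i • f^[i] v), ← add_assoc,
      ← Finset.sum_add_distrib, Finset.sum_range_succ' (fun i => x i • f^[i] v)]
    congr 1
    · refine Finset.sum_congr rfl fun i _ => ?_
      simp only [x]
      rw [smul_smul, ← add_smul, fixedVectorPoly, eval_add, eval_mul, eval_pow, eval_C, eval_pow,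
        eval_X, mul_comm (y ^ q)]
    · simp only [x]
      rw [smul_smul, fixedVectorPoly, eval_mul, eval_C, eval_pow, eval_X, mul_comm (y ^ q)]

-- The Artin–Schreier polynomial X^q - X - a has derivative -1.
open Polynomial in
theorem IsSepClosed.exists_pow_sub_eq [IsSepClosed F] {q : ℕ} (hq : 1 < q) (hqF : (q : F) = 0)
    (a : F) : ∃ c : F, c ^ q - c = a := by
  have hd : (X + C a : F[X]).degree < ((X : F[X]) ^ q).degree := by
    rw [degree_X_add_C, degree_X_pow]
    exact_mod_cast hq
  obtain ⟨c, hc⟩ := IsSepClosed.exists_root (X ^ q - (X + C a)) (by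
    rw [degree_sub_eq_left_of_degree_lt hd, degree_X_pow]
    exact_mod_cast (by omega : q ≠ 0)) (by
    rw [Polynomial.Separable, derivative_sub, derivative_X_pow, hqF]
    simpa using (isCoprime_one_right (x := (X ^ q - (X + C a) : F[X]))).neg_right)
  refine ⟨c, ?_⟩
  rw [IsRoot.def] at hc
  simp only [eval_sub, eval_pow, eval_X, eval_add, eval_C] at hc
  linear_combination hc

/-- Were the span U of the fixed vectors proper, W/U would contain a nonzero fixed vector, that is,
some x ∉ U with f(x) - x ∈ U. But f - 1 maps U onto U, since it sends c • u to (c^q - c) • u for u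
fixed; hence x can be corrected by an element of U to a fixed vector, which lies in U. -/
theorem LinearMap.span_fixed_eq_top [IsSepClosed F] [FiniteDimensional F W]
    {q : ℕ} (hq : 1 < q) (hqF : (q : F) = 0) (hσ : ∀ x, σ x = x ^ q)
    (f : W →ₛₗ[σ] W) (hf : Submodule.span F (Set.range f) = ⊤) :
    Submodule.span F {w | f w = w} = ⊤ := by
  set U := Submodule.span F {w | f w = w} with hU
  by_contra hne
  have hUf : U ≤ U.comap f := by
    rw [hU, Submodule.span_le]
    intro w hw
    rw [SetLike.mem_coe, Submodule.mem_comap, show f w = w from hw]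
    exact Submodule.subset_span hw
  have : Nontrivial (W ⧸ U) := Submodule.Quotient.nontrivial_iff.mpr hne
  let g : (W ⧸ U) →ₛₗ[σ] (W ⧸ U) := U.mapQ U f hUf
  have hg : Submodule.span F (Set.range g) = ⊤ := by
    rw [eq_top_iff, ← Submodule.range_mkQ U, LinearMap.range_eq_map, ← hf, Submodule.map_span,
      Submodule.span_le]
    rintro _ ⟨_, ⟨x, rfl⟩, rfl⟩
    exact Submodule.subset_span ⟨U.mkQ x, by simp [g]⟩
  obtain ⟨w, hw0, hw⟩ := g.exists_fixed_ne_zero hq hqF hσ hg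
  obtain ⟨x, rfl⟩ := U.mkQ_surjective w
  have hx : f x - x ∈ U := by
    rw [← Submodule.Quotient.mk_eq_zero, Submodule.Quotient.mk_sub, sub_eq_zero]
    simpa [g] using hw
  have key : ∀ u ∈ U, ∃ z ∈ U, f z - z = u := by
    intro u hu
    refine Submodule.closure_induction (p := fun u _ => ∃ z ∈ U, f z - z = u)
      ⟨0, zero_mem _, by simp⟩ ?_ ?_ hu
    · rintro _ _ _ _ ⟨z1, h1, rfl⟩ ⟨z2, h2, rfl⟩
      exact ⟨z1 + z2, add_mem h1 h2, by rw [map_add]; abel⟩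
    · intro a u hu
      obtain ⟨c, hc⟩ := IsSepClosed.exists_pow_sub_eq hq hqF a
      exact ⟨c • u, Submodule.smul_mem _ _ (Submodule.subset_span hu), by
        rw [map_smulₛₗ, show f u = u from hu, ← sub_smul, hσ, hc]⟩
  obtain ⟨z, hz, hzx⟩ := key _ hx
  refine hw0 ?_
  rw [Submodule.mkQ_apply, Submodule.Quotient.mk_eq_zero]
  have : x - z ∈ U := Submodule.subset_span (by
    rw [Set.mem_ofPred_eq, map_sub]
    have := hzx
    rw [sub_eq_sub_iff_add_eq_add] at this
    rw [sub_eq_sub_iff_add_eq_add, ← this]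
    abel)
  simpa using add_mem this hz
end Semilinear

/-! ### Counting fixed vectors and Frobenius equivariant functionals -/

section Counting

theorem FiniteField.pow_natCard_eq_self_iff {k F : Type*} [Field k] [Finite k] [Field F]
    [Algebra k F] {c : F} : c ^ Nat.card k = c ↔ c ∈ Set.range (algebraMap k F) := by
  have := Fintype.ofFinite k
  rw [Nat.card_eq_fintype_card]
  constructor
  · intro h
    classical
    have h1 : 1 < Fintype.card k := Fintype.one_lt_card
    have hne := FiniteField.X_pow_card_sub_X_ne_zero F h1
    have heq : Finset.univ.image (algebraMap k F)
        = (Polynomial.X ^ Fintype.card k - Polynomial.X : Polynomial F).roots.toFinset := by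
      refine Finset.eq_of_subset_of_card_le ?_ ?_
      · intro x hx
        obtain ⟨a, -, rfl⟩ := Finset.mem_image.mp hx
        simp [hne, ← map_pow, FiniteField.pow_card]
      · rw [Finset.card_image_of_injective _ (algebraMap k F).injective, Finset.card_univ]
        refine (Multiset.toFinset_card_le _).trans ((Polynomial.card_roots' _).trans ?_)
        rw [FiniteField.X_pow_card_sub_X_natDegree_eq F h1]
    have hc : c ∈ (Polynomial.X ^ Fintype.card k - Polynomial.X : Polynomial F).roots.toFinset := by
      simp [hne, h]
    rw [← heq] at hc
    obtain ⟨a, -, ha⟩ := Finset.mem_image.mp hc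
    exact ⟨a, ha⟩
  · rintro ⟨a, rfl⟩
    rw [← map_pow, FiniteField.pow_card]

variable {k F W : Type*} [Field k] [Finite k] [Field F] [Algebra k F] [AddCommGroup W]
  [Module F W] {σ : F →+* F}

theorem natCast_natCard_eq_zero (k : Type*) {F : Type*} [Field k] [Finite k] [Ring F]
    [Algebra k F] : (Nat.card k : F) = 0 := by
  have := Fintype.ofFinite k
  rw [Nat.card_eq_fintype_card, ← map_natCast (algebraMap k F), FiniteField.cast_card_eq_zero,
    map_zero]

/-- In a basis of fixed vectors, a vector is fixed exactly when its coordinates satisfy c^q = c,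
that is, lie in k. -/
theorem LinearMap.natCard_fixed [IsSepClosed F] [FiniteDimensional F W]
    (hσ : ∀ x, σ x = x ^ Nat.card k)
    (f : W →ₛₗ[σ] W) (hf : Submodule.span F (Set.range f) = ⊤) :
    Nat.card {w // f w = w} = Nat.card k ^ Module.finrank F W := by
  have hs := f.span_fixed_eq_top (Finite.one_lt_card (α := k)) (natCast_natCard_eq_zero k) hσ hf
  obtain ⟨s, hsub, hspan, hli⟩ := exists_linearIndependent F {w | f w = w}
  rw [hs] at hspan
  let b : Module.Basis s F W := Module.Basis.mk hli (by simp [hspan])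
  have hb : ∀ i, f (b i) = b i := fun i => by
    simpa [b] using hsub i.2
  have := Module.Finite.finite_basis b
  have := Fintype.ofFinite s
  rw [Module.finrank_eq_card_basis b]
  let g : (s → k) → {w // f w = w} := fun c =>
    ⟨∑ i, algebraMap k F (c i) • b i, by
      rw [map_sum]
      refine Finset.sum_congr rfl fun i _ => ?_
      rw [map_smulₛₗ, hb, hσ, FiniteField.pow_natCard_eq_self_iff.mpr ⟨_, rfl⟩]⟩
  have hg : Function.Bijective g := by
    constructor
    · intro c c' h
      funext i
      have := congrArg (fun w => b.repr w.1 i) h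
      simp only [g, b.repr_sum_self] at this
      exact (algebraMap k F).injective this
    · rintro ⟨w, hw⟩
      have h1 : ∀ i, b.repr w i ∈ Set.range (algebraMap k F) := by
        intro i
        rw [← FiniteField.pow_natCard_eq_self_iff, ← hσ]
        have h2 : f w = ∑ i, σ (b.repr w i) • b i := by
          conv_lhs => rw [← b.sum_repr w, map_sum]
          refine Finset.sum_congr rfl fun i _ => ?_
          rw [map_smulₛₗ, hb]
        have h3 := congrArg (fun w => b.repr w i) (hw.symm.trans h2)
        simp only [b.repr_sum_self] at h3
        exact h3.symm
      choose c hc using h1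
      exact ⟨c, Subtype.ext (by simp [g, hc, b.sum_repr])⟩
  rw [← Nat.card_congr (Equiv.ofBijective g hg), Nat.card_fun, Nat.card_eq_fintype_card (α := s)]
end Counting

/-- Since τ carries a basis b of V to a basis, h ↦ (τ(bᵢ) ↦ h(bᵢ)^q) is a well-defined Frobenius
semilinear endomorphism of Hom(V, F). Its fixed points are the equivariant functionals. -/
theorem natCard_frobenius_equivariant {k L F V : Type*} [Field k] [Finite k] [Field L] [Field F]
    [Algebra k F] [Algebra L F] [IsSepClosed F] [AddCommGroup V] [Module L V]
    [FiniteDimensional L V] (τ : V →+ V) (hτ : ∀ (c : L) v, τ (c • v) = c ^ Nat.card k • τ v)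
    (hspan : Submodule.span L (Set.range τ) = ⊤) :
    Nat.card {h : V →ₗ[L] F // ∀ v, h (τ v) = h v ^ Nat.card k}
      = Nat.card k ^ Module.finrank L V := by
  have := Fintype.ofFinite k
  let σ : F →+* F := (FiniteField.frobeniusAlgHom k F).toRingHom
  have hσ : ∀ x, σ x = x ^ Nat.card k := fun x => by
    simp [σ, Nat.card_eq_fintype_card]
  let b := Module.finBasis L V
  have hsp : ⊤ ≤ Submodule.span L (Set.range (τ ∘ b)) := by
    rw [← hspan, Submodule.span_le]
    rintro _ ⟨x, rfl⟩
    rw [← b.sum_repr x, map_sum]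
    refine Submodule.sum_mem _ fun i _ => ?_
    rw [hτ]
    exact Submodule.smul_mem _ _ (Submodule.subset_span ⟨i, rfl⟩)
  let b' := basisOfTopLeSpanOfCardEqFinrank (τ ∘ b) hsp (by simp)
  have hb' : ∀ i, b' i = τ (b i) := fun i => by simp [b']
  let f : (V →ₗ[L] F) →ₛₗ[σ] (V →ₗ[L] F) :=
    { toFun := fun h => b'.constr F fun i => σ (h (b i))
      map_add' := fun g h => b'.ext fun i => by
        simp only [LinearMap.add_apply, Module.Basis.constr_basis, map_add]
      map_smul' := fun c h => b'.ext fun i => by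
        simp only [LinearMap.smul_apply, Module.Basis.constr_basis, smul_eq_mul, map_mul] }
  have hf : ∀ h i, f h (b' i) = σ (h (b i)) := fun h i => by
    simp [f]
  have hfs : Submodule.span F (Set.range f) = ⊤ := by
    rw [eq_top_iff]
    rintro h -
    have : h = ∑ i, h (b' i) • f (b.constr F (Pi.single i 1)) := b'.ext fun j => by
      simp [LinearMap.sum_apply, hf, Pi.single_apply, apply_ite]
    rw [this]
    exact Submodule.sum_mem _ fun i _ => Submodule.smul_mem _ _ (Submodule.subset_span ⟨_, rfl⟩)
  have : Module.Finite F (V →ₗ[L] F) := Module.Finite.equiv (b.constr F)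
  have hrank : Module.finrank F (V →ₗ[L] F) = Module.finrank L V := by
    rw [← (b.constr F (M' := F)).finrank_eq, Module.finrank_fintype_fun_eq_card]
    simp
  rw [← hrank, ← LinearMap.natCard_fixed hσ f hfs]
  refine Nat.card_congr (Equiv.subtypeEquivRight fun h => ?_)
  constructor
  · intro hh
    refine b'.ext fun i => ?_
    rw [hf, hb', hh, hσ]
  · intro hh v
    have h1 : ∀ i, h (τ (b i)) = σ (h (b i)) := fun i => by rw [← hf, ← hb', hh]
    rw [← hσ, ← b.sum_repr v, map_sum, map_sum, map_sum, map_sum]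
    refine Finset.sum_congr rfl fun i _ => ?_
    rw [hτ, map_smul, map_smul, h1, Algebra.smul_def, Algebra.smul_def, map_mul, map_pow,
      hσ (algebraMap L F _)]

/-! ### Structure of `k`-linear polynomials -/

/-- If N = pM, the congruence binom(pM, pn) ≡ binom(M, n) mod p passes the hypothesis on to M. If p
does not divide N, the case n = 1 leaves only N = 1. -/
theorem Nat.exists_eq_prime_pow_of_dvd_choose {p : ℕ} (hp : p.Prime) (N : ℕ) (hN : 0 < N)
    (h : ∀ n, 0 < n → n < N → p ∣ N.choose n) : ∃ j, N = p ^ j := by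
  have := Fact.mk hp
  induction N using Nat.strong_induction_on with
  | _ N ih =>
  by_cases hpN : p ∣ N
  · obtain ⟨M, rfl⟩ := hpN
    have hM : 0 < M := Nat.pos_of_mul_pos_left hN
    have hlt : M < p * M := by nlinarith [hp.two_le]
    obtain ⟨j, rfl⟩ := ih M hlt hM fun n hn hnM => by
      have h1 := h (p * n) (Nat.mul_pos hp.pos hn) (Nat.mul_lt_mul_of_pos_left hnM hp.pos)
      have h2 := Choose.choose_modEq_choose_mod_mul_choose_div_nat (p := p) (n := p * M)
        (k := p * n)
      simp only [Nat.mul_mod_right, Nat.choose_self, one_mul, Nat.mul_div_cancel_left _ hp.pos]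
        at h2
      exact (h2.dvd_iff dvd_rfl).mp h1
    exact ⟨j + 1, by rw [pow_succ, mul_comm]⟩
  · refine ⟨0, ?_⟩
    by_contra hne
    refine hpN ?_
    simpa using h 1 one_pos (by simp at hne; omega)

/-- Let #k = p^e. Only j mod e matters for the map c ↦ c^(p^j) on k; if this remainder were
positive, all p^e elements of k would be roots of a nonzero polynomial of smaller degree. -/
theorem FiniteField.exists_eq_natCard_pow {k : Type*} [Field k] [Finite k] {p : ℕ} [CharP k p]
    (hp : p.Prime) {j : ℕ} (h : ∀ c : k, c ^ p ^ j = c) : ∃ n, p ^ j = Nat.card k ^ n := by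
  have := Fintype.ofFinite k
  have := Fact.mk hp
  obtain ⟨e, -, he⟩ := FiniteField.card k p
  have he' : Nat.card k = p ^ (e : ℕ) := by rw [Nat.card_eq_fintype_card, he]
  refine ⟨j / e, ?_⟩
  rw [he', ← pow_mul]
  congr 1
  suffices hb : j % e = 0 by
    conv_lhs => rw [← Nat.div_add_mod j e, hb, add_zero]
  by_contra hb
  have h1 : ∀ c : k, c ^ p ^ (j % e) = c := fun c => by
    conv_rhs => rw [← h c, ← Nat.div_add_mod j e, pow_add, pow_mul, pow_mul p]
    congr 1
    rw [← he, FiniteField.pow_card_pow]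
  have h2 : 1 < p ^ (j % e) := Nat.one_lt_pow hb hp.one_lt
  have hne := FiniteField.X_pow_card_sub_X_ne_zero k h2
  have h3 : Fintype.card k ≤ p ^ (j % e) := by
    classical
    rw [← FiniteField.X_pow_card_sub_X_natDegree_eq k h2, ← Finset.card_univ]
    refine le_trans (Finset.card_le_card (t := (Polynomial.X ^ p ^ (j % e) -
      Polynomial.X : Polynomial k).roots.toFinset) fun c _ => ?_)
      ((Multiset.toFinset_card_le _).trans (Polynomial.card_roots' _))
    simp [hne, h1]
  rw [he] at h3
  exact absurd ((Nat.pow_le_pow_iff_right hp.one_lt).mp h3)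
    (not_le.mpr (Nat.mod_lt _ e.pos))

section

variable {k L : Type*} [Field k] [Field L] [Algebra k L]

open Polynomial in
/-- The monomials of an additive, `k`-homogeneous polynomial have degrees which are powers of
`#k`. -/
theorem Polynomial.exists_eq_pow_of_additive [Finite k] (g : L[X])
    (hadd : taylor X (g.map C) = C g + g.map C)
    (hsmul : ∀ c : k, g.comp (C (algebraMap k L c) * X) = C (algebraMap k L c) * g)
    {N : ℕ} (hN : g.coeff N ≠ 0) : ∃ n, N = Nat.card k ^ n := by
  -- With Y the inner variable, `hadd` reads g(X + Y) = g(Y) + g(X). The coefficients of X^n Y^m are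
  -- compared: there are no mixed terms on the right.
  have hder : ∀ m n, 0 < m → 0 < n → ((m + n).choose n : L) * g.coeff (m + n) = 0 := by
    intro m n hm hn
    have h := congrArg (fun f => (f.coeff n).coeff m) hadd
    simp only [taylor_coeff, coeff_add, coeff_C, hn.ne', if_false, coeff_map, zero_add,
      hm.ne'] at h
    rw [← hasseDeriv_coeff, ← h]
    congr 1
    rw [hasseDeriv_apply, hasseDeriv_apply, sum_def, sum_def, eval_finsetSum]
    rw [support_map_of_injective _ C_injective]
    refine Finset.sum_congr rfl fun i _ => ?_
    simp [← C_mul_X_pow_eq_monomial, mul_comm]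
  have hz : g.coeff 0 = 0 := by
    have h := congrArg (fun f => (f.coeff 0).coeff 0) hadd
    simp only [taylor_coeff_zero, coeff_add, coeff_C, if_true, coeff_map, eval_map, eval₂_C_X] at h
    simpa using h
  have hN0 : 0 < N := by
    rcases Nat.eq_zero_or_pos N with rfl | h
    · exact absurd hz hN
    · exact h
  obtain ⟨p, hp⟩ := CharP.exists k
  have hpp : p.Prime := (CharP.char_is_prime_or_zero k p).resolve_right (CharP.char_ne_zero_of_finite k p)
  have : CharP L p := charP_of_injective_algebraMap (algebraMap k L).injective p
  obtain ⟨j, rfl⟩ := Nat.exists_eq_prime_pow_of_dvd_choose hpp N hN0 fun n hn hnN => by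
    have h := hder (N - n) n (by omega) hn
    rw [Nat.sub_add_cancel hnN.le] at h
    exact (CharP.cast_eq_zero_iff L p _).mp ((mul_eq_zero.mp h).resolve_right hN)
  refine FiniteField.exists_eq_natCard_pow hpp fun c => ?_
  have h := congrArg (fun f => f.coeff (p ^ j)) (hsmul c)
  simp only [comp_C_mul_X_coeff, coeff_C_mul] at h
  rw [mul_comm] at h
  have := mul_right_cancel₀ hN h
  rw [← map_pow] at this
  exact (algebraMap k L).injective this

theorem isLinearPolynomial_X {σ : Type*} (i : σ) :
    IsLinearPolynomial k (MvPolynomial.X i : MvPolynomial σ L) :=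
  ⟨by simp, fun c => by simp⟩

theorem add_pow_natCard (k : Type*) [Field k] [Finite k] {S : Type*} [CommRing S] [Algebra k S]
    (x y : S) : (x + y) ^ Nat.card k = x ^ Nat.card k + y ^ Nat.card k := by
  have := Fintype.ofFinite k
  simpa [Nat.card_eq_fintype_card] using map_add (FiniteField.frobeniusAlgHom k S) x y

theorem algebraMap_pow_natCard [Finite k] {S : Type*} [CommRing S] [Algebra k S] (c : k) :
    algebraMap k S c ^ Nat.card k = algebraMap k S c := by
  have := Fintype.ofFinite k
  rw [Nat.card_eq_fintype_card, ← map_pow, FiniteField.pow_card]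

theorem IsLinearPolynomial.pow_natCard [Finite k] {σ : Type*} {f : MvPolynomial σ L}
    (hf : IsLinearPolynomial k f) : IsLinearPolynomial k (f ^ Nat.card k) := by
  refine ⟨?_, fun c => ?_⟩
  · rw [map_pow, hf.add, map_pow, map_pow]
    exact add_pow_natCard k _ _
  · rw [map_pow, hf.smul, mul_pow, ← map_pow, algebraMap_pow_natCard]

theorem IsLinearPolynomial.aeval_zero {σ S : Type*} [CommRing S] [Algebra L S]
    {f : MvPolynomial σ L} (hf : IsLinearPolynomial k f) :
    MvPolynomial.aeval (0 : σ → S) f = 0 := by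
  have h := hf.aeval_add (0 : σ → S) 0
  rw [add_zero] at h
  exact left_eq_add.mp h

theorem IsLinearPolynomial.aeval_sum {σ S ι : Type*} [CommRing S] [Algebra L S]
    {f : MvPolynomial σ L} (hf : IsLinearPolynomial k f) (x : ι → σ → S) (s : Finset ι) :
    MvPolynomial.aeval (∑ i ∈ s, x i) f = ∑ i ∈ s, MvPolynomial.aeval (x i) f := by
  classical
  induction s using Finset.induction_on with
  | empty => simpa using hf.aeval_zero
  | insert i s hi ih => rw [Finset.sum_insert hi, Finset.sum_insert hi, hf.aeval_add, ih]

theorem aeval_aeval_single_X {L σ S : Type*} [Field L] [DecidableEq σ] [CommRing S] [Algebra L S]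
    (f : MvPolynomial σ L) (i : σ) (s : S) :
    Polynomial.aeval s (MvPolynomial.aeval (Pi.single i (Polynomial.X : Polynomial L)) f)
      = MvPolynomial.aeval (Pi.single i s) f := by
  rw [← AlgHom.comp_apply, MvPolynomial.comp_aeval]
  congr 2
  funext j
  by_cases hj : j = i
  · subst hj; simp
  · simp [hj]

/-- A `k`-linear polynomial of total degree less than `q ^ n` is a linear combination of the
`X_i ^ (q ^ l)` with `l < n`. -/
theorem IsLinearPolynomial.mem_span [Finite k] {σ : Type*} [Finite σ] {f : MvPolynomial σ L}
    (hf : IsLinearPolynomial k f) {n : ℕ} (hn : f.totalDegree < Nat.card k ^ n) :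
    f ∈ Submodule.span L (Set.range fun j : σ × Fin n =>
      (MvPolynomial.X j.1 ^ Nat.card k ^ (j.2 : ℕ) : MvPolynomial σ L)) := by
  classical
  have := Fintype.ofFinite σ
  let g : σ → Polynomial L := fun i => MvPolynomial.aeval (Pi.single i Polynomial.X) f
  -- A vector is the sum of its coordinate components, so additivity splits `f` into polynomials in
  -- one variable.
  have hfg : f = ∑ i, Polynomial.aeval (MvPolynomial.X i : MvPolynomial σ L) (g i) := by
    simp only [g, aeval_aeval_single_X]
    rw [← hf.aeval_sum]
    conv_lhs => rw [← MvPolynomial.aeval_X_left_apply f]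
    congr 2
    funext j
    simp [Finset.sum_apply, Pi.single_apply]
  have hcoeff : ∀ i N, (g i).coeff N ≠ 0 → ∃ l, N = Nat.card k ^ l := by
    intro i N hN
    refine Polynomial.exists_eq_pow_of_additive (k := k) (g i) ?_ ?_ hN
    · have h1 := aeval_aeval_single_X f i (Polynomial.X + Polynomial.C Polynomial.X : Polynomial (Polynomial L))
      rw [Pi.single_add, hf.aeval_add,
        ← aeval_aeval_single_X f i (Polynomial.X : Polynomial (Polynomial L)),
        ← aeval_aeval_single_X f i (Polynomial.C Polynomial.X : Polynomial (Polynomial L))] at h1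
      rw [Polynomial.taylor_apply, Polynomial.comp, Polynomial.eval₂_map]
      rw [Polynomial.aeval_def] at h1
      refine h1.trans ?_
      rw [add_comm]
      congr 1
      · rw [← Polynomial.algebraMap_eq, Polynomial.aeval_algebraMap_apply,
          Polynomial.aeval_X_left_apply]
    · intro c
      have h1 := aeval_aeval_single_X f i
        (Polynomial.C (algebraMap k L c) * Polynomial.X : Polynomial L)
      rw [← Polynomial.comp_eq_aeval] at h1
      refine h1.trans ?_
      rw [← Polynomial.algebraMap_eq, ← hf.aeval_smul c]
      congr 2
      funext j
      by_cases hj : j = i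
      · subst hj; simp
      · simp [hj]
  have hdeg : ∀ i, (g i).natDegree < Nat.card k ^ n := by
    intro i
    refine lt_of_le_of_lt ?_ hn
    have := MvPolynomial.aeval_natDegree_le (n := 1) f le_rfl (Pi.single i Polynomial.X)
      fun j => by
        by_cases hj : j = i
        · subst hj; simp
        · simp [hj]
    simpa using this
  rw [hfg]
  refine Submodule.sum_mem _ fun i _ => ?_
  rw [Polynomial.aeval_eq_sum_range]
  refine Submodule.sum_mem _ fun N hN => ?_
  by_cases hc : (g i).coeff N = 0
  · rw [hc, zero_smul]
    exact zero_mem _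
  · obtain ⟨l, rfl⟩ := hcoeff i N hc
    have hl : l < n := by
      have := hdeg i
      rw [Finset.mem_range] at hN
      exact (Nat.pow_lt_pow_iff_right (Finite.one_lt_card (α := k))).mp (by omega)
    exact Submodule.smul_mem _ _ (Submodule.subset_span ⟨(i, ⟨l, hl⟩), rfl⟩)
end

/-! ### The Frobenius on the motive -/

namespace AndersonModule

section Motive

variable {k A L : Type*} [Field k] [Finite k] [CommRing A] [Algebra k A] [Field L]
  [Algebra k L] [Algebra A L] {d : ℕ} (E : AndersonModule k A L d)

variable (k) in
/-- The `q`-power Frobenius of a `k`-algebra, where `q = #k`. -/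
def frobAlgHom (S : Type*) [CommRing S] [Algebra k S] : S →ₐ[k] S :=
  { (letI := Fintype.ofFinite k; FiniteField.frobeniusAlgHom k S) with }

theorem frobAlgHom_apply {S : Type*} [CommRing S] [Algebra k S] (x : S) :
    frobAlgHom k S x = x ^ Nat.card k := by
  let := Fintype.ofFinite k
  rw [Nat.card_eq_fintype_card]
  rfl

/-- The `q`-power Frobenius `m ↦ m ^ q` of the motive. -/
def frob : E.Motive →ₛₗ[(frobAlgHom k L).toRingHom] E.Motive where
  toFun m := ⟨m.toPoly ^ Nat.card k, IsLinearPolynomial.pow_natCard (k := k) m.2⟩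
  map_add' m n := Motive.ext (add_pow_natCard k m.toPoly n.toPoly)
  map_smul' c m := Motive.ext <| by
    change (c • m.toPoly) ^ Nat.card k = frobAlgHom k L c • m.toPoly ^ Nat.card k
    rw [smul_pow, frobAlgHom_apply]

theorem toPoly_frob (m : E.Motive) : (E.frob m).toPoly = m.toPoly ^ Nat.card k := rfl

theorem frob_smul (a : A) (m : E.Motive) : E.frob (a • m) = a • E.frob m :=
  Motive.ext <| by rw [toPoly_frob, toPoly_smul, toPoly_smul, toPoly_frob, map_pow]

/-- The coordinate functions of `E`. -/
def coord (i : Fin d) : E.Motive := ⟨MvPolynomial.X i, isLinearPolynomial_X i⟩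

theorem toPoly_iterate_frob_coord (n : ℕ) (i : Fin d) :
    (E.frob^[n] (E.coord i)).toPoly = MvPolynomial.X i ^ Nat.card k ^ n := by
  induction n with
  | zero => rw [pow_zero, pow_one]; rfl
  | succ n ih => rw [Function.iterate_succ_apply', toPoly_frob, ih, ← pow_mul, pow_succ]

/-- The underlying polynomial as an `L`-linear map. -/
def toPolyLinear : E.Motive →ₗ[L] MvPolynomial (Fin d) L where
  toFun := Motive.toPoly
  map_add' := E.toPoly_add
  map_smul' := E.toPoly_smul'

theorem mem_span_of_totalDegree_lt (m : E.Motive) {n : ℕ}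
    (hn : m.toPoly.totalDegree < Nat.card k ^ n) :
    m ∈ Submodule.span L (Set.range fun j : Fin d × Fin n => E.frob^[(j.2 : ℕ)] (E.coord j.1)) := by
  have h := IsLinearPolynomial.mem_span (k := k) (f := m.toPoly) m.2 hn
  have h2 : Set.range (fun j : Fin d × Fin n =>
      (MvPolynomial.X j.1 ^ Nat.card k ^ (j.2 : ℕ) : MvPolynomial (Fin d) L))
      = E.toPolyLinear ''
        Set.range fun j : Fin d × Fin n => E.frob^[(j.2 : ℕ)] (E.coord j.1) := by
    rw [← Set.range_comp]
    exact congrArg Set.range (funext fun j => (E.toPoly_iterate_frob_coord _ _).symm)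
  rw [h2, ← Submodule.map_span] at h
  obtain ⟨m', hm', h⟩ := h
  have : m' = m := Motive.ext h
  exact this ▸ hm'

theorem span_iterate_frob_coord :
    Submodule.span L (Set.range fun j : Fin d × ℕ => E.frob^[j.2] (E.coord j.1)) = ⊤ := by
  rw [eq_top_iff]
  rintro m -
  refine Submodule.span_mono ?_
    (E.mem_span_of_totalDegree_lt m (Nat.lt_pow_self (Finite.one_lt_card (α := k))))
  rintro _ ⟨j, rfl⟩
  exact ⟨(j.1, j.2), rfl⟩

/-- A set of motive elements which contains the coordinates and is stable under the operations is
everything. -/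
theorem motive_induction {p : E.Motive → Prop} (hzero : p 0) (hcoord : ∀ i, p (E.coord i))
    (hfrob : ∀ m, p m → p (E.frob m)) (hsmul : ∀ (c : L) m, p m → p (c • m))
    (hadd : ∀ m n, p m → p n → p (m + n)) (m : E.Motive) : p m := by
  have hm : m ∈ Submodule.span L (Set.range fun j : Fin d × ℕ => E.frob^[j.2] (E.coord j.1)) := by
    rw [E.span_iterate_frob_coord]; trivial
  have key : ∀ n i, p (E.frob^[n] (E.coord i)) := by
    intro n i
    induction n with
    | zero => exact hcoord i
    | succ n ih => rw [Function.iterate_succ_apply']; exact hfrob _ ih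
  induction hm using Submodule.span_induction with
  | mem x hx => obtain ⟨j, rfl⟩ := hx; exact key _ _
  | zero => exact hzero
  | add x y _ _ h1 h2 => exact hadd _ _ h1 h2
  | smul c x _ h => exact hsmul _ _ h

theorem constantCoeff_toPoly (m : E.Motive) : MvPolynomial.constantCoeff m.toPoly = 0 := by
  have h := IsLinearPolynomial.aeval_zero (k := k) (S := L) (f := m.toPoly) m.2
  rwa [MvPolynomial.aeval_zero] at h

/-- An element of the motive has no constant term, and q ≥ 2, so its q-th power has no linear term.
-/
theorem coeff_single_frob (m : E.Motive) (j : Fin d) :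
    MvPolynomial.coeff (Finsupp.single j 1) (E.frob m).toPoly = 0 := by
  obtain ⟨n, hn⟩ : ∃ n, Nat.card k = n + 2 :=
    ⟨_, (Nat.sub_add_cancel (Finite.one_lt_card (α := k))).symm⟩
  have h0 := E.constantCoeff_toPoly m
  rw [MvPolynomial.constantCoeff_eq] at h0
  rw [toPoly_frob, hn, pow_succ, MvPolynomial.coeff_mul, Finsupp.antidiagonal_single]
  refine Finset.sum_eq_zero fun x hx => ?_
  obtain ⟨⟨a, b⟩, hab, rfl⟩ := Finset.mem_map.mp hx
  rw [Finset.HasAntidiagonal.mem_antidiagonal] at hab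
  obtain ⟨rfl, rfl⟩ | ⟨rfl, rfl⟩ : a = 0 ∧ b = 1 ∨ a = 1 ∧ b = 0 := by omega
  · have : MvPolynomial.coeff 0 (m.toPoly ^ (n + 1)) = 0 := by
      rw [← MvPolynomial.constantCoeff_eq, map_pow, MvPolynomial.constantCoeff_eq, h0,
        zero_pow n.succ_ne_zero]
    simp [this]
  · simp [h0]

/-- Modulo the L-span of τ(M) only the linear part of m survives: the quotient is the cotangent
space of E, generated by the coordinates. -/
theorem sub_sum_coeff_smul_coord_mem (m : E.Motive) :
    m - ∑ j, MvPolynomial.coeff (Finsupp.single j 1) m.toPoly • E.coord j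
      ∈ Submodule.span L (Set.range E.frob) := by
  induction m using E.motive_induction with
  | hzero => simp [toPoly_zero]
  | hcoord i =>
    have : ∀ j, MvPolynomial.coeff (Finsupp.single j 1) (E.coord i).toPoly
        = if j = i then 1 else 0 := fun j => by
      change MvPolynomial.coeff (Finsupp.single j 1) (MvPolynomial.X i) = _
      rw [MvPolynomial.coeff_X]
      simp [Finsupp.single_left_inj, eq_comm]
    simp [this]
  | hfrob m _ =>
    simp only [coeff_single_frob, zero_smul, Finset.sum_const_zero, sub_zero]
    exact Submodule.subset_span ⟨m, rfl⟩
  | hsmul c m h =>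
    convert Submodule.smul_mem _ c h using 1
    simp [toPoly_smul', smul_sub, Finset.smul_sum, smul_smul]
  | hadd m n h1 h2 =>
    convert add_mem h1 h2 using 1
    simp only [toPoly_add, MvPolynomial.coeff_add, add_smul, Finset.sum_add_distrib]
    abel

/-- The endomorphism `id ⊗ Frob_q` of `A ⊗ L`. -/
def twist (k B L : Type*) [Field k] [Finite k] [CommRing B] [Algebra k B] [Field L] [Algebra k L] :
    B ⊗[k] L →ₐ[k] B ⊗[k] L :=
  Algebra.TensorProduct.map (AlgHom.id k B) (frobAlgHom k L)

theorem frob_tensor_smul (x : A ⊗[k] L) (m : E.Motive) :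
    E.frob (x • m) = twist k A L x • E.frob m := by
  induction x using TensorProduct.induction_on with
  | zero => rw [zero_smul, _root_.map_zero, _root_.map_zero, zero_smul]
  | add x y hx hy => rw [add_smul, _root_.map_add, _root_.map_add, add_smul, hx, hy]
  | tmul a c =>
    rw [twist, Algebra.TensorProduct.map_tmul, tmul_smul, tmul_smul, frob_smul, map_smulₛₗ]
    rfl

end Motive

end AndersonModule
-- Finiteness of the rank of the motive
theorem MvPolynomial.totalDegree_bind₁_le {R σ τ : Type*} [CommSemiring R]
    (φ : σ → MvPolynomial τ R) {D : ℕ} (hD : ∀ i, (φ i).totalDegree ≤ D) (f : MvPolynomial σ R) :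
    (MvPolynomial.bind₁ φ f).totalDegree ≤ f.totalDegree * D := by
  rw [MvPolynomial.bind₁, MvPolynomial.aeval_def, MvPolynomial.eval₂_eq]
  refine MvPolynomial.totalDegree_finsetSum_le fun s hs => ?_
  refine (MvPolynomial.totalDegree_mul _ _).trans ?_
  rw [MvPolynomial.algebraMap_eq, MvPolynomial.totalDegree_C, zero_add]
  refine (MvPolynomial.totalDegree_finsetProd _ _).trans ?_
  refine (Finset.sum_le_sum (g := fun i => s i * D) fun i _ =>
    (MvPolynomial.totalDegree_pow _ _).trans (Nat.mul_le_mul_left _ (hD i))).trans ?_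
  rw [← Finset.sum_mul]
  exact Nat.mul_le_mul_right _ (MvPolynomial.le_totalDegree hs)

theorem TensorProduct.eq_zero_of_sum_tmul_eq_zero {k A L ι : Type*} [Field k] [AddCommGroup A]
    [Module k A] [AddCommGroup L] [Module k L] {v : ι → A} (hv : LinearIndependent k v)
    {s : Finset ι} {c : ι → L} (h : ∑ i ∈ s, v i ⊗ₜ[k] c i = 0) {i : ι} (hi : i ∈ s) : c i = 0 := by
  classical
  let b := Module.Basis.extend hv.linearIndepOn_id
  let e : ι → _ := fun i => (⟨v i, hv.linearIndepOn_id.subset_extend _ ⟨i, rfl⟩⟩ :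
    hv.linearIndepOn_id.extend (Set.subset_univ _))
  have he : Function.Injective e := fun i j hij => hv.injective (congrArg Subtype.val hij)
  have hb : ∀ i, b (e i) = v i := fun i => by simp [b, e]
  have h1 := congrArg (fun x => TensorProduct.equivFinsuppOfBasisLeft b x (e i)) h
  simp only [map_sum, Finsupp.finsetSum_apply, ← hb] at h1
  simpa [Finsupp.single_apply, he.eq_iff, hi] using h1

namespace AndersonModule

section Rank

variable {k A L : Type*} [Field k] [Finite k] [CommRing A] [Algebra k A] [Field L]
  [Algebra k L] [Algebra A L] {d : ℕ} (E : AndersonModule k A L d)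

/-- A growth argument: if s is independent over A ⊗ L, the elements t^j • m with m ∈ s and j ≤ J are
independent over L. Their number grows like #s · J, while the space of bounded degree containing
them has dimension about duJ. -/
theorem exists_card_le_of_linearIndependent {t : A}
    (ht : LinearIndependent k (fun j : ℕ => t ^ j)) :
    ∃ B : ℕ, ∀ s : Finset E.Motive, LinearIndependent (A ⊗[k] L) (fun m : s => (m : E.Motive)) →
      s.card ≤ B := by
  have hq : 1 < Nat.card k := Finite.one_lt_card
  obtain ⟨D, hD⟩ : ∃ D, ∀ i, (E.φ t i).totalDegree ≤ D :=
    ⟨Finset.univ.sup fun i => (E.φ t i).totalDegree, fun i => Finset.le_sup (f := fun i => (E.φ t i).totalDegree) (Finset.mem_univ i)⟩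
  -- The action of `t` turns degree < q^c into degree < q^(c + u).
  obtain ⟨u, hu⟩ : ∃ u, D ≤ Nat.card k ^ u := ⟨D, (Nat.lt_pow_self hq).le⟩
  have hdeg : ∀ (m : E.Motive) (c : ℕ), m.toPoly.totalDegree < Nat.card k ^ c → ∀ j,
      (t ^ j • m).toPoly.totalDegree < Nat.card k ^ (c + j * u) := by
    intro m c hm j
    induction j with
    | zero => simpa using hm
    | succ j ih =>
      rw [pow_succ', mul_smul, toPoly_smul]
      refine (MvPolynomial.totalDegree_bind₁_le _ (fun i => (hD i).trans hu) _).trans_lt ?_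
      rw [add_mul, one_mul, ← add_assoc, pow_add _ (c + j * u)]
      exact Nat.mul_lt_mul_of_pos_right ih (by positivity)
  refine ⟨d * u, fun s hs => ?_⟩
  by_contra! hcard
  obtain ⟨c, hc⟩ : ∃ c, ∀ m : s, m.1.toPoly.totalDegree < Nat.card k ^ c := by
    refine ⟨s.sup fun m => m.toPoly.totalDegree, fun m => ?_⟩
    refine lt_of_le_of_lt ?_ (Nat.lt_pow_self hq)
    exact Finset.le_sup (f := fun m : E.Motive => m.toPoly.totalDegree) m.2
  -- If #s ≥ du + 1, then (du + 1)(J + 1) ≤ d(c + Ju), that is, du + J + 1 ≤ dc. This fails as soon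
  -- as J ≥ dc.
  let J := d * c
  let v : s × Fin (J + 1) → E.Motive := fun x => t ^ (x.2 : ℕ) • x.1.1
  have hv : LinearIndependent L v := by
    rw [Fintype.linearIndependent_iff]
    intro g hg x
    have h1 : ∑ m : s, (∑ j : Fin (J + 1), (t ^ (j : ℕ)) ⊗ₜ[k] g (m, j)) • (m : E.Motive) = 0 := by
      rw [← hg, Fintype.sum_prod_type]
      refine Finset.sum_congr rfl fun m _ => ?_
      rw [Finset.sum_smul]
      refine Finset.sum_congr rfl fun j _ => ?_
      rw [tmul_smul, smul_comm]
    have h2 := Fintype.linearIndependent_iff.mp hs _ h1 x.1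
    have ht' : LinearIndependent k (fun j : Fin (J + 1) => t ^ (j : ℕ)) :=
      ht.comp _ Fin.val_injective
    exact TensorProduct.eq_zero_of_sum_tmul_eq_zero ht' h2 (Finset.mem_univ x.2)
  have hle : Submodule.span L (Set.range v) ≤ Submodule.span L
      (Set.range fun j : Fin d × Fin (c + J * u) => E.frob^[(j.2 : ℕ)] (E.coord j.1)) := by
    rw [Submodule.span_le]
    rintro _ ⟨x, rfl⟩
    refine E.mem_span_of_totalDegree_lt _ ((hdeg _ c (hc x.1) x.2).trans_le ?_)
    refine Nat.pow_le_pow_right hq.le (Nat.add_le_add_left (Nat.mul_le_mul_right _ ?_) _)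
    have := x.2.2
    omega
  have := Module.Finite.span_of_finite L (Set.finite_range fun j : Fin d × Fin (c + J * u) =>
    E.frob^[(j.2 : ℕ)] (E.coord j.1))
  have h3 := Submodule.finrank_mono hle
  rw [finrank_span_eq_card hv] at h3
  have h4 := h3.trans (finrank_range_le_card _)
  simp only [Fintype.card_prod, Fintype.card_fin, Fintype.card_coe] at h4
  have h5 : (d * u + 1) * (J + 1) ≤ d * (c + J * u) := (Nat.mul_le_mul_right _ hcard).trans h4
  have h6 : (d * u + 1) * (J + 1) = d * (J * u) + d * u + J + 1 := by ring
  have h7 : d * (c + J * u) = J + d * (J * u) := by simp only [J]; ring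
  omega

/-- Localizing M at the non-zero-divisors keeps its rank over A ⊗ L, and a module over the fraction
ring has the same rank over A ⊗ L. -/
theorem motiveRank_eq_of_rank_eq {r : ℕ} (h : Module.rank (A ⊗[k] L) E.Motive = r) :
    E.motiveRank = r := by
  have h1 := IsLocalizedModule.lift_rank_eq (nonZeroDivisors (A ⊗[k] L))
    (TensorProduct.mk (A ⊗[k] L) (FractionRing (A ⊗[k] L)) E.Motive 1) le_rfl
  have h2 := IsLocalization.rank_eq (FractionRing (A ⊗[k] L))
    (N := FractionRing (A ⊗[k] L) ⊗[A ⊗[k] L] E.Motive) (nonZeroDivisors (A ⊗[k] L)) le_rfl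
  rw [motiveRank, h2]
  rw [h, Cardinal.lift_natCast] at h1
  exact Cardinal.lift_injective (h1.trans (Cardinal.lift_natCast r).symm)

theorem exists_ne_zero_smul_mem_span {R M : Type*} [CommRing R] [IsDomain R] [AddCommGroup M]
    [Module R M] {r : ℕ} (hr : Module.rank R M = r) {v : Fin r → M} (hv : LinearIndependent R v)
    (m : M) : ∃ f : R, f ≠ 0 ∧ f • m ∈ Submodule.span R (Set.range v) := by
  by_contra! hcon
  have h : LinearIndependent R (Fin.cons m v : Fin (r + 1) → M) := by
    rw [Fintype.linearIndependent_iff]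
    intro g hg
    rw [Fin.sum_univ_succ] at hg
    simp only [Fin.cons_zero, Fin.cons_succ] at hg
    have h0 : g 0 = 0 := by
      by_contra hne
      refine hcon _ hne ?_
      rw [eq_neg_of_add_eq_zero_left hg]
      exact neg_mem (Submodule.sum_mem _ fun i _ =>
        Submodule.smul_mem _ _ (Submodule.subset_span ⟨i, rfl⟩))
    rw [h0, zero_smul, zero_add] at hg
    exact Fin.cases h0 (Fintype.linearIndependent_iff.mp hv _ hg)
  have h1 := Module.le_rank_iff.mpr ⟨_, h⟩
  rw [hr] at h1
  have : r + 1 ≤ r := by exact_mod_cast h1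
  omega

/-- Every element of M has a nonzero multiple in the span of v, but without finite generation there
need be no common multiplier. One for the finitely many elements `coord i` and `frob (v i)` is
enough later, because the coordinates generate M under τ and L. -/
theorem exists_basis_of_motive [IsDomain (A ⊗[k] L)] {t : A}
    (ht : LinearIndependent k (fun j : ℕ => t ^ j)) :
    ∃ (r : ℕ) (v : Fin r → E.Motive) (f : A ⊗[k] L), E.motiveRank = r ∧
      LinearIndependent (A ⊗[k] L) v ∧ f ≠ 0 ∧
      (∀ i, f • E.coord i ∈ Submodule.span (A ⊗[k] L) (Set.range v)) ∧
      ∀ i, f • E.frob (v i) ∈ Submodule.span (A ⊗[k] L) (Set.range v) := by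
  obtain ⟨B, hB⟩ := E.exists_card_le_of_linearIndependent ht
  have h1 : Module.rank (A ⊗[k] L) E.Motive < Cardinal.aleph0 :=
    (rank_le hB).trans_lt Cardinal.natCast_lt_aleph0
  obtain ⟨r, hr⟩ := Cardinal.lt_aleph0.mp h1
  obtain ⟨v, hv⟩ := Module.le_rank_iff.mp hr.ge
  choose f1 hf1 hf1' using fun i => exists_ne_zero_smul_mem_span hr hv (E.coord i)
  choose f2 hf2 hf2' using fun i => exists_ne_zero_smul_mem_span hr hv (E.frob (v i))
  refine ⟨r, v, (∏ i, f1 i) * ∏ i, f2 i, E.motiveRank_eq_of_rank_eq hr, hv,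
    mul_ne_zero (Finset.prod_ne_zero_iff.mpr fun i _ => hf1 i)
      (Finset.prod_ne_zero_iff.mpr fun i _ => hf2 i), fun i => ?_, fun i => ?_⟩
  · obtain ⟨g, hg⟩ := Finset.dvd_prod_of_mem f1 (Finset.mem_univ i)
    rw [hg, show f1 i * g * ∏ i, f2 i = (g * ∏ i, f2 i) * f1 i by ring, mul_smul]
    exact Submodule.smul_mem _ _ (hf1' i)
  · obtain ⟨g, hg⟩ := Finset.dvd_prod_of_mem f2 (Finset.mem_univ i)
    rw [hg, show (∏ i, f1 i) * (f2 i * g) = ((∏ i, f1 i) * g) * f2 i by ring, mul_smul]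
    exact Submodule.smul_mem _ _ (hf2' i)

end Rank

end AndersonModule
-- Torsion points as functionals on the quotients of the motive
namespace AndersonModule

section Torsion

variable {k A L : Type*} [Field k] [Finite k] [CommRing A] [Algebra k A] [Field L]
  [Algebra k L] [Algebra A L] {d : ℕ} (E : AndersonModule k A L d)

/-- The submodule `𝔞 M` of the motive, as an `L`-vector space. -/
def idealMotive (p : Ideal A) : Submodule L E.Motive :=
  Submodule.span L {x | ∃ a ∈ p, ∃ m : E.Motive, x = a • m}

theorem idealMotive_le_comap_frob (p : Ideal A) :
    E.idealMotive p ≤ (E.idealMotive p).comap E.frob := by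
  rw [idealMotive, Submodule.span_le]
  rintro _ ⟨a, ha, m, rfl⟩
  rw [SetLike.mem_coe, Submodule.mem_comap, frob_smul]
  exact Submodule.subset_span ⟨a, ha, _, rfl⟩

/-- The Frobenius of `M / 𝔞 M`. -/
def quotientFrob (p : Ideal A) :
    (E.Motive ⧸ E.idealMotive p) →ₛₗ[(frobAlgHom k L).toRingHom] (E.Motive ⧸ E.idealMotive p) :=
  (E.idealMotive p).mapQ _ E.frob (E.idealMotive_le_comap_frob p)

theorem isUnit_lieAction {a : A} (ha : algebraMap A L a ≠ 0) : IsUnit (E.lieAction a) := by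
  have h1 : IsUnit (algebraMap L (Matrix (Fin d) (Fin d) L) (algebraMap A L a)) :=
    (IsUnit.mk0 _ ha).map _
  have h2 := (E.nilpotent a).isUnit_add_left_of_commute h1
    (Algebra.commutes (algebraMap A L a) _).symm
  rwa [add_sub_cancel] at h2

/-- This expresses that E[𝔭] is étale. Modulo τ(M) the element a acts on the coordinates by the
invertible matrix dφ_a, and aM ⊆ 𝔭M; hence the coordinates, and with them all of M, lie in the span
of τ(M) and 𝔭M. -/
theorem span_range_quotientFrob (p : Ideal A) {a : A} (hap : a ∈ p) (ha : algebraMap A L a ≠ 0) :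
    Submodule.span L (Set.range (E.quotientFrob p)) = ⊤ := by
  set S := Submodule.span L (Set.range E.frob) ⊔ E.idealMotive p with hS
  have hfr : ∀ m, E.frob m ∈ S := fun m =>
    Submodule.mem_sup_left (Submodule.subset_span ⟨m, rfl⟩)
  have h1 : ∀ i, ∑ j, E.lieAction a i j • E.coord j ∈ S := by
    intro i
    have h2 := E.sub_sum_coeff_smul_coord_mem (a • E.coord i)
    have h3 : (a • E.coord i).toPoly = E.φ a i := by
      rw [toPoly_smul]
      exact MvPolynomial.bind₁_X_right _ _
    rw [h3] at h2
    have h4 : a • E.coord i ∈ S :=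
      Submodule.mem_sup_right (Submodule.subset_span ⟨a, hap, _, rfl⟩)
    have h5 := sub_mem h4 (Submodule.mem_sup_left h2 : _ ∈ S)
    rwa [sub_sub_cancel] at h5
  have hcoord : ∀ i, E.coord i ∈ S := by
    intro i
    obtain ⟨u, hu⟩ := E.isUnit_lieAction ha
    have h2 : ∑ l, (↑u⁻¹ : Matrix (Fin d) (Fin d) L) i l • ∑ j, E.lieAction a l j • E.coord j
        = E.coord i := by
      simp only [Finset.smul_sum, smul_smul]
      rw [Finset.sum_comm]
      simp only [← Finset.sum_smul, ← Matrix.mul_apply, ← hu, Units.inv_mul, Matrix.one_apply]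
      simp
    rw [← h2]
    exact Submodule.sum_mem _ fun l _ => Submodule.smul_mem _ _ (h1 l)
  have htop : ∀ m, m ∈ S := fun m => E.motive_induction (p := (· ∈ S)) (zero_mem _) hcoord
    (fun m _ => hfr m) (fun c m h => Submodule.smul_mem _ c h) (fun m n => add_mem) m
  rw [eq_top_iff]
  rintro x -
  obtain ⟨m, rfl⟩ := (E.idealMotive p).mkQ_surjective x
  obtain ⟨y, hy, z, hz, rfl⟩ := Submodule.mem_sup.mp (htop m)
  rw [_root_.map_add, Submodule.mkQ_apply _ z, (Submodule.Quotient.mk_eq_zero _).mpr hz, add_zero]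
  have := Submodule.mem_map_of_mem (f := (E.idealMotive p).mkQ) hy
  rw [Submodule.map_span] at this
  refine Submodule.span_mono ?_ this
  rintro _ ⟨_, ⟨n, rfl⟩, rfl⟩
  exact ⟨(E.idealMotive p).mkQ n, rfl⟩

variable {F : Type*} [Field F] [Algebra L F]

/-- Evaluation of the motive at a point. -/
def evalAt (x : E.Points F) : E.Motive →ₗ[L] F :=
  (MvPolynomial.aeval (R := L) (x : Fin d → F)).toLinearMap ∘ₗ E.toPolyLinear

theorem evalAt_apply (x : E.Points F) (m : E.Motive) :
    E.evalAt x m = MvPolynomial.aeval (R := L) (x : Fin d → F) m.toPoly := rfl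

theorem evalAt_smul (x : E.Points F) (a : A) (m : E.Motive) :
    E.evalAt x (a • m) = E.evalAt (a • x) m := by
  rw [evalAt_apply, toPoly_smul]
  exact MvPolynomial.aeval_bind₁ (x : Fin d → F) (E.φ a) m.toPoly

theorem evalAt_zero (m : E.Motive) : E.evalAt (0 : E.Points F) m = 0 :=
  IsLinearPolynomial.aeval_zero (k := k) (f := m.toPoly) m.2

theorem evalAt_coord (x : E.Points F) (i : Fin d) :
    E.evalAt x (E.coord i) = (x : Fin d → F) i :=
  MvPolynomial.aeval_X (R := L) (x : Fin d → F) i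

theorem evalAt_frob (x : E.Points F) (m : E.Motive) :
    E.evalAt x (E.frob m) = E.evalAt x m ^ Nat.card k := by
  rw [evalAt_apply, toPoly_frob, map_pow]
  rfl

theorem mem_torsion_iff (p : Ideal A) (x : E.Points F) :
    x ∈ E.torsion F p ↔ ∀ a ∈ p, a • x = 0 := by
  simp [torsion, Submodule.mem_torsionBySet_iff]

/-- The point with coordinates given by the values of a functional on the motive. -/
def ofFunctional (h : E.Motive →ₗ[L] F) : E.Points F := fun i => h (E.coord i)

/-- Both sides agree on the coordinates and are compatible with τ and L, which generate the motive
from the coordinates. -/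
theorem evalAt_ofFunctional (h : E.Motive →ₗ[L] F)
    (hh : ∀ m, h (E.frob m) = h m ^ Nat.card k) : E.evalAt (E.ofFunctional h) = h := by
  refine LinearMap.ext fun m => ?_
  refine E.motive_induction (p := fun m => E.evalAt (E.ofFunctional h) m = h m) ?_ ?_ ?_ ?_ ?_ m
  · rw [_root_.map_zero, _root_.map_zero]
  · exact fun i => E.evalAt_coord _ i
  · intro m hm
    rw [evalAt_frob, hm, hh]
  · intro c m hm
    rw [map_smul, hm, map_smul]
  · intro m n hm hn
    rw [_root_.map_add, hm, hn, _root_.map_add]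

/-- The `𝔞`-torsion points of `E` are the Frobenius equivariant functionals on `M / 𝔞 M`. -/
def torsionEquiv (p : Ideal A) : E.torsion F p ≃
    {h : (E.Motive ⧸ E.idealMotive p) →ₗ[L] F //
      ∀ v, h (E.quotientFrob p v) = h v ^ Nat.card k} where
  toFun x := ⟨(E.idealMotive p).liftQ (E.evalAt x.1) (by
      rw [idealMotive, Submodule.span_le]
      rintro _ ⟨a, ha, m, rfl⟩
      rw [SetLike.mem_coe, LinearMap.mem_ker, evalAt_smul,
        (E.mem_torsion_iff p x.1).mp x.2 a ha, evalAt_zero]), by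
    intro v
    obtain ⟨m, rfl⟩ := (E.idealMotive p).mkQ_surjective v
    exact E.evalAt_frob x.1 m⟩
  invFun h := ⟨E.ofFunctional (h.1 ∘ₗ (E.idealMotive p).mkQ), by
    rw [mem_torsion_iff]
    intro a ha
    funext i
    refine (E.evalAt_coord _ i).symm.trans ?_
    rw [← evalAt_smul, evalAt_ofFunctional _ _ fun m => h.2 ((E.idealMotive p).mkQ m),
      LinearMap.comp_apply, Submodule.mkQ_apply,
      (Submodule.Quotient.mk_eq_zero (E.idealMotive p)).mpr
        (Submodule.subset_span ⟨a, ha, _, rfl⟩), _root_.map_zero]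
    rfl⟩
  left_inv x := Subtype.ext (funext fun i => E.evalAt_coord x.1 i)
  right_inv h := Subtype.ext (Submodule.linearMap_qext _
    (E.evalAt_ofFunctional _ fun m => h.2 ((E.idealMotive p).mkQ m)))

theorem natCard_torsion [IsSepClosed F] (p : Ideal A) {a : A} (hap : a ∈ p)
    (ha : algebraMap A L a ≠ 0) [FiniteDimensional L (E.Motive ⧸ E.idealMotive p)] :
    Nat.card (E.torsion F p) =
      Nat.card k ^ Module.finrank L (E.Motive ⧸ E.idealMotive p) := by
  let : Algebra k F := ((algebraMap L F).comp (algebraMap k L)).toAlgebra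
  rw [Nat.card_congr (E.torsionEquiv p)]
  refine natCard_frobenius_equivariant (k := k) (E.quotientFrob p).toAddMonoidHom
    (fun c v => ?_) (E.span_range_quotientFrob p hap ha)
  have := map_smulₛₗ (E.quotientFrob p) c v
  rw [← frobAlgHom_apply]
  exact this

end Torsion

/-! ### Dimension of M/𝔭M at primes where the denominators are invertible -/

section Reduction

variable {k A L : Type*} [Field k] [Finite k] [CommRing A] [Algebra k A] [Field L]
  [Algebra k L] [Algebra A L] {d : ℕ} (E : AndersonModule k A L d)

/-- Reduction modulo `𝔞` of the coefficients, `A ⊗ L → A/𝔞 ⊗ L`. -/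
def reduction (k L : Type*) [Field k] [Field L] [Algebra k L] [Algebra k A] (p : Ideal A) :
    A ⊗[k] L →ₐ[k] (A ⧸ p) ⊗[k] L :=
  Algebra.TensorProduct.map (Ideal.Quotient.mkₐ k p) (AlgHom.id k L)

/-- By right exactness of the tensor product, the kernel of the reduction is generated by the a ⊗ 1
with a ∈ 𝔭. -/
theorem smul_mem_idealMotive {p : Ideal A} {x : A ⊗[k] L} (hx : reduction k L p x = 0)
    (m : E.Motive) : x • m ∈ E.idealMotive p := by
  have h1 := Algebra.TensorProduct.rTensor_ker (R := k) (S := k) (A := A) (B := A ⧸ p) (C := L) (Ideal.Quotient.mkₐ k p)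
    (Ideal.Quotient.mkₐ_surjective k p)
  have h2 : x ∈ RingHom.ker (reduction k L p) := hx
  rw [reduction] at h2
  rw [h1] at h2
  refine Submodule.span_induction (p := fun x _ => ∀ m : E.Motive, x • m ∈ E.idealMotive p)
    ?_ ?_ ?_ ?_ h2 m
  · rintro _ ⟨a, ha, rfl⟩ m
    change (a ⊗ₜ[k] (1 : L)) • m ∈ _
    rw [tmul_smul, one_smul]
    exact Submodule.subset_span ⟨a, Ideal.Quotient.eq_zero_iff_mem.mp ha, m, rfl⟩
  · intro m; rw [zero_smul]; exact zero_mem _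
  · intro x y _ _ hx hy m; rw [add_smul]; exact add_mem (hx m) (hy m)
  · intro y x _ h m
    rw [smul_eq_mul, mul_comm, mul_smul]
    exact h _

theorem reduction_tmul {p : Ideal A} (a : A) (c : L) :
    reduction k L p (a ⊗ₜ c) = Ideal.Quotient.mk p a ⊗ₜ c := rfl

theorem reduction_twist (p : Ideal A) (x : A ⊗[k] L) :
    reduction k L p (twist k A L x) = twist k (A ⧸ p) L (reduction k L p x) := by
  induction x using TensorProduct.induction_on with
  | zero => simp only [_root_.map_zero]
  | add x y hx hy => simp only [_root_.map_add, hx, hy]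
  | tmul a c => rfl

variable {p : Ideal A} {r : ℕ} {v : Fin r → E.Motive} {f : A ⊗[k] L}

/-- After inverting the elements which are units modulo 𝔭, the family v generates M. The elements m
with this property include the coordinates and are stable under τ and L-linear combinations. -/
theorem exists_smul_mem_span_of_isUnit (hf : IsUnit (reduction k L p f))
    (hcoord : ∀ i, f • E.coord i ∈ Submodule.span (A ⊗[k] L) (Set.range v))
    (hfrob : ∀ i, f • E.frob (v i) ∈ Submodule.span (A ⊗[k] L) (Set.range v)) (m : E.Motive) :
    ∃ g, IsUnit (reduction k L p g) ∧ g • m ∈ Submodule.span (A ⊗[k] L) (Set.range v) := by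
  refine E.motive_induction (p := fun m => ∃ g, IsUnit (reduction k L p g) ∧
    g • m ∈ Submodule.span (A ⊗[k] L) (Set.range v)) ?_ ?_ ?_ ?_ ?_ m
  · exact ⟨f, hf, by rw [smul_zero]; exact zero_mem _⟩
  · exact fun i => ⟨f, hf, hcoord i⟩
  · rintro m ⟨g, hg, hm⟩
    -- Applying τ to g • m ∈ ⟨v⟩ puts the twisted multiple of τ(m) into the span of the τ(vᵢ), which
    -- `f` moves into ⟨v⟩. The twist commutes with reduction and so preserves units modulo 𝔭.
    refine ⟨f * twist k A L g, ?_, ?_⟩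
    · rw [_root_.map_mul, reduction_twist]
      exact hf.mul (hg.map _)
    · rw [mul_smul, ← frob_tensor_smul]
      obtain ⟨c, hc⟩ := (Submodule.mem_span_range_iff_exists_fun _).mp hm
      rw [← hc, map_sum, Finset.smul_sum]
      refine Submodule.sum_mem _ fun i _ => ?_
      rw [frob_tensor_smul, smul_comm]
      exact Submodule.smul_mem _ _ (hfrob i)
  · rintro c m ⟨g, hg, hm⟩
    refine ⟨g, hg, ?_⟩
    have : c • m = ((1 : A) ⊗ₜ[k] c) • m := by rw [tmul_smul, one_smul]
    rw [this, smul_comm]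
    exact Submodule.smul_mem _ _ hm
  · rintro m n ⟨g, hg, hm⟩ ⟨g', hg', hn⟩
    refine ⟨g * g', by rw [_root_.map_mul]; exact hg.mul hg', ?_⟩
    rw [smul_add]
    refine add_mem ?_ ?_
    · rw [mul_comm, mul_smul]
      exact Submodule.smul_mem _ _ hm
    · rw [mul_smul]
      exact Submodule.smul_mem _ _ hn

/-- Up to a multiplier that is a unit modulo 𝔭, every element of 𝔭M is a combination of v with
coefficients reducing to 0. Independence of v over A ⊗ L allows the coefficients to be compared. -/
theorem reduction_eq_zero_of_sum_mem (hv : LinearIndependent (A ⊗[k] L) v)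
    (hspan : ∀ m : E.Motive, ∃ g, IsUnit (reduction k L p g) ∧
      g • m ∈ Submodule.span (A ⊗[k] L) (Set.range v))
    (x : Fin r → A ⊗[k] L) (hx : ∑ i, x i • v i ∈ E.idealMotive p) (i : Fin r) :
    reduction k L p (x i) = 0 := by
  have key : ∀ m ∈ E.idealMotive p, ∃ (g : A ⊗[k] L) (y : Fin r → A ⊗[k] L),
      IsUnit (reduction k L p g) ∧ (∀ i, reduction k L p (y i) = 0) ∧
      g • m = ∑ i, y i • v i := by
    intro m hm
    rw [idealMotive] at hm
    induction hm using Submodule.span_induction with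
    | mem m hm =>
      obtain ⟨a, ha, m, rfl⟩ := hm
      obtain ⟨g, hg, hgm⟩ := hspan m
      obtain ⟨c, hc⟩ := (Submodule.mem_span_range_iff_exists_fun _).mp hgm
      refine ⟨g, fun i => (a ⊗ₜ 1) * c i, hg, fun i => ?_, ?_⟩
      · rw [_root_.map_mul, reduction_tmul, Ideal.Quotient.eq_zero_iff_mem.mpr ha,
          TensorProduct.zero_tmul, zero_mul]
      · have : a • m = (a ⊗ₜ[k] (1 : L)) • m := by rw [tmul_smul, one_smul]
        simp only [mul_smul]
        rw [this, smul_comm, ← hc, Finset.smul_sum]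
    | zero => exact ⟨1, 0, by simp, by simp, by simp⟩
    | add m n _ _ hm hn =>
      obtain ⟨g, y, hg, hy, h⟩ := hm
      obtain ⟨g', y', hg', hy', h'⟩ := hn
      refine ⟨g * g', fun i => g' * y i + g * y' i, ?_, fun i => ?_, ?_⟩
      · rw [_root_.map_mul]; exact hg.mul hg'
      · simp [hy, hy']
      · simp only [add_smul, mul_smul, Finset.sum_add_distrib, ← Finset.smul_sum, smul_add]
        rw [← h, ← h', smul_comm]
    | smul c m _ hm =>
      obtain ⟨g, y, hg, hy, h⟩ := hm
      have : c • m = ((1 : A) ⊗ₜ[k] c) • m := by rw [tmul_smul, one_smul]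
      refine ⟨g, fun i => ((1 : A) ⊗ₜ[k] c) * y i, hg, fun i => by simp [hy], ?_⟩
      simp only [mul_smul]
      rw [this, smul_comm, h, Finset.smul_sum]
  obtain ⟨g, y, hg, hy, h⟩ := key _ hx
  rw [Finset.smul_sum, ← sub_eq_zero, ← Finset.sum_sub_distrib] at h
  simp only [smul_smul, ← sub_smul] at h
  have h1 := Fintype.linearIndependent_iff.mp hv _ h i
  have h2 := congrArg (reduction k L p) h1
  rw [_root_.map_sub, _root_.map_mul, hy, sub_zero, _root_.map_zero] at h2
  exact hg.mul_right_eq_zero.mp h2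

/-- If the coefficients of a maximal independent family are invertible modulo `𝔞`, then this family
is a basis of `M / 𝔞 M` over `A/𝔞 ⊗ L`. -/
theorem finrank_quotient_idealMotive [Finite (A ⧸ p)] (hv : LinearIndependent (A ⊗[k] L) v)
    (hspan : ∀ m : E.Motive, ∃ g, IsUnit (reduction k L p g) ∧
      g • m ∈ Submodule.span (A ⊗[k] L) (Set.range v)) :
    FiniteDimensional L (E.Motive ⧸ E.idealMotive p) ∧
      Module.finrank L (E.Motive ⧸ E.idealMotive p) = r * Module.finrank k (A ⧸ p) := by
  let b := Module.finBasis k (A ⧸ p)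
  choose α hα using fun j => Ideal.Quotient.mk_surjective (b j)
  let Θ : (Fin r × Fin (Module.finrank k (A ⧸ p)) → L) →ₗ[L] E.Motive ⧸ E.idealMotive p :=
    (E.idealMotive p).mkQ ∘ₗ Fintype.linearCombination L fun x => α x.2 • v x.1
  have hΘ : ∀ c, Θ c = (E.idealMotive p).mkQ
      (∑ i, (∑ j, α j ⊗ₜ[k] c (i, j)) • v i) := by
    intro c
    simp only [Θ, LinearMap.comp_apply, Fintype.linearCombination_apply]
    congr 1
    rw [Fintype.sum_prod_type]
    refine Finset.sum_congr rfl fun i _ => ?_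
    rw [Finset.sum_smul]
    refine Finset.sum_congr rfl fun j _ => ?_
    rw [tmul_smul, smul_comm (α j)]
  have hred : ∀ c : Fin (Module.finrank k (A ⧸ p)) → L,
      reduction k L p (∑ j, α j ⊗ₜ[k] c j) = ∑ j, b j ⊗ₜ[k] c j := by
    intro c
    rw [map_sum]
    exact Finset.sum_congr rfl fun j _ => by rw [reduction_tmul, hα]
  have hinj : Function.Injective Θ := by
    rw [injective_iff_map_eq_zero]
    intro c hc
    rw [hΘ, Submodule.mkQ_apply, Submodule.Quotient.mk_eq_zero] at hc
    funext x
    have h1 := E.reduction_eq_zero_of_sum_mem hv hspan _ hc x.1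
    rw [hred] at h1
    exact TensorProduct.eq_zero_of_sum_tmul_eq_zero b.linearIndependent h1 (Finset.mem_univ x.2)
  have hsurj : Function.Surjective Θ := by
    intro w
    obtain ⟨m, rfl⟩ := (E.idealMotive p).mkQ_surjective w
    obtain ⟨g, ⟨u, hu⟩, hg⟩ := hspan m
    obtain ⟨y, hy⟩ := (Submodule.mem_span_range_iff_exists_fun _).mp hg
    -- Since `g'` lifts the inverse of the reduction of `g`, m is congruent to g'g • m modulo 𝔭M,
    -- and this is a combination of `v`.
    obtain ⟨g', hg'⟩ : ∃ g', reduction k L p g' = ↑u⁻¹ :=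
      Algebra.TensorProduct.map_surjective (R := k) (S := k) (Ideal.Quotient.mkₐ k p)
        (AlgHom.id k L) (Ideal.Quotient.mkₐ_surjective k p) Function.surjective_id _
    have h1 : m - ∑ i, (g' * y i) • v i ∈ E.idealMotive p := by
      simp only [mul_smul, ← Finset.smul_sum]
      rw [hy, smul_smul, ← one_smul (A ⊗[k] L) m, smul_smul, ← sub_smul]
      refine E.smul_mem_idealMotive ?_ m
      rw [_root_.map_sub, _root_.map_mul, _root_.map_mul, hg', ← hu]
      simp
    choose c hc using fun i => TensorProduct.eq_repr_basis_left b (reduction k L p (g' * y i))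
    have hc' : ∀ i, ∑ j, b j ⊗ₜ[k] c i j = reduction k L p (g' * y i) := fun i => by
      rw [← hc i, Finsupp.sum_fintype _ _ (by simp)]
    refine ⟨fun x => c x.1 x.2, ?_⟩
    rw [hΘ, Submodule.mkQ_apply, Submodule.mkQ_apply, Submodule.Quotient.eq]
    have h2 : ∑ i, (∑ j, α j ⊗ₜ[k] c i j) • v i - ∑ i, (g' * y i) • v i ∈ E.idealMotive p := by
      rw [← Finset.sum_sub_distrib]
      refine Submodule.sum_mem _ fun i _ => ?_
      rw [← sub_smul]
      refine E.smul_mem_idealMotive ?_ _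
      rw [_root_.map_sub, hred, hc', sub_self]
    have h3 := sub_mem h2 h1
    convert h3 using 1
    abel
  let e := LinearEquiv.ofBijective Θ ⟨hinj, hsurj⟩
  refine ⟨Module.Finite.equiv e, ?_⟩
  rw [← e.finrank_eq, Module.finrank_fintype_fun_eq_card]
  simp

/-- The rank of the motive is finite, and it is the rank of the `𝔭`-torsion if a certain nonzero
element of `A ⊗ L` is invertible modulo `𝔭`. -/
theorem exists_motiveRank_eq_and_natCard_torsion [IsDomain (A ⊗[k] L)] {t : A}
    (ht : LinearIndependent k (fun j : ℕ => t ^ j)) (F : Type*) [Field F] [Algebra L F]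
    [IsSepClosed F] :
    ∃ (r : ℕ) (f : A ⊗[k] L), E.motiveRank = r ∧ f ≠ 0 ∧ ∀ p : Ideal A, Finite (A ⧸ p) →
      (∃ a ∈ p, algebraMap A L a ≠ 0) → IsUnit (reduction k L p f) →
      Nat.card (E.torsion F p) = Nat.card (A ⧸ p) ^ r := by
  obtain ⟨r, v, f, hr, hv, hf0, hcoord, hfrob⟩ := E.exists_basis_of_motive ht
  refine ⟨r, f, hr, hf0, fun p _ ⟨a, hap, ha⟩ hf => ?_⟩
  obtain ⟨_, h2⟩ := E.finrank_quotient_idealMotive hv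
    (E.exists_smul_mem_span_of_isUnit hf hcoord hfrob)
  rw [E.natCard_torsion p hap ha, h2, Module.natCard_eq_pow_finrank (K := k) (V := A ⧸ p),
    ← pow_mul, mul_comm]

end Reduction

end AndersonModule

/-! ### The ring `A ⊗ L` -/

section TensorDomain

variable {k K : Type*} [Field k] [Field K] [Algebra k K]

open Polynomial in
-- The coefficients of the minimal polynomial over K are integral over k, hence lie in k, so the two
-- minimal polynomials have the same degree.
theorem minpoly.natDegree_eq_of_algebraicallyClosed
    (hconst : ∀ x : K, IsAlgebraic k x → x ∈ Set.range (algebraMap k K))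
    {Ω : Type*} [Field Ω] [Algebra k Ω] [Algebra K Ω] [IsScalarTower k K Ω] {β : Ω}
    (hβ : IsIntegral k β) : (minpoly K β).natDegree = (minpoly k β).natDegree := by
  have hβK : IsIntegral K β := hβ.tower_top
  have hdvd : minpoly K β ∣ (minpoly k β).map (algebraMap k K) :=
    minpoly.dvd_map_of_isScalarTower k K β
  refine le_antisymm ?_ ?_
  · have := natDegree_le_of_dvd hdvd
      ((minpoly.monic hβ).map (algebraMap k K)).ne_zero
    rwa [natDegree_map] at this
  · have hlift : minpoly K β ∈ lifts (algebraMap k K) := by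
      rw [lifts_iff_coeff_lifts]
      intro i
      exact hconst _ (isIntegral_coeff_of_dvd _ _ (minpoly.monic hβ) (minpoly.monic hβK) hdvd
        i).isAlgebraic
    obtain ⟨h, hh⟩ := (mem_lifts _).mp hlift
    have h0 : h ≠ 0 := by
      rintro rfl
      exact minpoly.ne_zero hβK (by rw [← hh, Polynomial.map_zero])
    have h1 : minpoly k β ∣ h := by
      refine minpoly.dvd k β ?_
      rw [← aeval_map_algebraMap K, hh, minpoly.aeval]
    rw [← hh, natDegree_map]
    exact natDegree_le_of_dvd h1 h0

/-- For a primitive element α of k'/k, the powers of its image in an algebraic closure of K stay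
independent over K up to the degree of α. Thus K ⊗ k' embeds into that closure. -/
theorem isDomain_tensorProduct_of_finiteDimensional [PerfectField k]
    (hconst : ∀ x : K, IsAlgebraic k x → x ∈ Set.range (algebraMap k K))
    (k' : Type*) [Field k'] [Algebra k k'] [FiniteDimensional k k'] : IsDomain (K ⊗[k] k') := by
  obtain ⟨α, hα⟩ := Field.exists_primitive_element k k'
  let pb := (IntermediateField.adjoin.powerBasis (Algebra.IsIntegral.isIntegral (R := k) α)).map
    ((IntermediateField.equivOfEq hα).trans IntermediateField.topEquiv)
  let Ω := AlgebraicClosure K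
  let ι : k' →ₐ[k] Ω := IsAlgClosed.lift
  let φ : K ⊗[k] k' →ₐ[K] Ω := Algebra.TensorProduct.lift (Algebra.ofId K Ω) ι
    fun _ _ => Commute.all _ _
  have hgen : pb.gen = α := by simp [pb]
  have hβ : IsIntegral k (ι pb.gen) := (Algebra.IsIntegral.isIntegral pb.gen).map ι
  have hdim : (minpoly K (ι pb.gen)).natDegree = pb.dim := by
    rw [minpoly.natDegree_eq_of_algebraicallyClosed hconst hβ,
      minpoly.algHom_eq ι ι.injective, pb.natDegree_minpoly]
  have hφ : Function.Injective φ := by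
    rw [injective_iff_map_eq_zero]
    intro x hx
    obtain ⟨c, rfl⟩ := TensorProduct.eq_repr_basis_right (M := K) pb.basis x
    rw [Finsupp.sum_fintype _ _ (by simp)] at hx ⊢
    have hli := (linearIndependent_pow (K := K) (ι pb.gen))
    rw [hdim] at hli
    have hsum : ∑ i, c i • (ι pb.gen) ^ (i : ℕ) = 0 := by
      rw [← hx, map_sum]
      refine Finset.sum_congr rfl fun i _ => ?_
      simp [φ, Algebra.ofId_apply, Algebra.smul_def]
    have := Fintype.linearIndependent_iff.mp hli _ hsum
    simp [this]
  exact hφ.isDomain φ.toRingHom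

/-- If `k` is perfect and algebraically closed in `K`, then `L ⊗ K` is a domain for all extension
fields `L`. -/
theorem isDomain_tensorProduct_of_algebraicallyClosed [PerfectField k]
    (hconst : ∀ x : K, IsAlgebraic k x → x ∈ Set.range (algebraMap k K))
    (L : Type*) [Field L] [Algebra k L] : IsDomain (K ⊗[k] L) := by
  have hnt : Nontrivial (K ⊗[k] L) := inferInstance
  refine @NoZeroDivisors.to_isDomain _ _ hnt ⟨fun {x y} hxy => ?_⟩
  by_contra! hne
  obtain ⟨hx, hy⟩ := hne
  let e := Module.Basis.ofVectorSpace k K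
  obtain ⟨c, rfl⟩ := TensorProduct.eq_repr_basis_left (N := L) e x
  obtain ⟨c', rfl⟩ := TensorProduct.eq_repr_basis_left (N := L) e y
  obtain ⟨i, hi⟩ := Finsupp.ne_iff.mp (fun h => hx (by rw [h, Finsupp.sum_zero_index]) : c ≠ 0)
  obtain ⟨j, hj⟩ := Finsupp.ne_iff.mp (fun h => hy (by rw [h, Finsupp.sum_zero_index]) : c' ≠ 0)
  rw [Finsupp.zero_apply] at hi hj
  -- A zero-divisor relation involves only a finitely generated k-subalgebra of `L`. Adjoining the
  -- inverses of one nonzero coefficient of each factor keeps both factors nonzero modulo every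
  -- maximal ideal.
  let S : Set L := ((c '' c.support) ∪ (c' '' c'.support)) ∪ {(c i)⁻¹, (c' j)⁻¹}
  have hSf : S.Finite := Set.Finite.union ((c.support.finite_toSet.image _).union
    (c'.support.finite_toSet.image _)) (by simp)
  let B := Algebra.adjoin k S
  have hft : Algebra.FiniteType k B :=
    (Subalgebra.fg_iff_finiteType _).mp (Subalgebra.fg_def.mpr ⟨S, hSf, rfl⟩)
  have hSB : S ⊆ B := Algebra.subset_adjoin
  have hc : ∀ l, c l ∈ B := fun l => by
    by_cases h : c l = 0
    · rw [h]; exact zero_mem _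
    · exact hSB (Or.inl (Or.inl ⟨l, by simpa using h, rfl⟩))
  have hc' : ∀ l, c' l ∈ B := fun l => by
    by_cases h : c' l = 0
    · rw [h]; exact zero_mem _
    · exact hSB (Or.inl (Or.inr ⟨l, by simpa using h, rfl⟩))
  have hu : IsUnit (⟨c i, hc i⟩ : B) := IsUnit.of_mul_eq_one ⟨(c i)⁻¹, hSB (Or.inr (by simp))⟩
    (Subtype.ext (mul_inv_cancel₀ hi))
  have hu' : IsUnit (⟨c' j, hc' j⟩ : B) := IsUnit.of_mul_eq_one ⟨(c' j)⁻¹, hSB (Or.inr (by simp))⟩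
    (Subtype.ext (mul_inv_cancel₀ hj))
  let x₀ : K ⊗[k] B := ∑ l ∈ c.support, e l ⊗ₜ ⟨c l, hc l⟩
  let y₀ : K ⊗[k] B := ∑ l ∈ c'.support, e l ⊗ₜ ⟨c' l, hc' l⟩
  have hinj : Function.Injective (Algebra.TensorProduct.map (AlgHom.id k K) B.val) :=
    Module.Flat.lTensor_preserves_injective_linearMap B.val.toLinearMap Subtype.val_injective
  have hxy₀ : x₀ * y₀ = 0 := by
    apply hinj
    rw [map_mul, map_zero, ← hxy]
    simp only [x₀, y₀, map_sum, Algebra.TensorProduct.map_tmul]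
    rfl
  obtain ⟨m, hm⟩ := Ideal.exists_maximal B
  let : Field (B ⧸ m) := Ideal.Quotient.field m
  -- By the Nullstellensatz the residue field is finite over `k`, which reduces the claim to the
  -- finite-dimensional case.
  have : FiniteDimensional k (B ⧸ m) := finite_of_finite_type_of_isJacobsonRing k (B ⧸ m)
  have := isDomain_tensorProduct_of_finiteDimensional hconst (B ⧸ m)
  have h1 := congrArg (Algebra.TensorProduct.map (AlgHom.id k K) (Ideal.Quotient.mkₐ k m)) hxy₀
  rw [map_mul, map_zero, mul_eq_zero] at h1
  rcases h1 with h1 | h1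
  · simp only [x₀, map_sum, Algebra.TensorProduct.map_tmul] at h1
    have h2 := TensorProduct.eq_zero_of_sum_tmul_eq_zero (i := i) e.linearIndependent h1
      (by simpa using hi)
    exact (hu.map (Ideal.Quotient.mk m)).ne_zero h2
  · simp only [y₀, map_sum, Algebra.TensorProduct.map_tmul] at h1
    have h2 := TensorProduct.eq_zero_of_sum_tmul_eq_zero (i := j) e.linearIndependent h1
      (by simpa using hj)
    exact (hu'.map (Ideal.Quotient.mk m)).ne_zero h2

end TensorDomain

/-! ### Invertibility modulo almost all primes -/

section BadPrimes

variable {k L : Type*} [Field k] [Field L] [Algebra k L]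

-- A prime factor of h in L[X] either divides some nonzero b' ∈ k[X], which is then put into b, or
-- divides the image of no nonzero a ∈ k[X] and imposes no condition.
open Polynomial in
theorem Polynomial.exists_isCoprime_map (h : L[X]) (hh : h ≠ 0) :
    ∃ b : k[X], b ≠ 0 ∧ ∀ a : k[X], IsCoprime a b → IsCoprime (a.map (algebraMap k L)) h := by
  have key : ∃ b : k[X], b ≠ 0 ∧ ∀ a : k[X], a ≠ 0 → IsCoprime a b →
      IsCoprime (a.map (algebraMap k L)) h := by
    induction h using UniqueFactorizationMonoid.induction_on_prime with
    | h₁ => exact absurd rfl hh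
    | h₂ h hu =>
      exact ⟨1, one_ne_zero, fun a _ _ => isCoprime_one_right.of_isCoprime_of_dvd_right hu.dvd⟩
    | h₃ h p hp0 hp ih =>
      obtain ⟨b, hb0, hb⟩ := ih hp0
      by_cases hex : ∃ b' : k[X], b' ≠ 0 ∧ p ∣ b'.map (algebraMap k L)
      · obtain ⟨b', hb'0, hb'⟩ := hex
        refine ⟨b' * b, mul_ne_zero hb'0 hb0, fun a ha hab => ?_⟩
        refine IsCoprime.mul_right ?_ (hb a ha hab.of_mul_right_right)
        exact (hab.of_mul_right_left.map (mapRingHom (algebraMap k L))).of_isCoprime_of_dvd_right hb'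
      · push Not at hex
        refine ⟨b, hb0, fun a ha hab => IsCoprime.mul_right ?_ (hb a ha hab)⟩
        exact ((hp.irreducible.coprime_iff_not_dvd).mpr (hex a ha)).symm
  obtain ⟨b, hb0, hb⟩ := key
  -- The extra factor `X` excludes a = 0, since 0 is not coprime to a nonunit.
  refine ⟨X * b, mul_ne_zero X_ne_zero hb0, fun a hab => hb a ?_ hab.of_mul_right_right⟩
  rintro rfl
  exact not_isUnit_X (isCoprime_zero_left.mp hab.of_mul_right_left)

open Polynomial in
/-- A nonzero element of `A ⊗ L` is invertible modulo almost all primes of `A`. -/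
theorem exists_isUnit_reduction {A : Type*} [CommRing A] [IsDomain A] [Algebra k A]
    [IsDomain (A ⊗[k] L)] {t : A} (ht : Transcendental k t)
    (hint : ∀ a : A, (aeval t : k[X] →ₐ[k] A).toRingHom.IsIntegralElem a)
    {f : A ⊗[k] L} (hf : f ≠ 0) :
    ∃ b : A, b ≠ 0 ∧ ∀ p : Ideal A, p.IsPrime → p ≠ ⊥ → b ∉ p →
      IsUnit (AndersonModule.reduction k L p f) := by
  let : Algebra k[X] A := (aeval t : k[X] →ₐ[k] A).toRingHom.toAlgebra
  have : Algebra.IsIntegral k[X] A := ⟨hint⟩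
  let η : L[X] →+* A ⊗[k] L :=
    eval₂RingHom (Algebra.TensorProduct.includeRight : L →ₐ[k] A ⊗[k] L).toRingHom (t ⊗ₜ 1)
  have hη : η.comp (mapRingHom (algebraMap k L))
      = (Algebra.TensorProduct.includeLeft : A →ₐ[k] A ⊗[k] L).toRingHom.comp
        (algebraMap k[X] A) := by
    refine Polynomial.ringHom_ext (fun c => ?_) ?_
    · simp [η, RingHom.algebraMap_toAlgebra, Algebra.TensorProduct.algebraMap_apply]
    · simp [η, RingHom.algebraMap_toAlgebra]
  let : Algebra L[X] (A ⊗[k] L) := η.toAlgebra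
  have hR : ∀ x : A ⊗[k] L, IsIntegral L[X] x := by
    intro x
    induction x using TensorProduct.induction_on with
    | zero => exact isIntegral_zero
    | add x y hx hy => exact hx.add hy
    | tmul a c =>
      have h1 : a ⊗ₜ[k] c = (a ⊗ₜ 1) * algebraMap L[X] (A ⊗[k] L) (C c) := by
        simp [RingHom.algebraMap_toAlgebra, η]
      rw [h1]
      refine IsIntegral.mul ?_ isIntegral_algebraMap
      obtain ⟨g, hg, hga⟩ := hint a
      refine ⟨g.map (mapRingHom (algebraMap k L)), hg.map _, ?_⟩
      rw [eval₂_map, RingHom.algebraMap_toAlgebra, hη]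
      have := congrArg (Algebra.TensorProduct.includeLeft : A →ₐ[k] A ⊗[k] L).toRingHom hga
      rw [hom_eval₂, map_zero] at this
      exact this
  -- By integrality over `L[X]`, with X acting as t, the ideal generated by `f` contains the image
  -- of a nonzero polynomial `h`.
  have h1 := Ideal.comap_ne_bot_of_integral_mem hf (Ideal.mem_span_singleton_self f) (hR f)
  obtain ⟨h, hh, hh0⟩ := Submodule.exists_mem_ne_zero_of_ne_bot h1
  obtain ⟨g, hg⟩ := Ideal.mem_span_singleton.mp (Ideal.mem_comap.mp hh)
  obtain ⟨b, hb0, hb⟩ := Polynomial.exists_isCoprime_map (k := k) h hh0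
  refine ⟨aeval t b, fun h0 => hb0 (transcendental_iff.mp ht b h0), fun p hp hp0 hbp => ?_⟩
  have hmax : (p.comap (algebraMap k[X] A)).IsMaximal := by
    have : (p.comap (algebraMap k[X] A)).IsPrime := Ideal.IsPrime.comap _
    refine this.isMaximal ?_
    obtain ⟨a, ha, ha0⟩ := Submodule.exists_mem_ne_zero_of_ne_bot hp0
    exact Ideal.comap_ne_bot_of_integral_mem ha0 ha (hint a)
  -- As b is a unit modulo the maximal ideal 𝔭 ∩ k[X], some `a` in that ideal is coprime to b, hence
  -- to h over L. A Bézout relation between a and h becomes, modulo 𝔭, an inverse of h, and f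
  -- divides h.
  obtain ⟨y, a, ha, hya⟩ := hmax.exists_inv (x := b) hbp
  obtain ⟨u, w, huw⟩ := hb a ⟨1, y, by rw [one_mul, add_comm, hya]⟩
  have h2 : AndersonModule.reduction k L p (η (a.map (algebraMap k L))) = 0 := by
    have h3 : η (a.map (algebraMap k L)) = (algebraMap k[X] A a) ⊗ₜ 1 := congrArg (fun g => g a) hη
    rw [h3]
    change (Ideal.Quotient.mk p (algebraMap k[X] A a)) ⊗ₜ[k] (1 : L) = 0
    rw [Ideal.Quotient.eq_zero_iff_mem.mpr (show algebraMap _ _ a ∈ p from ha),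
      TensorProduct.zero_tmul]
  have h4 := congrArg (fun z => AndersonModule.reduction k L p (η z)) huw
  simp only [map_add, map_mul, h2, mul_zero, zero_add, map_one] at h4
  rw [show η h = f * g from hg, map_mul] at h4
  exact IsUnit.of_mul_eq_one (AndersonModule.reduction k L p g *
    AndersonModule.reduction k L p (η w)) (by rw [← h4]; ring)

end BadPrimes

/-! ### Function fields in one variable -/

section FunctionField

open Polynomial

variable {k K : Type*} [Field k] [Field K] [Algebra k K]

theorem IsCurveFunctionField.essFiniteType (hK : IsCurveFunctionField k K) :
    Algebra.EssFiniteType k K := by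
  obtain ⟨x, -, hx⟩ := hK.exists_transcendental
  have : Algebra.EssFiniteType k (IntermediateField.adjoin k {x}) :=
    IntermediateField.essFiniteType_iff.mpr ⟨{x}, by simp⟩
  exact Algebra.EssFiniteType.comp k (IntermediateField.adjoin k {x}) K

open IntermediateField.algebraAdjoinAdjoin in
theorem IsCurveFunctionField.trdeg_eq_one (hK : IsCurveFunctionField k K) :
    Algebra.trdeg k K = 1 := by
  obtain ⟨x, hx, hfin⟩ := hK.exists_transcendental
  have halg : Algebra.IsAlgebraic (Algebra.adjoin k {x}) K :=
    IsFractionRing.comap_isAlgebraic_iff (K := IntermediateField.adjoin k {x}) |>.mpr inferInstance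
  have hb : IsTranscendenceBasis k (fun _ : Unit => x) := by
    rw [isTranscendenceBasis_iff_algebraicIndependent_isAlgebraic, Set.range_const]
    exact ⟨(algebraicIndependent_unique_type_iff).mpr hx, halg⟩
  have := hb.lift_cardinalMk_eq_trdeg
  simpa using this.symm

theorem IsCurveFunctionField.isAlgebraic_adjoin (hK : IsCurveFunctionField k K) {y : K}
    (hy : Transcendental k y) : Algebra.IsAlgebraic (Algebra.adjoin k {y}) K := by
  have hi : AlgebraicIndependent k (fun _ : Unit => y) :=
    (algebraicIndependent_unique_type_iff).mpr hy
  have hb := hi.isTranscendenceBasis_of_lift_trdeg_le_of_finite (by simp [hK.trdeg_eq_one])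
  rw [isTranscendenceBasis_iff_algebraicIndependent_isAlgebraic, Set.range_const] at hb
  exact hb.2

/-- A curve function field is a finite extension of every subfield `k(y)` with `y` not constant. -/
theorem IsCurveFunctionField.exists_functionField (hK : IsCurveFunctionField k K)
    [Algebra k[X] K] [IsScalarTower k k[X] K]
    (hy : Function.Injective (algebraMap k[X] K)) :
    ∃ _ : Algebra (RatFunc k) K, IsScalarTower k[X] (RatFunc k) K ∧ FunctionField k K := by
  let : Algebra (RatFunc k) K := (IsFractionRing.lift hy : RatFunc k →+* K).toAlgebra
  have h1 : IsScalarTower k[X] (RatFunc k) K :=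
    IsScalarTower.of_algebraMap_eq fun g => (IsFractionRing.lift_algebraMap hy g).symm
  have h2 : IsScalarTower k (RatFunc k) K := IsScalarTower.of_algebraMap_eq fun c => by
    rw [IsScalarTower.algebraMap_apply k k[X] (RatFunc k), ← IsScalarTower.algebraMap_apply k[X],
      ← IsScalarTower.algebraMap_apply k]
  refine ⟨this, h1, ?_⟩
  have := hK.essFiniteType
  have := Algebra.EssFiniteType.of_comp k (RatFunc k) K
  have haeval : ∀ g : k[X], aeval (algebraMap k[X] K X) g = algebraMap k[X] K g := fun g => by
    rw [aeval_algebraMap_apply, aeval_X_left_apply]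
  have hyt : Transcendental k (algebraMap k[X] K X) := transcendental_iff.mpr fun g hg =>
    hy (by rw [← haeval, hg, map_zero])
  have halg := hK.isAlgebraic_adjoin hyt
  have : Algebra.IsAlgebraic k[X] K := by
    refine ⟨fun z => (halg.isAlgebraic z).of_ringHom_of_comp_eq
      ((Subalgebra.equivOfEq _ _ (Algebra.adjoin_singleton_eq_range_aeval k
        (algebraMap k[X] K X)).symm).toAlgHom.comp
        (aeval (algebraMap k[X] K X) : k[X] →ₐ[k] K).rangeRestrict) (RingHom.id K) ?_
        Function.injective_id (RingHom.ext haeval)⟩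
    exact ((Subalgebra.equivOfEq _ _ (Algebra.adjoin_singleton_eq_range_aeval k
      (algebraMap k[X] K X)).symm).surjective).comp
      (aeval (algebraMap k[X] K X) : k[X] →ₐ[k] K).rangeRestrict_surjective
  have : Algebra.IsAlgebraic (RatFunc k) K := IsFractionRing.comap_isAlgebraic_iff
    (A := k[X]) |>.mp this
  exact Algebra.finite_of_essFiniteType_of_isAlgebraic

end FunctionField

/-! ### Integral closures of k[X] in function fields -/

section IntegralClosure

open Polynomial

variable {k K : Type*} [Field k] [Field K] [Algebra k[X] K] [Algebra (RatFunc k) K] [IsScalarTower k[X] (RatFunc k) K]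
  [FunctionField k K] (B : Type*) [CommRing B] [Algebra k[X] B] [Algebra B K]
  [IsScalarTower k[X] B K] [IsIntegralClosure B k[X] K] [Algebra k B] [IsScalarTower k k[X] B]

/-- The extension may be inseparable, so B is not assumed finite over k[X]. A finite independent
subset of B/hB is lifted to a finitely generated k[X]-submodule of B; it is free of rank at most [K
: k(X)], and division by h shows that its image is spanned by deg h powers of X times a basis. -/
theorem FunctionField.finrank_quotient_le (h : k[X]) (hh : h ≠ 0) :
    Module.Finite k (B ⧸ Ideal.span {algebraMap k[X] B h}) ∧
      Module.finrank k (B ⧸ Ideal.span {algebraMap k[X] B h})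
        ≤ Module.finrank (RatFunc k) K * h.natDegree := by
  have hinj : Function.Injective (algebraMap k[X] K) := FunctionField.algebraMap_injective k K
  have hBK : Function.Injective (algebraMap B K) := IsIntegralClosure.algebraMap_injective B k[X] K
  suffices hrank : Module.rank k (B ⧸ Ideal.span {algebraMap k[X] B h})
      ≤ (Module.finrank (RatFunc k) K * h.natDegree : ℕ) by
    have hfin : Module.Finite k (B ⧸ Ideal.span {algebraMap k[X] B h}) :=
      Module.rank_lt_aleph0_iff.mp (hrank.trans_lt Cardinal.natCast_lt_aleph0)
    exact ⟨hfin, by rw [← Module.finrank_eq_rank] at hrank; exact_mod_cast hrank⟩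
  refine rank_le fun s hs => ?_
  let π := Ideal.Quotient.mkₐ k (Ideal.span {algebraMap k[X] B h})
  let σ := Function.surjInv (Ideal.Quotient.mkₐ_surjective k (Ideal.span {algebraMap k[X] B h}))
  let N : Submodule k[X] B := Submodule.span k[X] (σ '' s)
  have hN : N.FG := Submodule.fg_span (s.finite_toSet.image σ)
  have : Module.Finite k[X] N := Module.Finite.iff_fg.mpr hN
  have hsm : ∀ (g : k[X]) (b : B), g • b = 0 → g = 0 ∨ b = 0 := by
    intro g b hgb
    have h1 : algebraMap k[X] K g * algebraMap B K b = 0 := by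
      rw [IsScalarTower.algebraMap_apply k[X] B K, ← map_mul, ← Algebra.smul_def, hgb, map_zero]
    exact (mul_eq_zero.mp h1).imp (fun h2 => hinj (by rw [h2, map_zero]))
      (fun h2 => hBK (by rw [h2, map_zero]))
  have : Module.IsTorsionFree k[X] N := .of_smul_eq_zero fun g m hgm =>
    (hsm g m (congrArg N.subtype hgm)).imp_right Subtype.ext
  let e := Module.finBasis k[X] N
  set r := Module.finrank k[X] N with hr
  have hrn : r ≤ Module.finrank (RatFunc k) K := by
    have h1 : LinearIndependent k[X] fun i => ((IsScalarTower.toAlgHom k[X] B K).toLinearMap ∘ₗ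
        N.subtype) (e i) :=
      e.linearIndependent.map_injOn _ (hBK.comp Subtype.val_injective).injOn
    have h2 := (LinearIndependent.iff_fractionRing k[X] (RatFunc k)).mp h1
    simpa using h2.fintype_card_le_finrank
  let w : Fin r × Fin h.natDegree → B ⧸ Ideal.span {algebraMap k[X] B h} :=
    fun ij => π ((X ^ (ij.2 : ℕ) : k[X]) • (e ij.1 : B))
  have hspan : (s : Set (B ⧸ Ideal.span {algebraMap k[X] B h})) ⊆ Submodule.span k (Set.range w) := by
    intro z hz
    have hzN : σ z ∈ N := Submodule.subset_span ⟨z, hz, rfl⟩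
    have h1 : z = π (∑ i, e.repr ⟨σ z, hzN⟩ i • (e i : B)) := by
      have h2 := congrArg N.subtype (e.sum_repr ⟨σ z, hzN⟩)
      rw [map_sum] at h2
      simp only [map_smul, Submodule.subtype_apply] at h2
      rw [h2]
      exact (Function.surjInv_eq (Ideal.Quotient.mkₐ_surjective k _) z).symm
    rw [h1, map_sum]
    refine Submodule.sum_mem _ fun i _ => ?_
    generalize e.repr ⟨σ z, hzN⟩ i = g
    have h3 : π (g • (e i : B)) = π ((g % h) • (e i : B)) := by
      conv_lhs => rw [← EuclideanDomain.mod_add_div g h, add_smul, map_add]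
      rw [add_eq_left]
      refine Ideal.Quotient.eq_zero_iff_mem.mpr ?_
      rw [Algebra.smul_def, map_mul, mul_assoc]
      exact Ideal.mul_mem_right _ _ (Ideal.mem_span_singleton_self _)
    have hdeg : ∀ j ∈ (g % h).support, j < h.natDegree := fun j hj => by
      have h4 := (le_degree_of_mem_supp j hj).trans_lt (degree_mod_lt g hh)
      rw [degree_eq_natDegree hh] at h4
      exact_mod_cast h4
    rw [h3, (g % h).as_sum_support, Finset.sum_smul, map_sum]
    refine Submodule.sum_mem _ fun j hj => ?_
    rw [← smul_X_eq_monomial, smul_assoc, map_smul]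
    exact Submodule.smul_mem _ _ (Submodule.subset_span ⟨(i, ⟨j, hdeg j hj⟩), rfl⟩)
  classical
  have h5 := (linearIndependent_le_span_aux' _ hs (Set.range w) (by simpa using hspan)).trans
    (Fintype.card_range_le w)
  simp only [Fintype.card_coe, Fintype.card_prod, Fintype.card_fin] at h5
  exact h5.trans (Nat.mul_le_mul_right _ hrn)

theorem FunctionField.hasFiniteQuotients {k : Type*} (K : Type*) [Field k] [Finite k] [Field K]
    [Algebra k[X] K] [Algebra (RatFunc k) K] [IsScalarTower k[X] (RatFunc k) K]
    [FunctionField k K] (B : Type*) [CommRing B] [Algebra k[X] B] [Algebra B K]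
    [IsScalarTower k[X] B K] [IsIntegralClosure B k[X] K]
    [Algebra k B] [IsScalarTower k k[X] B] : Ring.HasFiniteQuotients B := by
  refine ⟨fun {I} hI => ?_⟩
  have hBK : Function.Injective (algebraMap B K) := IsIntegralClosure.algebraMap_injective B k[X] K
  have : IsDomain B := hBK.isDomain (algebraMap B K)
  obtain ⟨b, hb, hb0⟩ := Submodule.exists_mem_ne_zero_of_ne_bot hI
  obtain ⟨h, hh, hh0⟩ := Submodule.exists_mem_ne_zero_of_ne_bot
    (Ideal.comap_ne_bot_of_integral_mem hb0 hb
      ((IsIntegralClosure.isIntegral_algebra k[X] K (A := B)).isIntegral b))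
  obtain ⟨hfin, -⟩ := FunctionField.finrank_quotient_le (K := K) B h hh0
  have := Module.finite_of_finite k (M := B ⧸ Ideal.span {algebraMap k[X] B h})
  exact Finite.of_surjective _ (Ideal.Quotient.factor_surjective
    ((Ideal.span_singleton_le_iff_mem I).mpr hh))

theorem FunctionField.isFractionRing_integralClosure (k : Type*) (K : Type*) [Field k] [Field K]
    [Algebra k[X] K] [Algebra (RatFunc k) K] [IsScalarTower k[X] (RatFunc k) K]
    [FunctionField k K] (B : Type*) [CommRing B] [Algebra k[X] B] [Algebra B K]
    [IsScalarTower k[X] B K] [IsIntegralClosure B k[X] K] :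
    IsFractionRing B K :=
  have : IsDomain B :=
    (IsIntegralClosure.algebraMap_injective B k[X] K).isDomain (algebraMap B K)
  IsIntegralClosure.isFractionRing_of_finite_extension k[X] (RatFunc k) K B

/-- Finite quotients yield the noetherian property and dimension at most one; integral closedness is
transitivity of integrality. -/
theorem FunctionField.isDedekindDomain {k : Type*} (K : Type*) [Field k] [Finite k] [Field K]
    [Algebra k[X] K] [Algebra (RatFunc k) K] [IsScalarTower k[X] (RatFunc k) K]
    [FunctionField k K] (B : Type*) [CommRing B] [Algebra k[X] B] [Algebra B K]
    [IsScalarTower k[X] B K] [IsIntegralClosure B k[X] K]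
    [Algebra k B] [IsScalarTower k k[X] B] : IsDedekindDomain B := by
  have hBK : Function.Injective (algebraMap B K) := IsIntegralClosure.algebraMap_injective B k[X] K
  have : IsDomain B := hBK.isDomain (algebraMap B K)
  have := FunctionField.hasFiniteQuotients (k := k) K B
  have := FunctionField.isFractionRing_integralClosure k K B
  refine (isDedekindDomain_iff B K).mpr ⟨inferInstance, inferInstance, inferInstance, fun {x} hx => ?_⟩
  have : Algebra.IsIntegral k[X] B := IsIntegralClosure.isIntegral_algebra k[X] K
  have h1 : IsIntegral k[X] x := isIntegral_trans x hx
  exact ⟨IsIntegralClosure.mk' B x h1, IsIntegralClosure.algebraMap_mk' B x h1⟩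

end IntegralClosure

/-! ### Places -/

section Places

open Polynomial

variable {k K : Type*} [Field k] [Field K] [Algebra k K]

/-- An element which is integral at all places lying over `R` is integral over `R`. -/
theorem CurvePlace.isIntegral_of_forall_mem {R : Type*} [CommRing R] [Algebra k R] [Algebra R K]
    [IsScalarTower k R K] {x : K}
    (h : ∀ Q : CurvePlace k K, (∀ r : R, algebraMap R K r ∈ Q.ring) → x ∈ Q.ring) :
    IsIntegral R x := by
  by_contra hx
  obtain ⟨V, hV, hxV⟩ := Subring.exists_le_valuationSubring_of_isIntegrallyClosedIn
    (R := (integralClosure R K).toSubring) hx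
  have hR : ∀ r : R, algebraMap R K r ∈ V := fun r =>
    hV (show algebraMap R K r ∈ integralClosure R K from algebraMap_mem _ r)
  refine hxV (h ⟨V, fun c => ?_, ?_⟩ hR)
  · rw [IsScalarTower.algebraMap_apply k R K]
    exact hR _
  · rintro rfl
    exact hxV trivial

theorem ValuationSubring.mem_of_isIntegral {R : Type*} [CommRing R] [Algebra R K]
    (V : ValuationSubring K) (hV : ∀ r : R, algebraMap R K r ∈ V) {x : K} (hx : IsIntegral R x) :
    x ∈ V := by
  have h1 : IsIntegral V x := hx.map_of_comp_eq
    ((algebraMap R K).codRestrict V.toSubring hV : R →+* V) (RingHom.id K) rfl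
  obtain ⟨y, hy⟩ := IsIntegrallyClosed.isIntegral_iff.mp h1
  exact hy ▸ y.2

/-- A function without poles is integral over k, hence algebraic, hence constant. -/
theorem IsCurveFunctionField.mem_range_algebraMap (hK : IsCurveFunctionField k K) {x : K}
    (h : ∀ Q : CurvePlace k K, x ∈ Q.ring) : x ∈ Set.range (algebraMap k K) :=
  hK.constants x (CurvePlace.isIntegral_of_forall_mem (R := k) fun Q _ => h Q).isAlgebraic

theorem IsCurveFunctionField.transcendental_of_notMem (hK : IsCurveFunctionField k K)
    (P : CurvePlace k K) {x : K} (h : x ∉ P.ring) : Transcendental k x := fun hx => by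
  obtain ⟨c, rfl⟩ := hK.constants x hx
  exact h (P.constants_mem c)

/-- The prime ideal of `B` which is cut out by a valuation ring containing `B`. -/
def ValuationSubring.centre {B : Type*} [CommRing B] [Algebra B K] (V : ValuationSubring K)
    (h : ∀ b : B, algebraMap B K b ∈ V) : Ideal B :=
  (IsLocalRing.maximalIdeal V).comap ((algebraMap B K).codRestrict V.toSubring h : B →+* V)

instance {B : Type*} [CommRing B] [Algebra B K] (V : ValuationSubring K)
    (h : ∀ b : B, algebraMap B K b ∈ V) : (V.centre h).IsPrime :=
  Ideal.IsPrime.comap _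

theorem ValuationSubring.mem_centre {B : Type*} [CommRing B] [Algebra B K]
    (V : ValuationSubring K) (h : ∀ b : B, algebraMap B K b ∈ V) {b : B} :
    b ∈ V.centre h ↔ algebraMap B K b ∈ V.nonunits :=
  (V.coe_mem_nonunits_iff (a := ⟨algebraMap B K b, h b⟩)).symm

theorem ValuationSubring.inv_mem_of_notMem_nonunits (V : ValuationSubring K) {x : K}
    (h : x ∉ V.nonunits) : x⁻¹ ∈ V := by
  rw [V.mem_nonunits_iff_or, not_or, not_not] at h
  exact h.2

/-- The localization of B at the common centre is a discrete valuation ring, so z or 1/z lies in it.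
If z does, so does V' contain z; otherwise 1/z = a/b, and z ∈ V leaves only z = 0 or a outside the
centre, so that z = b/a ∈ V'. -/
theorem ValuationSubring.eq_of_centre_eq {B : Type*} [CommRing B] [IsDedekindDomain B] [Algebra B K]
    [IsFractionRing B K] {V V' : ValuationSubring K} (h : ∀ b : B, algebraMap B K b ∈ V)
    (h' : ∀ b : B, algebraMap B K b ∈ V') (hc : V.centre h = V'.centre h') (h0 : V.centre h ≠ ⊥) :
    V = V' := by
  suffices key : ∀ {V V' : ValuationSubring K} (h : ∀ b : B, algebraMap B K b ∈ V)
      (h' : ∀ b : B, algebraMap B K b ∈ V') (_ : V.centre h = V'.centre h') (_ : V.centre h ≠ ⊥),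
      V ≤ V' from le_antisymm (key h h' hc h0) (key h' h hc.symm (hc ▸ h0))
  intro V V' h h' hc h0 z hz
  let p := V.centre h
  have hp : p.primeCompl ≤ nonZeroDivisors B := p.primeCompl_le_nonZeroDivisors
  let S := Localization.subalgebra.ofField K p.primeCompl hp
  have := IsLocalization.AtPrime.isDiscreteValuationRing_of_dedekind_domain B h0 S
  have hS : ∀ s : S, ∃ a b : B, b ∉ p ∧ (s : K) = algebraMap B K a * (algebraMap B K b)⁻¹ := by
    rintro ⟨s, a, b, hb, rfl⟩
    exact ⟨a, b, hb, rfl⟩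
  rcases ValuationRing.isInteger_or_isInteger S z with ⟨s, hs⟩ | ⟨s, hs⟩
  · obtain ⟨a, b, hb, hab⟩ := hS s
    rw [← hs, show algebraMap S K s = (s : K) from rfl, hab]
    refine MulMemClass.mul_mem (h' a) (V'.inv_mem_of_notMem_nonunits ?_)
    rw [← V'.mem_centre h', ← hc]
    exact hb
  · obtain ⟨a, b, hb, hab⟩ := hS s
    rw [show algebraMap S K s = (s : K) from rfl, hab] at hs
    by_cases ha : a ∈ p
    · have h1 : z⁻¹ ∈ V.nonunits := by
        rw [← hs, V.mem_nonunits_iff, map_mul]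
        refine mul_lt_one_of_lt_of_le ((V.mem_nonunits_iff).mp ((V.mem_centre h).mp ha)) ?_
        rw [V.valuation_le_one_iff]
        exact V.inv_mem_of_notMem_nonunits (fun h2 => hb ((V.mem_centre h).mpr h2))
      rcases V.inv_mem_nonunits_iff.mp h1 with rfl | h2
      · exact zero_mem _
      · exact absurd hz h2
    · rw [← inv_inv z, ← hs, mul_inv, inv_inv, mul_comm]
      refine MulMemClass.mul_mem (h' b) (V'.inv_mem_of_notMem_nonunits ?_)
      rw [← V'.mem_centre h', ← hc]
      exact ha

/-- If `y` vanishes at the place `V`, there is an element of `B` which does not vanish at `V`, but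
which vanishes at least to the order of `y` at all the other places of `B`. -/
theorem ValuationSubring.exists_mul_inv_mem {B : Type*} [CommRing B] [IsDedekindDomain B]
    [Algebra B K] [IsFractionRing B K] {V : ValuationSubring K} (h : ∀ b : B, algebraMap B K b ∈ V)
    {y : B} (hy : y ∈ V.centre h) (hy0 : y ≠ 0) :
    ∃ s : B, s ∉ V.centre h ∧ ∀ V' : ValuationSubring K, (∀ b : B, algebraMap B K b ∈ V') →
      V' ≠ V → (algebraMap B K y)⁻¹ * algebraMap B K s ∈ V' := by
  let p := V.centre h
  have hp0 : p ≠ ⊥ := fun h0 => hy0 (by simpa [p, h0] using hy)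
  have hpp : Prime p := Ideal.prime_of_isPrime hp0 inferInstance
  have hpm : p.IsMaximal := Ideal.IsPrime.isMaximal inferInstance hp0
  -- Write (y) = p^e J with p not dividing J. An element `s` of J outside p works: at another place,
  -- a power of some u ∈ p not vanishing there replaces the factor p^e.
  obtain ⟨e, J, hJ, hpJ⟩ := WfDvdMonoid.max_power_factor
    (a₀ := Ideal.span {y}) (by simpa using hy0) hpp.irreducible
  rw [Ideal.dvd_iff_le] at hJ
  obtain ⟨s, hsJ, hs⟩ := SetLike.not_le_iff_exists.mp hJ
  refine ⟨s, hs, fun V' h' hV => ?_⟩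
  have hc : ¬ p ≤ V'.centre h' := fun hle => hV <| (ValuationSubring.eq_of_centre_eq h h'
    (hpm.eq_of_le (Ideal.IsPrime.ne_top inferInstance) hle) hp0).symm
  obtain ⟨u, hu, hu'⟩ := SetLike.not_le_iff_exists.mp hc
  have h1 : u ^ e * s ∈ Ideal.span {y} := by
    rw [hpJ]
    exact Ideal.mul_mem_mul (Ideal.pow_mem_pow hu e) hsJ
  obtain ⟨b, hb⟩ := Ideal.mem_span_singleton.mp h1
  have hue : u ^ e ∉ V'.centre h' := fun h2 => hu' (Ideal.IsPrime.mem_of_pow_mem (I := V'.centre h') inferInstance e h2)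
  have hue0 : algebraMap B K (u ^ e) ≠ 0 := fun h2 => hue (by
    rw [V'.mem_centre, h2]; exact V'.nonunits.zero_mem)
  have hyK : algebraMap B K y ≠ 0 := by
    simpa using hy0
  have h3 : (algebraMap B K y)⁻¹ * algebraMap B K s
      = algebraMap B K b * (algebraMap B K (u ^ e))⁻¹ := by
    rw [eq_mul_inv_iff_mul_eq₀ hue0, mul_assoc, ← map_mul, mul_comm s, hb, map_mul,
      inv_mul_cancel_left₀ hyK]
  rw [h3]
  exact MulMemClass.mul_mem (h' b) (V'.inv_mem_of_notMem_nonunits fun h4 => hue ((V'.mem_centre h').mpr h4))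

/-- For j ≤ m, the product of X^(-m) and X^j is a nonnegative power of X^(-1). -/
theorem ValuationSubring.pow_mul_algebraMap_mem [Algebra k[X] K] [IsScalarTower k k[X] K]
    (V : ValuationSubring K) (hk : ∀ c : k, algebraMap k K c ∈ V)
    (hX : (algebraMap k[X] K X)⁻¹ ∈ V) (hX0 : algebraMap k[X] K X ≠ 0) (g : k[X]) {m : ℕ}
    (hm : g.natDegree ≤ m) : (algebraMap k[X] K X)⁻¹ ^ m * algebraMap k[X] K g ∈ V := by
  rw [g.as_sum_range' (m + 1) (by omega), map_sum, Finset.mul_sum]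
  refine sum_mem fun j hj => ?_
  rw [Finset.mem_range] at hj
  have h1 : (algebraMap k[X] K X)⁻¹ ^ m * algebraMap k[X] K (monomial j (g.coeff j))
      = algebraMap k K (g.coeff j) * (algebraMap k[X] K X)⁻¹ ^ (m - j) := by
    rw [← C_mul_X_pow_eq_monomial, map_mul, map_pow, IsScalarTower.algebraMap_apply k k[X] K,
      algebraMap_eq, ← pow_sub_mul_pow _ (show j ≤ m by omega)]
    have : (algebraMap k[X] K X)⁻¹ ^ j * algebraMap k[X] K X ^ j = 1 := by
      rw [← mul_pow, inv_mul_cancel₀ hX0, one_pow]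
    linear_combination (algebraMap k[X] K X)⁻¹ ^ (m - j) * algebraMap k[X] K (C (g.coeff j)) * this
  rw [h1]
  exact MulMemClass.mul_mem (hk _) (pow_mem hX _)

/-- An element integral over `k[y]` has bounded pole order at the poles of `y`. -/
theorem ValuationSubring.exists_pow_mul_mem [Algebra k[X] K] [IsScalarTower k k[X] K]
    (hX0 : algebraMap k[X] K X ≠ 0) {z : K} (hz : IsIntegral k[X] z) :
    ∃ c : ℕ, ∀ c' ≥ c, ∀ V : ValuationSubring K, (∀ a : k, algebraMap k K a ∈ V) →
      (algebraMap k[X] K X)⁻¹ ∈ V → (algebraMap k[X] K X)⁻¹ ^ c' * z ∈ V := by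
  obtain ⟨p, hp, hpz⟩ := hz
  refine ⟨p.support.sup fun i => (p.coeff i).natDegree, fun c hc V hk hX => ?_⟩
  have hcoeff : ∀ i, (p.coeff i).natDegree ≤ c := fun i => by
    by_cases hi : p.coeff i = 0
    · simp [hi]
    · exact (Finset.le_sup (f := fun i => (p.coeff i).natDegree) (mem_support_iff.mpr hi)).trans hc
  -- The element X^(-c) z is a root of the scaled polynomial. Its lower coefficients are pᵢ
  -- X^(-c(n-i)), n being the degree, and lie in V because deg pᵢ ≤ c.
  let q := scaleRoots (p.map (algebraMap k[X] K)) ((algebraMap k[X] K X)⁻¹ ^ c)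
  have hq : q.Monic := (monic_scaleRoots_iff _).mpr (hp.map _)
  have hqz : q.eval ((algebraMap k[X] K X)⁻¹ ^ c * z) = 0 := by
    have := scaleRoots_eval₂_eq_zero (RingHom.id K) (s := (algebraMap k[X] K X)⁻¹ ^ c)
      (show eval₂ (RingHom.id K) z (p.map (algebraMap k[X] K)) = 0 by
        rw [eval₂_map]; exact hpz)
    simpa [q, eval₂_id] using this
  have hql : q ∈ lifts (algebraMap V K) := by
    rw [lifts_iff_coeff_lifts]
    intro i
    have h1 : q.coeff i ∈ V := by
      rw [coeff_scaleRoots]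
      rcases lt_trichotomy i (p.map (algebraMap k[X] K)).natDegree with hi | hi | hi
      · rw [← pow_mul, mul_comm, coeff_map]
        exact V.pow_mul_algebraMap_mem hk hX hX0 _
          ((hcoeff i).trans (Nat.le_mul_of_pos_right _ (by omega)))
      · rw [hi, Nat.sub_self, pow_zero, mul_one, (hp.map _).coeff_natDegree]
        exact V.one_mem
      · rw [coeff_eq_zero_of_natDegree_lt hi, zero_mul]
        exact V.zero_mem
    exact ⟨⟨_, h1⟩, rfl⟩
  obtain ⟨g, hg, -, hgm⟩ := lifts_and_natDegree_eq_and_monic hql hq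
  refine V.mem_of_isIntegral (R := V) (fun r => r.2) ⟨g, hgm, ?_⟩
  rw [← eval_map, hg, hqz]

end Places

/-! ### A function whose only pole is P -/

section RiemannCount

open Polynomial

variable {k K : Type*} [Field k] [Field K] [Algebra k K]

/-- Write g = X^j g' with j < N and g'(0) ≠ 0. Cancelling X^j would put s g' into p, whereas neither
s nor g' lies in p. -/
theorem mul_algebraMap_notMem_span_X_pow {B : Type*} [CommRing B] [IsDomain B] [Algebra k[X] B]
    {p : Ideal B} [p.IsPrime] (hX : algebraMap k[X] B X ∈ p) (hX0 : algebraMap k[X] B X ≠ 0)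
    {s : B} (hs : s ∉ p) {N : ℕ} {g : k[X]} (hg : g ≠ 0) (hgN : g.degree < N) :
    s * algebraMap k[X] B g ∉ Ideal.span {algebraMap k[X] B (X ^ N)} := by
  intro hmem
  obtain ⟨b, hb⟩ := Ideal.mem_span_singleton.mp hmem
  obtain ⟨j, g', hg', rfl⟩ := WfDvdMonoid.max_power_factor hg (irreducible_X (R := k))
  have hjN : j < N := by
    rw [degree_mul, degree_X_pow] at hgN
    have h0 : (0 : WithBot ℕ) ≤ g'.degree := zero_le_degree_iff.mpr (right_ne_zero_of_mul hg)
    have h1 : (j : WithBot ℕ) < N := lt_of_le_of_lt (le_add_of_nonneg_right h0) hgN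
    exact_mod_cast h1
  have h1 : s * algebraMap k[X] B g' = algebraMap k[X] B X ^ (N - j) * b := by
    refine mul_left_cancel₀ (pow_ne_zero j hX0) ?_
    rw [← mul_assoc (_ ^ j) (_ ^ (N - j)), ← pow_add, Nat.add_sub_cancel' hjN.le, ← map_pow _ X N,
      ← hb, map_mul, map_pow]
    ring
  have h2 : s * algebraMap k[X] B g' ∈ p := by
    rw [h1]
    exact Ideal.mul_mem_right _ _ (Ideal.pow_mem_of_mem _ hX _ (by omega))
  have h3 := (Ideal.IsPrime.mem_or_mem inferInstance h2).resolve_left hs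
  have h4 : g'.coeff 0 ≠ 0 := fun h => hg' (X_dvd_iff.mpr h)
  have h5 : algebraMap k[X] B (C (g'.coeff 0)) ∈ p := by
    rw [← X_mul_divX_add g', map_add, map_mul] at h3
    exact (Ideal.add_mem_iff_right _ (Ideal.mul_mem_right _ _ hX)).mp h3
  exact Ideal.IsPrime.ne_top inferInstance (Ideal.eq_top_of_isUnit_mem _ h5
    (((isUnit_C.mpr h4.isUnit)).map _))

set_option maxHeartbeats 1000000 in
/-- There is a nonconstant function which is regular away from `P`. -/
theorem IsCurveFunctionField.exists_mem_regularAway_notMem [Finite k]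
    (hK : IsCurveFunctionField k K) (P : CurvePlace k K) :
    ∃ t ∈ regularAway P, t ∉ P.ring := by
  obtain ⟨x, hx⟩ : ∃ x, x ∉ P.ring := by
    by_contra! h
    exact P.ne_top (top_unique fun x _ => h x)
  -- A Riemann-type count. Functions x^N b with b in the integral closure B of k[y] are considered;
  -- regularity is required at the zeros of y other than P and at the places where x is regular.
  -- Showing that the available space has dimension at least 2 suffices, since the functions regular
  -- everywhere have dimension at most 1.
  set y := x⁻¹ with hy
  have hx0 : x ≠ 0 := fun h => hx (h ▸ P.ring.zero_mem)
  have hy0 : y ≠ 0 := inv_ne_zero hx0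
  have hyinv : y⁻¹ = x := inv_inv x
  have hyP : y ∈ P.ring.nonunits := P.ring.inv_mem_nonunits_iff.mpr (Or.inr hx)
  have hyt : Transcendental k y := fun h => hK.transcendental_of_notMem P hx (by simpa [y] using IsAlgebraic.inv h)
  let : Algebra k[X] K := (aeval y).toAlgebra
  have hXy : algebraMap k[X] K X = y := aeval_X y
  have : IsScalarTower k k[X] K := IsScalarTower.of_algebraMap_eq fun c => (aeval_C y c).symm
  have hinj : Function.Injective (algebraMap k[X] K) := (injective_iff_map_eq_zero _).mpr
    (transcendental_iff.mp hyt)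
  obtain ⟨_, _, _⟩ := hK.exists_functionField hinj
  let B := integralClosure k[X] K
  have : IsDedekindDomain B := FunctionField.isDedekindDomain (k := k) K B
  have : IsFractionRing B K := FunctionField.isFractionRing_integralClosure k K B
  have hmem : ∀ V : ValuationSubring K, (∀ c : k, algebraMap k K c ∈ V) → y ∈ V →
      ∀ b : B, algebraMap B K b ∈ V := fun V hk hyV b =>
    V.mem_of_isIntegral (R := k[X]) (fun g => by
      induction g using Polynomial.induction_on' with
      | add f g hf hg => rw [map_add]; exact add_mem hf hg
      | monomial n c =>
        rw [← C_mul_X_pow_eq_monomial, map_mul, map_pow, hXy, ← algebraMap_eq,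
          ← IsScalarTower.algebraMap_apply k k[X] K]
        exact mul_mem (hk c) (pow_mem hyV n)) b.2
  have hBP := hmem P.ring P.constants_mem (P.ring.nonunits_subset hyP)
  let Y : B := algebraMap k[X] B X
  have hYK : algebraMap B K Y = y := hXy
  have hYP : Y ∈ P.ring.centre hBP := (P.ring.mem_centre hBP).mpr (by rw [hYK]; exact hyP)
  have hY0 : Y ≠ 0 := fun h => hy0 (by rw [← hYK, h, map_zero])
  obtain ⟨s, hs, hsQ⟩ := P.ring.exists_mul_inv_mem hBP hYP hY0
  rw [hYK, hyinv] at hsQ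
  set n := Module.finrank (RatFunc k) K with hn
  have hn0 : 0 < n := Module.finrank_pos
  -- a basis of `K` over `k(y)` consisting of elements of `B`
  obtain ⟨β, hβ⟩ : ∃ β : Fin n → B, LinearIndependent k[X] fun i => algebraMap B K (β i) := by
    let f := Module.finBasis (RatFunc k) K
    obtain ⟨b, hb⟩ := IsLocalization.exist_integer_multiples_of_finite (nonZeroDivisors B) f
    choose β hβ using hb
    refine ⟨β, (LinearIndependent.iff_fractionRing k[X] (RatFunc k)).mpr ?_⟩
    have hb0 : algebraMap B K b ≠ 0 := by simp
    have h1 := f.linearIndependent.map_injOn (LinearMap.mulLeft (RatFunc k) (algebraMap B K b))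
      (mul_right_injective₀ hb0).injOn
    have h2 : (fun i => algebraMap B K (β i))
        = (LinearMap.mulLeft (RatFunc k) (algebraMap B K b)) ∘ f := by
      funext i
      rw [hβ i, Algebra.smul_def]
      rfl
    rw [h2]
    exact h1
  choose c hc using fun i => ValuationSubring.exists_pow_mul_mem (by rw [hXy]; exact hy0) (β i).2
  rw [hXy, hyinv] at hc
  obtain ⟨C, hC⟩ : ∃ C, ∀ i, c i ≤ C := ⟨Finset.univ.sup c, fun i => Finset.le_sup (Finset.mem_univ i)⟩
  -- The combinations h₁β₁ + ... + h_nβ_n with deg hᵢ ≤ m form a space of dimension n(m + 1), and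
  -- the conditions at the zeros of y number at most (n - 1)N with N = C + m. This choice of `m`
  -- leaves dimension at least n + 2.
  set m := C * (n - 1) + 2 with hm
  set N := C + m with hN
  let J : Submodule k B :=
    { carrier := {b | ∀ Q : CurvePlace k K, Q ≠ P → y ∈ Q.ring → x ^ N * algebraMap B K b ∈ Q.ring}
      zero_mem' := fun Q _ _ => by rw [map_zero, mul_zero]; exact zero_mem _
      add_mem' := fun {a b} ha hb Q hQ hyQ => by
        rw [map_add, mul_add]; exact add_mem (ha Q hQ hyQ) (hb Q hQ hyQ)
      smul_mem' := fun c b hb Q hQ hyQ => by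
        have h1 : x ^ N * algebraMap B K (c • b) = algebraMap k K c * (x ^ N * algebraMap B K b) := by
          rw [Algebra.smul_def, map_mul, ← IsScalarTower.algebraMap_apply k B K]; ring
        rw [h1]
        exact mul_mem (Q.constants_mem c) (hb Q hQ hyQ) }
  let I : Ideal B := Ideal.span {algebraMap k[X] B (X ^ N)}
  let π : B →ₗ[k] B ⧸ I := (Ideal.Quotient.mkₐ k I).toLinearMap
  obtain ⟨hfin, hfr⟩ := FunctionField.finrank_quotient_le (k := k) (K := K) B (X ^ N) (by simp)
  rw [natDegree_X_pow] at hfr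
  have hIJ : ∀ b ∈ I, b ∈ J := fun b hb Q hQ hyQ => by
    obtain ⟨b', rfl⟩ := Ideal.mem_span_singleton.mp hb
    have h1 : x ^ N * algebraMap B K (algebraMap k[X] B (X ^ N) * b') = algebraMap B K b' := by
      rw [map_pow, map_mul, map_pow, show algebraMap B K (algebraMap k[X] B X) = y from hYK,
        ← mul_assoc, ← mul_pow, hy, mul_inv_cancel₀ hx0, one_pow, one_mul]
    rw [h1]
    exact hmem _ Q.constants_mem hyQ b'
  -- The classes of s^N g(y) with deg g < N lie in J, because s/y is regular at the other zeros of
  -- y; they are independent modulo y^N B, because s does not vanish at P.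
  have hJdim : N ≤ Module.finrank k (J.map π) := by
    let γ : degreeLT k N →ₗ[k] B ⧸ I := π ∘ₗ LinearMap.mulLeft k (s ^ N) ∘ₗ
      (IsScalarTower.toAlgHom k k[X] B).toLinearMap ∘ₗ (degreeLT k N).subtype
    have hγ : Function.Injective γ := by
      rw [injective_iff_map_eq_zero]
      intro g hg
      by_contra hg0
      exact mul_algebraMap_notMem_span_X_pow hYP hY0
        (fun h => hs (Ideal.IsPrime.mem_of_pow_mem inferInstance N h))
        (fun h => hg0 (Subtype.ext h)) (mem_degreeLT.mp g.2) (Ideal.Quotient.eq_zero_iff_mem.mp hg)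
    have h1 : LinearMap.range γ ≤ J.map π := by
      rintro _ ⟨g, rfl⟩
      refine ⟨s ^ N * algebraMap k[X] B g, fun Q hQ hyQ => ?_, rfl⟩
      rw [map_mul, map_pow, ← mul_assoc, ← mul_pow]
      exact mul_mem (pow_mem (hsQ Q.ring (hmem _ Q.constants_mem hyQ)
        (fun h => hQ (CurvePlace.ext h))) N) (hmem _ Q.constants_mem hyQ _)
    have h2 := Submodule.finrank_mono h1
    rw [LinearMap.finrank_range_of_inj hγ, (degreeLTEquiv k N).finrank_eq, Module.finrank_fin_fun] at h2
    exact h2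
  let υ : (Fin n → degreeLT k (m + 1)) →ₗ[k] B := ∑ i, LinearMap.mulRight k (β i) ∘ₗ
      (IsScalarTower.toAlgHom k k[X] B).toLinearMap ∘ₗ (degreeLT k (m + 1)).subtype ∘ₗ
      LinearMap.proj i
  have hυ : ∀ h, υ h = ∑ i, algebraMap k[X] B (h i) * β i := fun h => by
    simp [υ]
  let ψ := (J.map π).mkQ ∘ₗ π ∘ₗ υ
  have hker : 2 ≤ Module.finrank k (LinearMap.ker ψ) := by
    have h1 := ψ.finrank_range_add_finrank_ker
    have h2 := (LinearMap.range ψ).finrank_le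
    have h3 := (J.map π).finrank_quotient_add_finrank
    have h4 : Module.finrank k (Fin n → degreeLT k (m + 1)) = n * (m + 1) := by
      rw [Module.finrank_pi_fintype]
      simp [(degreeLTEquiv k (m + 1)).finrank_eq]
    rw [h4] at h1
    have h5 : Module.finrank k (B ⧸ I) ≤ n * N := hfr
    obtain ⟨n', hn'⟩ : ∃ n', n = n' + 1 := ⟨n - 1, by omega⟩
    have h6 : m = C * n' + 2 := by rw [hm, hn']; simp
    have h7 : n * N = n' * C + n' * m + C + m := by rw [hN, hn']; ring
    have h8 : n * (m + 1) = n' * m + m + n' + 1 := by rw [hn']; ring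
    rw [h7] at h5
    rw [h8] at h1
    rw [mul_comm C n'] at h6
    omega
  let θ : (Fin n → degreeLT k (m + 1)) →ₗ[k] K := LinearMap.mulLeft k (x ^ N) ∘ₗ
    (IsScalarTower.toAlgHom k B K).toLinearMap ∘ₗ υ
  have hθ : Function.Injective θ := by
    rw [injective_iff_map_eq_zero]
    intro h hh
    have h1 : algebraMap B K (υ h) = 0 := (mul_eq_zero.mp hh).resolve_left (pow_ne_zero _ hx0)
    rw [hυ, map_sum] at h1
    have h2 := Fintype.linearIndependent_iff.mp hβ (fun i => (h i : k[X])) (by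
      rw [← h1]
      refine Finset.sum_congr rfl fun i _ => ?_
      rw [map_mul, Algebra.smul_def, ← IsScalarTower.algebraMap_apply k[X] B K])
    funext i
    exact Subtype.ext (h2 i)
  have hA : ∀ h ∈ LinearMap.ker ψ, θ h ∈ regularAway P := by
    intro h hh Q hQ
    by_cases hyQ : y ∈ Q.ring
    · have h1 : π (υ h) ∈ J.map π := by
        rw [← Submodule.ker_mkQ (J.map π)]
        exact hh
      obtain ⟨j, hj, hjh⟩ := h1
      have h2 : υ h - j ∈ I := by
        rw [← Ideal.Quotient.eq_zero_iff_mem, map_sub, sub_eq_zero]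
        exact hjh.symm
      have h3 : υ h ∈ J := by
        rw [← sub_add_cancel (υ h) j]
        exact J.add_mem (hIJ _ h2) hj
      exact h3 Q hQ hyQ
    · have hxQ : x ∈ Q.ring := (Q.ring.mem_or_inv_mem x).resolve_right hyQ
      -- Where x is regular, x^m offsets the poles of the polynomials hᵢ(y) and x^C those of the βᵢ;
      -- this is the reason for N = C + m.
      have h1 : θ h = ∑ i, (x ^ m * algebraMap k[X] K (h i)) * (x ^ C * algebraMap B K (β i)) := by
        change x ^ N * algebraMap B K (υ h) = _
        rw [hυ, map_sum, Finset.mul_sum]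
        refine Finset.sum_congr rfl fun i _ => ?_
        rw [map_mul, ← IsScalarTower.algebraMap_apply k[X] B K, hN, pow_add]
        ring
      rw [h1]
      refine sum_mem fun i _ => mul_mem ?_ (hc i C (hC i) Q.ring Q.constants_mem hxQ)
      have h2 := Q.ring.pow_mul_algebraMap_mem Q.constants_mem (by rwa [hXy, hyinv])
        (by rwa [hXy]) (h i : k[X]) (m := m) (by
          rcases eq_or_ne (h i : k[X]) 0 with h0 | h0
          · simp [h0]
          · have := (natDegree_lt_iff_degree_lt h0).mpr (mem_degreeLT.mp (h i).2)
            omega)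
      rwa [hXy, hyinv] at h2
  by_contra! hcon
  have h1 : ∀ h ∈ LinearMap.ker ψ, θ h ∈ (LinearMap.range (Algebra.linearMap k K)) := by
    intro h hh
    refine hK.mem_range_algebraMap fun Q => ?_
    by_cases hQ : Q = P
    · exact hQ ▸ hcon _ (hA h hh)
    · exact hA h hh Q hQ
  have h2 : Module.finrank k (LinearMap.ker ψ) ≤ 1 := by
    have h3 : ((LinearMap.ker ψ).map θ) ≤ LinearMap.range (Algebra.linearMap k K) := by
      rintro _ ⟨h, hh, rfl⟩
      exact h1 h hh
    have h4 := Submodule.finrank_mono h3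
    rw [(Submodule.equivMapOfInjective θ hθ (LinearMap.ker ψ)).symm.finrank_eq] at h4
    exact h4.trans ((LinearMap.finrank_range_le _).trans (Module.finrank_self k).le)
  omega

end RiemannCount

/-! ### The ring A: Dedekind property and primes -/

section RegularAway

open Polynomial

variable {k K : Type*} [Field k] [Field K] [Algebra k K]

/-- The image of X lies in A and has a pole at P, so the places containing the image of k[X] are
exactly those different from P. -/
theorem isIntegralClosure_regularAway (P : CurvePlace k K) [Algebra k[X] (regularAway P)]
    [Algebra k[X] K] [IsScalarTower k[X] (regularAway P) K] [IsScalarTower k k[X] K]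
    (hX : algebraMap k[X] K X ∉ P.ring) : IsIntegralClosure (regularAway P) k[X] K where
  algebraMap_injective := Subtype.val_injective
  isIntegral_iff := fun {x} => by
    refine ⟨fun hx => ⟨⟨x, fun Q hQ => Q.ring.mem_of_isIntegral (R := k[X]) (fun g => ?_) hx⟩, rfl⟩,
      ?_⟩
    · rw [IsScalarTower.algebraMap_apply k[X] (regularAway P) K]
      exact (algebraMap k[X] (regularAway P) g).2 Q hQ
    · rintro ⟨a, rfl⟩
      refine CurvePlace.isIntegral_of_forall_mem fun Q hQ => a.2 Q ?_
      rintro rfl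
      exact hX (hQ X)

theorem isIntegralElem_regularAway (P : CurvePlace k K) {t : regularAway P}
    (ht : (t : K) ∉ P.ring) (a : regularAway P) :
    (aeval t : k[X] →ₐ[k] regularAway P).toRingHom.IsIntegralElem a := by
  let : Algebra k[X] (regularAway P) := (aeval t : k[X] →ₐ[k] regularAway P).toAlgebra
  let : Algebra k[X] K := (aeval (t : K) : k[X] →ₐ[k] K).toAlgebra
  have : IsScalarTower k k[X] K := IsScalarTower.of_algebraMap_eq fun c => (aeval_C (t : K) c).symm
  have : IsScalarTower k[X] (regularAway P) K := IsScalarTower.of_algebraMap_eq fun g =>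
    aeval_algebraMap_apply K t g
  have := isIntegralClosure_regularAway P (by
    rw [show algebraMap k[X] K X = t from aeval_X (t : K)]; exact ht)
  exact (IsIntegralClosure.isIntegral_algebra k[X] K).isIntegral a

theorem IsCurveFunctionField.regularAway_structure [Finite k] (hK : IsCurveFunctionField k K)
    (P : CurvePlace k K) : IsDedekindDomain (regularAway P) ∧ IsFractionRing (regularAway P) K ∧
      Ring.HasFiniteQuotients (regularAway P) := by
  obtain ⟨t₀, ht₀, htP⟩ := hK.exists_mem_regularAway_notMem P
  let t : regularAway P := ⟨t₀, ht₀⟩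
  let : Algebra k[X] (regularAway P) := (aeval t : k[X] →ₐ[k] regularAway P).toAlgebra
  let : Algebra k[X] K := (aeval (t : K) : k[X] →ₐ[k] K).toAlgebra
  have : IsScalarTower k k[X] K := IsScalarTower.of_algebraMap_eq fun c => (aeval_C (t : K) c).symm
  have : IsScalarTower k k[X] (regularAway P) :=
    IsScalarTower.of_algebraMap_eq fun c => (aeval_C t c).symm
  have : IsScalarTower k[X] (regularAway P) K := IsScalarTower.of_algebraMap_eq fun g =>
    aeval_algebraMap_apply K t g
  have := isIntegralClosure_regularAway P (by
    rw [show algebraMap k[X] K X = t from aeval_X (t : K)]; exact htP)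
  obtain ⟨_, _, _⟩ := hK.exists_functionField ((injective_iff_map_eq_zero _).mpr
    (transcendental_iff.mp (hK.transcendental_of_notMem P htP)))
  exact ⟨FunctionField.isDedekindDomain (k := k) K _,
    FunctionField.isFractionRing_integralClosure k K _,
    FunctionField.hasFiniteQuotients (k := k) K _⟩

theorem IsCurveFunctionField.isDomain_regularAway_tensorProduct [PerfectField k]
    (hK : IsCurveFunctionField k K) (P : CurvePlace k K) (L : Type*) [Field L] [Algebra k L] :
    IsDomain (regularAway P ⊗[k] L) := by
  have := isDomain_tensorProduct_of_algebraicallyClosed hK.constants L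
  have hinj : Function.Injective (Algebra.TensorProduct.map (regularAway P).val (AlgHom.id k L)) :=
    Module.Flat.rTensor_preserves_injective_linearMap (regularAway P).val.toLinearMap
      Subtype.val_injective
  exact hinj.isDomain (Algebra.TensorProduct.map (regularAway P).val (AlgHom.id k L)).toRingHom

/-- No nonzero element of the ring `A` is contained in all nonzero primes. -/
theorem IsCurveFunctionField.exists_isPrime_notMem [Finite k] (hK : IsCurveFunctionField k K)
    (P : CurvePlace k K) {b : regularAway P} (hb : b ≠ 0) :
    ∃ p : Ideal (regularAway P), p.IsPrime ∧ p ≠ ⊥ ∧ b ∉ p := by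
  obtain ⟨t₀, ht₀, htP⟩ := hK.exists_mem_regularAway_notMem P
  let t : regularAway P := ⟨t₀, ht₀⟩
  have hconst : ∀ a : regularAway P, (a : K) ∈ P.ring → (a : K) ∈ Set.range (algebraMap k K) :=
    fun a ha => hK.mem_range_algebraMap fun Q => by
      by_cases hQ : Q = P
      · exact hQ ▸ ha
      · exact a.2 Q hQ
  have hb0 : (b : K) ≠ 0 := fun h => hb (Subtype.ext h)
  have hbinv : (b : K)⁻¹ ∈ P.ring := by
    rcases P.ring.mem_or_inv_mem (b : K) with h | h
    · obtain ⟨c, hc⟩ := hconst b h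
      rw [← hc, ← map_inv₀]
      exact P.constants_mem _
    · exact h
  have hbt : ((b * t : regularAway P) : K) ∉ P.ring := fun h => htP (by
    have := mul_mem hbinv h
    rwa [MulMemClass.coe_mul, inv_mul_cancel_left₀ hb0] at this)
  -- Euclid's argument: a prime containing 1 + bt does not contain b. This element has a pole at P,
  -- so an inverse in A would be regular everywhere, hence constant, which is absurd.
  let u : regularAway P := 1 + b * t
  have hu : (u : K) ∉ P.ring := fun h => hbt (by
    have := sub_mem h P.ring.one_mem
    rwa [show (u : K) = 1 + (b * t : regularAway P) from rfl, add_sub_cancel_left] at this)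
  have hu0 : u ≠ 0 := fun h => hu (by rw [h]; exact P.ring.zero_mem)
  have hunit : ¬ IsUnit u := fun h => by
    obtain ⟨w, hw⟩ := h.exists_right_inv
    have hwK : (u : K) * (w : K) = 1 := congrArg Subtype.val hw
    have hw1 : (w : K) = (u : K)⁻¹ := (inv_eq_of_mul_eq_one_right hwK).symm
    have hw2 : (w : K) ∈ P.ring := hw1 ▸ (P.ring.mem_or_inv_mem (u : K)).resolve_left hu
    obtain ⟨c, hc⟩ := hconst w hw2
    refine hu ?_
    rw [← inv_inv (u : K), ← hw1, ← hc, ← map_inv₀]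
    exact P.constants_mem _
  obtain ⟨p, hp, hup⟩ := exists_max_ideal_of_mem_nonunits hunit
  refine ⟨p, hp.isPrime, fun h => hu0 (by simpa [h] using hup), fun hbp => hp.ne_top ?_⟩
  rw [Ideal.eq_top_iff_one]
  exact (Ideal.add_mem_iff_left _ (Ideal.mul_mem_right t _ hbp)).mp hup

end RegularAway

/-! ### The field `ℂ_∞` -/

namespace CInfty

section

variable {K : Type*} [Field K] (v : AbsoluteValue (AlgebraicClosure K) ℝ)

theorem norm_ofAlgebraicClosure (x : AlgebraicClosure K) : ‖ofAlgebraicClosure v x‖ = v x := by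
  refine (UniformSpace.Completion.norm_coe _).trans ?_
  rfl

theorem norm_algebraMap_eq {R : Type*} [CommSemiring R] [Algebra R K] (r : R) :
    ‖algebraMap R (CInfty v) r‖ = v (algebraMap K (AlgebraicClosure K) (algebraMap R K r)) :=
  norm_ofAlgebraicClosure v _

theorem denseRange_ofAlgebraicClosure : DenseRange (ofAlgebraicClosure v) := by
  refine DenseRange.comp (g := UniformSpace.Completion.coeRingHom)
    UniformSpace.Completion.denseRange_coe ?_ (UniformSpace.Completion.continuous_coe _)
  exact (WithAbs.equiv v).symm.surjective.denseRange

end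

variable {k K : Type*} [Field k] [Field K] [Algebra k K]
  {v : AbsoluteValue (AlgebraicClosure K) ℝ} {P : CurvePlace k K}

theorem norm_algebraMap_le_one (hv : LiesAbovePlace v P) {R : Type*} [CommSemiring R] [Algebra R K]
    {r : R} : ‖algebraMap R (CInfty v) r‖ ≤ 1 ↔ algebraMap R K r ∈ P.ring := by
  rw [norm_algebraMap_eq]
  exact hv _

/-- Integers are constants, hence have norm at most 1. -/
theorem isUltrametricDist (hv : LiesAbovePlace v P) : IsUltrametricDist (CInfty v) := by
  refine IsUltrametricDist.isUltrametricDist_of_forall_norm_natCast_le_one fun n => ?_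
  have h := (norm_algebraMap_le_one hv (r := (n : K))).mpr (by
    rw [Algebra.algebraMap_self_apply, ← map_natCast (algebraMap k K)]
    exact P.constants_mem _)
  rwa [map_natCast] at h

theorem exists_one_lt_norm (hv : LiesAbovePlace v P) : ∃ x : CInfty v, 1 < ‖x‖ := by
  obtain ⟨x, hx⟩ : ∃ x, x ∉ P.ring := by
    by_contra! h
    exact P.ne_top (top_unique fun x _ => h x)
  exact ⟨algebraMap K (CInfty v) x, not_le.mp fun h => hx ((norm_algebraMap_le_one hv).mp h)⟩

theorem isSepClosed (hv : LiesAbovePlace v P) : IsSepClosed (CInfty v) := by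
  let : NontriviallyNormedField (CInfty v) :=
    { (inferInstance : NormedField (CInfty v)) with non_trivial := exists_one_lt_norm hv }
  have := isUltrametricDist hv
  let : Algebra (AlgebraicClosure K) (CInfty v) := (ofAlgebraicClosure v).toAlgebra
  exact IsSepClosed.of_denseRange (K := AlgebraicClosure K) (denseRange_ofAlgebraicClosure v)

end CInfty

/-! ### Torsion of quotients by lattices -/

section Lattice

variable {A K W : Type*} [CommRing A] [IsDedekindDomain A] [Field K] [Algebra A K]
  [IsFractionRing A K] [AddCommGroup W] [Module K W] [Module A W] [IsScalarTower A K W]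

/-- Lifts of a basis of Λ/pΛ form a K-basis of KΛ. A K-linear relation can be scaled to have
coefficients in A, not all in p, which gives independence; Nakayama's lemma gives generation. -/
theorem finrank_quotient_smul_top_eq_finrank_span {Λ : Submodule A W} (hΛ : Λ.FG) (p : Ideal A)
    [p.IsMaximal] : Module.finrank (A ⧸ p) (Λ ⧸ (p • ⊤ : Submodule A Λ))
      = Module.finrank K (Submodule.span K (Λ : Set W)) := by
  let : Field (A ⧸ p) := Ideal.Quotient.field p
  have : Module.Finite A Λ := Module.Finite.iff_fg.mpr hΛ
  have : Module.Finite (A ⧸ p) (Λ ⧸ (p • ⊤ : Submodule A Λ)) :=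
    Module.Finite.of_restrictScalars_finite A _ _
  let b := Module.finBasis (A ⧸ p) (Λ ⧸ (p • ⊤ : Submodule A Λ))
  choose b' hb' using fun i => Submodule.mkQ_surjective (p • ⊤ : Submodule A Λ) (b i)
  have hli : LinearIndependent K fun i => (b' i : W) := by
    rw [Fintype.linearIndependent_iff]
    intro g hg
    by_contra! hne
    obtain ⟨j, hj⟩ := hne
    obtain ⟨a, ha, i, -, hi⟩ := Ideal.exist_integer_multiples_notMem
      (Ideal.IsMaximal.ne_top (I := p) inferInstance) Finset.univ g (Finset.mem_univ j) hj
    choose c hc using fun i => ha i (Finset.mem_univ i)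
    have h1 : ∑ i, c i • b' i = 0 := by
      refine Subtype.ext ?_
      rw [AddSubmonoidClass.coe_finsetSum, ZeroMemClass.coe_zero]
      calc ∑ i, ((c i • b' i : Λ) : W) = ∑ i, a • g i • (b' i : W) := by
            refine Finset.sum_congr rfl fun i _ => ?_
            rw [Submodule.coe_smul, smul_smul, ← hc i, algebraMap_smul]
        _ = 0 := by rw [← Finset.smul_sum, hg, smul_zero]
    have h2 : ∑ i, (Ideal.Quotient.mk p (c i)) • b i = 0 := by
      have := congrArg (p • ⊤ : Submodule A Λ).mkQ h1
      rw [map_sum, map_zero] at this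
      rw [← this]
      refine Finset.sum_congr rfl fun i _ => ?_
      rw [map_smul, hb']
      rfl
    have h3 := Fintype.linearIndependent_iff.mp b.linearIndependent _ h2 i
    refine hi ?_
    rw [← hc i]
    exact FractionalIdeal.mem_coeIdeal_of_mem _ (Ideal.Quotient.eq_zero_iff_mem.mp h3)
  have hspan : Submodule.span K (Set.range fun i => (b' i : W)) = Submodule.span K (Λ : Set W) := by
    refine le_antisymm (Submodule.span_mono ?_) (Submodule.span_le.mpr ?_)
    · rintro _ ⟨i, rfl⟩
      exact (b' i).2
    · have hle : (⊤ : Submodule A Λ) ≤ Submodule.span A (Set.range b') ⊔ p • ⊤ := by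
        intro x _
        have h1 : (p • ⊤ : Submodule A Λ).mkQ x
            ∈ (Submodule.span A (Set.range b')).map (p • ⊤ : Submodule A Λ).mkQ := by
          rw [Submodule.map_span, ← Set.range_comp, show (p • ⊤ : Submodule A Λ).mkQ ∘ b' = b from
            funext hb']
          rw [← Submodule.restrictScalars_span A (A ⧸ p) Ideal.Quotient.mk_surjective, b.span_eq]
          trivial
        obtain ⟨y, hy, hyx⟩ := h1
        rw [← add_sub_cancel y x]
        refine add_mem (Submodule.mem_sup_left hy) (Submodule.mem_sup_right ?_)
        rw [← Submodule.ker_mkQ (p • ⊤ : Submodule A Λ), LinearMap.mem_ker, map_sub, hyx, sub_self]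
      obtain ⟨r, hr, hrle⟩ := Submodule.exists_sub_one_mem_and_smul_le_of_fg_of_le_sup
        (Module.finite_def.mp ‹Module.Finite A Λ›) le_rfl hle
      have hr0 : r ≠ 0 := by
        rintro rfl
        rw [zero_sub, neg_mem_iff] at hr
        exact Ideal.IsMaximal.ne_top (I := p) inferInstance ((Ideal.eq_top_iff_one p).mpr hr)
      intro x hx
      have h1 : r • (⟨x, hx⟩ : Λ) ∈ Submodule.span A (Set.range b') :=
        hrle (Submodule.smul_mem_pointwise_smul _ _ _ trivial)
      have h2 := Submodule.mem_map_of_mem (f := Λ.subtype) h1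
      rw [Submodule.map_span, ← Set.range_comp] at h2
      have h3 : algebraMap A K r • x ∈ Submodule.span K (Set.range fun i => (b' i : W)) := by
        rw [algebraMap_smul]
        exact Submodule.span_le_restrictScalars A K _ h2
      have hr0' : algebraMap A K r ≠ 0 := by simpa using hr0
      have h4 := Submodule.smul_mem _ (algebraMap A K r)⁻¹ h3
      rwa [inv_smul_smul₀ hr0'] at h4
  rw [← hspan, finrank_span_eq_card hli, Fintype.card_fin]

/-- The `p`-torsion of `W / Λ` for a lattice `Λ` in a vector space `W`. -/
theorem natCard_torsionBySet_quotient {Λ : Submodule A W} (hΛ : Λ.FG) (p : Ideal A) [p.IsMaximal]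
    (hp : p ≠ ⊥) : Nat.card (Submodule.torsionBySet A (W ⧸ Λ) (p : Set A))
      = Nat.card (A ⧸ p) ^ Module.finrank K (Submodule.span K (Λ : Set W)) := by
  have hpp : Prime p := Ideal.prime_of_isPrime hp inferInstance
  have hlt := Ideal.pow_right_strictAnti p hp (Ideal.IsMaximal.ne_top inferInstance) one_lt_two
  -- The prime p need not be principal. With (π) = pJ, p not dividing J and c ∈ J outside p,
  -- multiplication by c/π plays the role of the inverse of a generator: it induces an isomorphism
  -- from Λ/pΛ to the p-torsion of W/Λ.
  obtain ⟨π, hπ, hπ2⟩ : ∃ π ∈ p, π ∉ p ^ 2 := SetLike.exists_of_lt (by simpa using hlt)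
  have hπ0 : π ≠ 0 := fun h => hπ2 (h ▸ zero_mem _)
  obtain ⟨J, hJ⟩ : p ∣ Ideal.span {π} := Ideal.dvd_iff_le.mpr
    ((Ideal.span_singleton_le_iff_mem _).mpr hπ)
  have hJp : ¬ J ≤ p := fun h => hπ2 (by
    have := Ideal.mul_mono_right (I := p) h
    rw [← hJ, ← sq] at this
    exact this (Ideal.mem_span_singleton_self π))
  obtain ⟨c, hcJ, hcp⟩ := SetLike.not_le_iff_exists.mp hJp
  have hcπ : ∀ a ∈ p, ∃ a', a * c = π * a' := fun a ha => Ideal.mem_span_singleton.mp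
    (hJ ▸ Ideal.mul_mem_mul ha hcJ)
  obtain ⟨c', a₀, ha₀, hc'⟩ := Ideal.IsMaximal.exists_inv (I := p) inferInstance hcp
  have hπK : algebraMap A K π ≠ 0 := by simpa using hπ0
  have hdiv : ∀ w : W, (algebraMap A K π)⁻¹ • π • w = w := fun w => by
    rw [← algebraMap_smul K π, inv_smul_smul₀ hπK]
  have hdiv' : ∀ w : W, π • (algebraMap A K π)⁻¹ • w = w := fun w => by
    rw [← algebraMap_smul K π, smul_inv_smul₀ hπK]
  have hcomm : ∀ (a : A) (w : W), a • (algebraMap A K π)⁻¹ • w = (algebraMap A K π)⁻¹ • a • w :=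
    fun a w => by rw [← algebraMap_smul K a, ← algebraMap_smul K a, smul_comm]
  let Ψ : Λ →ₗ[A] W ⧸ Λ :=
    { toFun := fun x => Λ.mkQ ((algebraMap A K π)⁻¹ • c • (x : W))
      map_add' := fun x y => by rw [← map_add, Submodule.coe_add, smul_add, smul_add]
      map_smul' := fun a x => by
        rw [RingHom.id_apply, ← map_smul, Submodule.coe_smul, hcomm, smul_comm c a] }
  have hker : LinearMap.ker Ψ = p • ⊤ := by
    refine le_antisymm (fun x hx => ?_) ?_
    · have h1 : (algebraMap A K π)⁻¹ • c • (x : W) ∈ Λ :=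
        (Submodule.Quotient.mk_eq_zero Λ).mp hx
      have h2 : c • x = π • (⟨_, h1⟩ : Λ) := Subtype.ext (by
        rw [Submodule.coe_smul, Submodule.coe_smul, hdiv'])
      have h3 : x = c' • π • (⟨_, h1⟩ : Λ) + a₀ • x := by
        rw [← h2, smul_smul, ← add_smul, hc', one_smul]
      rw [h3]
      exact add_mem (Submodule.smul_mem _ _ (Submodule.smul_mem_smul hπ trivial))
        (Submodule.smul_mem_smul ha₀ trivial)
    · rw [Submodule.smul_le]
      intro a ha x _
      obtain ⟨a', ha'⟩ := hcπ a ha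
      rw [LinearMap.mem_ker]
      change Λ.mkQ ((algebraMap A K π)⁻¹ • c • a • (x : W)) = 0
      rw [smul_smul c, mul_comm c, ha', mul_smul, hdiv, Submodule.mkQ_apply,
        Submodule.Quotient.mk_eq_zero]
      exact Λ.smul_mem _ x.2
  have hrange : LinearMap.range Ψ = Submodule.torsionBySet A (W ⧸ Λ) (p : Set A) := by
    refine le_antisymm ?_ fun w hw => ?_
    · rintro _ ⟨x, rfl⟩
      rw [Submodule.mem_torsionBySet_iff]
      rintro ⟨a, ha⟩
      change a • Ψ x = 0
      rw [← map_smul, ← LinearMap.mem_ker, hker]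
      exact Submodule.smul_mem_smul ha trivial
    · obtain ⟨w, rfl⟩ := Λ.mkQ_surjective w
      rw [Submodule.mem_torsionBySet_iff] at hw
      have hw' : ∀ a ∈ p, a • w ∈ Λ := fun a ha => by
        rw [← Submodule.ker_mkQ Λ, LinearMap.mem_ker, map_smul]
        exact hw ⟨a, ha⟩
      refine ⟨c' • ⟨π • w, hw' π hπ⟩, ?_⟩
      change Λ.mkQ ((algebraMap A K π)⁻¹ • c • c' • π • w) = Λ.mkQ w
      rw [← hcomm, ← hcomm, hdiv, smul_smul, mul_comm c, ← sub_eq_zero, ← map_sub,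
        ← LinearMap.mem_ker, Submodule.ker_mkQ]
      have h1 : (c' * c) • w - w = -(a₀ • w) := by
        rw [eq_sub_iff_add_eq.mpr hc', sub_smul, one_smul]
        abel
      rw [h1]
      exact neg_mem (hw' a₀ ha₀)
  let : Field (A ⧸ p) := Ideal.Quotient.field p
  have : Module.Finite A Λ := Module.Finite.iff_fg.mpr hΛ
  have : Module.Finite (A ⧸ p) (Λ ⧸ (p • ⊤ : Submodule A Λ)) :=
    Module.Finite.of_restrictScalars_finite A _ _
  rw [← finrank_quotient_smul_top_eq_finrank_span hΛ p, ← hrange,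
    ← Module.natCard_eq_pow_finrank (K := A ⧸ p), ← hker]
  exact Nat.card_congr Ψ.quotKerEquivRange.symm.toEquiv

end Lattice

/-! ### Discrete submodules and finite generation -/

section Discrete

open Polynomial

theorem IsUltrametricDist.norm_sub_le_max {S : Type*} [SeminormedAddCommGroup S]
    [IsUltrametricDist S] (x y : S) : ‖x - y‖ ≤ max ‖x‖ ‖y‖ := by
  simpa [sub_eq_add_neg] using IsUltrametricDist.norm_add_le_max x (-y)

theorem aeval_smul_eq_aeval_smul {k F : Type*} [Field k] [Field F] [Algebra k F] {τ : F}
    {A W : Type*} [CommRing A] [Algebra k A] [AddCommGroup W]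
    [Module A W] [Module F W] {T : A} (hT : ∀ w : W, T • w = τ • w)
    (hk : ∀ (c : k) (w : W), algebraMap k A c • w = algebraMap k F c • w) (g : k[X]) (w : W) :
    aeval T g • w = aeval τ g • w := by
  have hpow : ∀ n : ℕ, T ^ n • w = τ ^ n • w := fun n => by
    induction n with
    | zero => rw [pow_zero, pow_zero, one_smul, one_smul]
    | succ n ih => rw [pow_succ', mul_smul, ih, hT, smul_smul, ← pow_succ']
  induction g using Polynomial.induction_on' with
  | add f g hf hg => rw [map_add, map_add, add_smul, add_smul, hf, hg]
  | monomial n c =>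
    rw [aeval_monomial, aeval_monomial, mul_smul, mul_smul, hpow, hk]

section Norm

variable {k F : Type*} [Field k] [Finite k] [NormedField F] [Algebra k F]

theorem norm_algebraMap_eq_one_of_finite {c : k} (hc : c ≠ 0) : ‖algebraMap k F c‖ = 1 := by
  have h1 : c ^ Nat.card kˣ = 1 := by
    have := congrArg Units.val (pow_card_eq_one' (x := Units.mk0 c hc))
    rwa [Units.val_pow_eq_pow_val] at this
  refine (pow_eq_one_iff_of_nonneg (norm_nonneg _) (Nat.card_pos (α := kˣ)).ne').mp ?_
  rw [← norm_pow, ← map_pow, h1, map_one, norm_one]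

variable [IsUltrametricDist F] {τ : F}

theorem norm_aeval_le_pow (hτ : 1 ≤ ‖τ‖) {g : k[X]} {m : ℕ} (hg : g.natDegree ≤ m) :
    ‖aeval τ g‖ ≤ ‖τ‖ ^ m := by
  rw [aeval_eq_sum_range' (Nat.lt_succ_of_le hg)]
  refine IsUltrametricDist.norm_sum_le_of_forall_le_of_nonneg (by positivity) fun i hi => ?_
  rw [Algebra.smul_def, norm_mul, norm_pow]
  have h1 : ‖algebraMap k F (g.coeff i)‖ ≤ 1 := by
    by_cases h : g.coeff i = 0
    · simp [h]
    · exact (norm_algebraMap_eq_one_of_finite h).le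
  calc _ ≤ 1 * ‖τ‖ ^ m := mul_le_mul h1 (pow_le_pow_right₀ hτ
        (Nat.lt_succ_iff.mp (Finset.mem_range.mp hi))) (by positivity) zero_le_one
    _ = _ := one_mul _

/-- Nonzero constants have norm 1 and ‖τ‖ > 1, so the leading term dominates strictly. -/
theorem norm_aeval_eq_pow (hτ : 1 < ‖τ‖) {g : k[X]} (hg : g ≠ 0) :
    ‖aeval τ g‖ = ‖τ‖ ^ g.natDegree := by
  have h1 : ‖aeval τ (monomial g.natDegree g.leadingCoeff)‖ = ‖τ‖ ^ g.natDegree := by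
    rw [aeval_monomial, norm_mul, norm_pow, norm_algebraMap_eq_one_of_finite
      (leadingCoeff_ne_zero.mpr hg), one_mul]
  rcases Nat.eq_zero_or_pos g.natDegree with h0 | h0
  · rw [← h1, h0]
    conv_lhs => rw [eq_C_of_natDegree_eq_zero h0]
    rw [leadingCoeff, h0, monomial_zero_left]
  · have h2 : ‖aeval τ g.eraseLead‖ < ‖τ‖ ^ g.natDegree :=
      (norm_aeval_le_pow hτ.le g.eraseLead_natDegree_le).trans_lt
        (pow_lt_pow_right₀ hτ (by omega))
    rw [← h1] at h2
    conv_lhs => rw [← g.eraseLead_add_monomial_natDegree_leadingCoeff, map_add]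
    rw [IsUltrametricDist.norm_add_eq_max_of_norm_ne_norm h2.ne, max_eq_right h2.le, h1]

/-- Division with remainder: the quotient is the polynomial part, and remainder over denominator has
norm < 1. -/
theorem exists_norm_sub_aeval_lt_one (hτ : 1 < ‖τ‖) {α : F}
    (hα : α ∈ IntermediateField.adjoin k {τ}) : ∃ g : k[X], ‖α - aeval τ g‖ < 1 := by
  obtain ⟨a, b, rfl⟩ := (IntermediateField.mem_adjoin_simple_iff k α).mp hα
  by_cases hb : b = 0
  · exact ⟨0, by simp [hb]⟩
  refine ⟨a / b, ?_⟩
  have hb' : aeval τ b ≠ 0 := by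
    rw [← norm_pos_iff, norm_aeval_eq_pow hτ hb]
    exact pow_pos (zero_lt_one.trans hτ) _
  have h1 : aeval τ a / aeval τ b - aeval τ (a / b) = aeval τ (a % b) / aeval τ b := by
    rw [eq_div_iff hb', sub_mul, div_mul_cancel₀ _ hb', ← map_mul, ← map_sub]
    congr 1
    rw [sub_eq_iff_eq_add, mul_comm, EuclideanDomain.mod_add_div]
  rw [h1, norm_div, div_lt_one (norm_pos_iff.mpr hb'), norm_aeval_eq_pow hτ hb]
  by_cases hr : a % b = 0
  · rw [hr, map_zero, norm_zero]
    exact pow_pos (zero_lt_one.trans hτ) _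
  · rw [norm_aeval_eq_pow hτ hr]
    exact pow_lt_pow_right₀ hτ (natDegree_lt_natDegree hr (degree_mod_lt a hb))

/-- A discrete submodule which is contained in a finite-dimensional space over `k(τ)` is finitely
generated. -/
theorem fg_of_discrete {A W : Type*} [CommRing A] [Algebra k A] [NormedAddCommGroup W]
    [NormedSpace F W] [Module A W] (hτ : 1 < ‖τ‖) {T : A} (hT : ∀ w : W, T • w = τ • w)
    (hk : ∀ (c : k) (w : W), algebraMap k A c • w = algebraMap k F c • w)
    {Λ : Submodule A W} {ε : ℝ} (hε : 0 < ε) (hΛ : ∀ w ∈ Λ, ‖w‖ < ε → w = 0)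
    {ι : Type*} [Finite ι] {v : ι → W} (hv : ∀ i, v i ∈ Λ)
    (hspan : ∀ w ∈ Λ, ∃ α : ι → F, (∀ i, α i ∈ IntermediateField.adjoin k {τ}) ∧
      w = ∑ᶠ i, α i • v i) : Λ.FG := by
  cases nonempty_fintype ι
  simp_rw [finsum_eq_sum_of_fintype] at hspan
  have haeval := aeval_smul_eq_aeval_smul hT hk
  have hτmem : τ ∈ IntermediateField.adjoin k {τ} := IntermediateField.mem_adjoin_simple_self k τ
  have haevalmem : ∀ g : k[X], aeval τ g ∈ IntermediateField.adjoin k {τ} := fun g =>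
    IntermediateField.algebra_adjoin_le_adjoin k _ (aeval_mem_adjoin_singleton k τ)
  -- With this `J`, a vector whose multiple by τ^J has norm at most ∑ ‖vᵢ‖ is shorter than ε.
  obtain ⟨J, hJ⟩ := pow_unbounded_of_one_lt ((∑ i, ‖v i‖) / ε) hτ
  rw [div_lt_iff₀ hε] at hJ
  have hred : ∀ w : Λ, ∃ (g : ι → k[X]) (β : ι → F), (∀ i, β i ∈ IntermediateField.adjoin k {τ}) ∧
      (∀ i, ‖β i‖ < 1) ∧ (w : W) - ∑ i, aeval T (g i) • v i = ∑ i, β i • v i := by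
    intro w
    obtain ⟨α, hα, hw⟩ := hspan w w.2
    choose g hg using fun i => exists_norm_sub_aeval_lt_one hτ (hα i)
    refine ⟨g, fun i => α i - aeval τ (g i), fun i => sub_mem (hα i) (haevalmem _), hg, ?_⟩
    simp_rw [sub_smul, Finset.sum_sub_distrib, ← hw, haeval]
  choose g β hβ hβ1 hgβ using hred
  -- After removal of polynomial parts the coefficients βᵢ have norm < 1, so the polynomial part of
  -- τ^J βᵢ has degree < J: only finitely many cases occur. Remainders in the same case differ by an
  -- element of Λ shorter than ε, so they are equal.
  choose h hh using fun w i => exists_norm_sub_aeval_lt_one (k := k) hτ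
    (mul_mem (pow_mem hτmem J) (hβ w i))
  have hdeg : ∀ w i, h w i ∈ degreeLT k J := by
    intro w i
    rw [mem_degreeLT]
    by_cases h0 : h w i = 0
    · rw [h0, degree_zero]
      exact WithBot.bot_lt_coe J
    · rw [degree_eq_natDegree h0, Nat.cast_lt, ← pow_lt_pow_iff_right₀ hτ, ← norm_aeval_eq_pow hτ h0]
      have h1 : ‖τ ^ J * β w i‖ < ‖τ‖ ^ J := by
        rw [norm_mul, norm_pow]
        exact mul_lt_of_lt_one_right (pow_pos (zero_lt_one.trans hτ) J) (hβ1 w i)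
      have h2 := IsUltrametricDist.norm_sub_le_max (τ ^ J * β w i)
        (τ ^ J * β w i - aeval τ (h w i))
      rw [sub_sub_cancel] at h2
      exact h2.trans_lt (max_lt h1 ((hh w i).trans_le (one_le_pow₀ hτ.le)))
  have : Finite (degreeLT k J) := Finite.of_equiv _ (degreeLTEquiv k J).symm.toEquiv
  let D : Λ → ι → degreeLT k J := fun w i => ⟨h w i, hdeg w i⟩
  let μ : Λ → W := fun w => w - ∑ i, aeval T (g w i) • v i
  have hμmem : ∀ w, ∑ i, aeval T (g w i) • v i ∈ Λ := fun w =>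
    sum_mem fun i _ => Λ.smul_mem _ (hv i)
  have hDμ : ∀ w w', D w = D w' → μ w = μ w' := by
    intro w w' hww
    rw [← sub_eq_zero]
    refine hΛ _ (sub_mem (sub_mem w.2 (hμmem w)) (sub_mem w'.2 (hμmem w'))) ?_
    have h1 : τ ^ J • (μ w - μ w') = ∑ i, (τ ^ J * β w i - τ ^ J * β w' i) • v i := by
      simp only [μ, hgβ, ← Finset.sum_sub_distrib, Finset.smul_sum, ← sub_smul, smul_smul, mul_sub]
    have h2 : ‖τ ^ J • (μ w - μ w')‖ ≤ ∑ i, ‖v i‖ := by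
      rw [h1]
      refine (norm_sum_le _ _).trans (Finset.sum_le_sum fun i _ => ?_)
      rw [norm_smul]
      refine mul_le_of_le_one_left (norm_nonneg _) ?_
      have h3 : h w i = h w' i := congrArg (fun f => (f i : k[X])) hww
      have h4 := IsUltrametricDist.norm_sub_le_max (τ ^ J * β w i - aeval τ (h w i))
        (τ ^ J * β w' i - aeval τ (h w' i))
      rw [h3, sub_sub_sub_cancel_right] at h4
      have h5 := hh w i
      rw [h3] at h5
      exact h4.trans (max_le h5.le (hh w' i).le)
    rw [norm_smul, norm_pow] at h2
    have h5 := h2.trans_lt hJ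
    exact lt_of_mul_lt_mul_left h5 (by positivity)
  have hfin : (Set.range μ).Finite := by
    have : Function.Injective fun x : Set.range μ => D x.2.choose := fun x y hxy => by
      have := hDμ _ _ hxy
      rw [x.2.choose_spec, y.2.choose_spec] at this
      exact Subtype.ext this
    have := Finite.of_injective _ this
    exact Set.toFinite _
  have hspan' : Λ = Submodule.span A (Set.range v ∪ Set.range μ) := by
    refine le_antisymm (fun w hw => ?_) (Submodule.span_le.mpr ?_)
    · have h1 : w = μ ⟨w, hw⟩ + ∑ i, aeval T (g ⟨w, hw⟩ i) • v i := (sub_add_cancel _ _).symm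
      rw [h1]
      exact add_mem (Submodule.subset_span (Or.inr ⟨_, rfl⟩)) (sum_mem fun i _ =>
        Submodule.smul_mem _ _ (Submodule.subset_span (Or.inl ⟨i, rfl⟩)))
    · rintro _ (⟨i, rfl⟩ | ⟨w, rfl⟩)
      · exact hv i
      · exact sub_mem w.2 (hμmem w)
  rw [hspan']
  exact Submodule.fg_span ((Set.finite_range v).union hfin)

end Norm

end Discrete

/-! ### Torsion of quotients by discrete submodules -/

section DiscreteSpan

open Polynomial

variable {k F A K W : Type*} [Field k] [Finite k] [NormedField F] [IsUltrametricDist F]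
  [Algebra k F] [CommRing A] [Algebra k A] [Field K] [Algebra A K] [IsFractionRing A K]
  [Algebra k K] [IsScalarTower k A K] [NormedAddCommGroup W] [NormedSpace F W] [Module A W]
  [Module K W] [IsScalarTower A K W]

/-- Elements of K need not act on W by scalars of F. Those of k(T) do, through T ↦ τ, which makes
norm estimates applicable to them. -/
theorem exists_forall_smul_eq_smul {τ : F} (hτ : 1 < ‖τ‖) {T : A} (hT : ∀ w : W, T • w = τ • w)
    (hk : ∀ (c : k) (w : W), algebraMap k A c • w = algebraMap k F c • w) {c : K}
    (hc : c ∈ IntermediateField.adjoin k {algebraMap A K T}) :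
    ∃ α ∈ IntermediateField.adjoin k {τ}, ∀ w : W, c • w = α • w := by
  obtain ⟨a, b, rfl⟩ := (IntermediateField.mem_adjoin_simple_iff k c).mp hc
  by_cases hb : aeval (algebraMap A K T) b = 0
  · exact ⟨0, zero_mem _, fun w => by rw [hb, div_zero, zero_smul, zero_smul]⟩
  have hb0 : b ≠ 0 := fun h => hb (by rw [h, map_zero])
  have hb' : aeval τ b ≠ 0 := by
    rw [← norm_pos_iff, norm_aeval_eq_pow hτ hb0]
    exact pow_pos (zero_lt_one.trans hτ) _
  have haeval : ∀ (g : k[X]) (w : W), aeval (algebraMap A K T) g • w = aeval τ g • w := fun g w => by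
    rw [aeval_algebraMap_apply, algebraMap_smul, aeval_smul_eq_aeval_smul hT hk]
  refine ⟨aeval τ a / aeval τ b,
    (IntermediateField.mem_adjoin_simple_iff k _).mpr ⟨a, b, rfl⟩, fun w => ?_⟩
  have h1 : w = aeval τ b • (aeval (algebraMap A K T) b)⁻¹ • w := by
    rw [← haeval, smul_inv_smul₀ hb]
  rw [div_eq_mul_inv, mul_smul, haeval]
  conv_rhs => rw [h1, smul_smul, div_mul_cancel₀ _ hb']

/-- The intersection of a discrete `A`-submodule `Λ` with the `K`-span of finitely many of its
elements is finitely generated. -/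
theorem fg_inf_span_of_discrete {τ : F} (hτ : 1 < ‖τ‖) {T : A} (hT : ∀ w : W, T • w = τ • w)
    (hk : ∀ (c : k) (w : W), algebraMap k A c • w = algebraMap k F c • w)
    [FiniteDimensional (IntermediateField.adjoin k {algebraMap A K T}) K]
    {Λ : Submodule A W} {ε : ℝ} (hε : 0 < ε) (hΛ : ∀ w ∈ Λ, ‖w‖ < ε → w = 0)
    {ι : Type*} [Finite ι] {l : ι → W} (hl : ∀ i, l i ∈ Λ) :
    (Λ ⊓ (Submodule.span K (Set.range l)).restrictScalars A).FG := by
  cases nonempty_fintype ι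
  have : IsDomain A := (IsFractionRing.injective A K).isDomain (algebraMap A K)
  let e := Module.finBasis (IntermediateField.adjoin k {algebraMap A K T}) K
  -- A basis of K over k(T) is written as βᵢ/b with βᵢ, b ∈ A, so that the vectors βᵢ • lⱼ lie in Λ
  -- and span the same space over k(T) as the lⱼ over K.
  obtain ⟨b, hb⟩ := IsLocalization.exist_integer_multiples_of_finite (nonZeroDivisors A) e
  choose β hβ using hb
  have hb0 : algebraMap A K b ≠ 0 := by simp
  have hlspan : ∀ j, l j ∈ (Submodule.span K (Set.range l)).restrictScalars A := fun j =>
    Submodule.subset_span ⟨j, rfl⟩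
  refine fg_of_discrete (ι := Fin _ × ι) hτ hT hk hε (fun w hw => hΛ w hw.1)
    (v := fun ij => β ij.1 • l ij.2)
    (fun ij => Submodule.smul_mem _ _ ⟨hl ij.2, hlspan ij.2⟩) fun w hw => ?_
  obtain ⟨x, rfl⟩ := (Submodule.mem_span_range_iff_exists_fun K).mp hw.2
  choose α hα hα' using fun ij : Fin _ × ι => exists_forall_smul_eq_smul (W := W) hτ hT hk
    (e.repr ((algebraMap A K b)⁻¹ * x ij.2) ij.1).2
  refine ⟨α, hα, ?_⟩
  rw [finsum_eq_sum_of_fintype, Fintype.sum_prod_type_right]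
  refine Finset.sum_congr rfl fun j _ => ?_
  simp_rw [← hα']
  have h1 : x j = ∑ i, (e.repr ((algebraMap A K b)⁻¹ * x j) i : K) * algebraMap A K (β i) := by
    calc x j = algebraMap A K b * ((algebraMap A K b)⁻¹ * x j) := by rw [mul_inv_cancel_left₀ hb0]
      _ = algebraMap A K b * ∑ i, e.repr ((algebraMap A K b)⁻¹ * x j) i • e i := by rw [e.sum_repr]
      _ = _ := by
        rw [Finset.mul_sum]
        refine Finset.sum_congr rfl fun i _ => ?_
        rw [hβ i, IntermediateField.smul_def, smul_eq_mul, Algebra.smul_def (b : A)]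
        ring
  conv_lhs => rw [h1, Finset.sum_smul]
  refine Finset.sum_congr rfl fun i _ => ?_
  rw [mul_smul, algebraMap_smul]

/-- A discrete `A`-submodule `Λ` whose `p`-torsion has at most `(#A/p)^r` elements for a single
prime `p` spans a space of dimension at most `r`, so the order of the `p`-torsion of `W / Λ` is
known for all primes `p`. -/
theorem exists_forall_natCard_torsionBySet_quotient [IsDedekindDomain A]
    [Ring.HasFiniteQuotients A] {τ : F} (hτ : 1 < ‖τ‖) {T : A}
    (hT : ∀ w : W, T • w = τ • w)
    (hk : ∀ (c : k) (w : W), algebraMap k A c • w = algebraMap k F c • w)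
    [FiniteDimensional (IntermediateField.adjoin k {algebraMap A K T}) K]
    {Λ : Submodule A W} {ε : ℝ} (hε : 0 < ε) (hΛ : ∀ w ∈ Λ, ‖w‖ < ε → w = 0)
    {p : Ideal A} (hp : p.IsPrime) (hp0 : p ≠ ⊥) {r : ℕ}
    (hr : Nat.card (Submodule.torsionBySet A (W ⧸ Λ) (p : Set A)) = Nat.card (A ⧸ p) ^ r) :
    ∀ p' : Ideal A, p'.IsPrime → p' ≠ ⊥ →
      Nat.card (Submodule.torsionBySet A (W ⧸ Λ) (p' : Set A)) = Nat.card (A ⧸ p') ^ r := by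
  have hmax : ∀ {p : Ideal A}, p.IsPrime → p ≠ ⊥ → p.IsMaximal := fun hp hp0 => hp.isMaximal hp0
  have hcard : ∀ {p : Ideal A}, p.IsPrime → p ≠ ⊥ → 1 < Nat.card (A ⧸ p) := fun {p} hp hp0 => by
    have := Ring.HasFiniteQuotients.finiteQuotient hp0
    have := Ideal.Quotient.nontrivial_iff.mpr hp.ne_top
    exact Finite.one_lt_card
  have hfg : ∀ t : Finset W, (t : Set W) ⊆ Λ →
      (Λ ⊓ (Submodule.span K (t : Set W)).restrictScalars A).FG := fun t ht => by
    have h1 := fg_inf_span_of_discrete (K := K) (ι := t) (l := Subtype.val) hτ hT hk hε hΛ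
      fun i => ht i.2
    rwa [Subtype.range_coe_subtype, Finset.setOfPred_mem] at h1
  have hspan : ∀ t : Finset W, (t : Set W) ⊆ Λ → LinearIndepOn K id (t : Set W) →
      Module.finrank K (Submodule.span K
        ((Λ ⊓ (Submodule.span K (t : Set W)).restrictScalars A : Submodule A W) : Set W)) =
          t.card := fun t ht hli => by
    rw [← finrank_span_finset_eq_card hli]
    exact congrArg (fun S : Submodule K W => Module.finrank K S) <| le_antisymm (Submodule.span_le.mpr fun w hw => hw.2)
      (Submodule.span_mono fun w hw => ⟨ht hw, Submodule.subset_span hw⟩)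
  obtain ⟨s, hs, hsl, hsli⟩ := exists_linearIndependent K (Λ : Set W)
  by_cases hsf : s.Finite
  · lift s to Finset W using hsf
    have h1 : Λ ⊓ (Submodule.span K (s : Set W)).restrictScalars A = Λ :=
      inf_eq_left.mpr fun w hw => by
        rw [Submodule.restrictScalars_mem, hsl]
        exact Submodule.subset_span hw
    have h2 := hfg s hs
    have h3 := hspan s hs hsli
    rw [h1] at h2 h3
    have h4 : ∀ p' : Ideal A, p'.IsPrime → p' ≠ ⊥ →
        Nat.card (Submodule.torsionBySet A (W ⧸ Λ) (p' : Set A)) = Nat.card (A ⧸ p') ^ s.card :=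
      fun p' hp' hp0' => by
        have := hmax hp' hp0'
        rw [natCard_torsionBySet_quotient (K := K) h2 p' hp0', h3]
    have h5 := h4 p hp hp0
    rw [hr] at h5
    rwa [Nat.pow_right_injective (hcard hp hp0) h5]
  · exfalso
    -- For r + 1 independent elements of Λ, let Λ' be the part of Λ in their K-span. The p-torsion
    -- of W/Λ' has #(A/p)^(r+1) elements and embeds into that of W/Λ, since a K-subspace containing
    -- a • w contains w when a ≠ 0.
    obtain ⟨t, hts, ht⟩ := Set.Infinite.exists_subset_card_eq hsf (r + 1)
    have hli : LinearIndepOn K id (t : Set W) :=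
      LinearIndepOn.mono (show LinearIndepOn K id s from hsli) hts
    have := hmax hp hp0
    have h1 := natCard_torsionBySet_quotient (K := K) (hfg t (hts.trans hs)) p hp0
    rw [hspan t (hts.trans hs) hli, ht] at h1
    have hpos : 0 < Nat.card (Submodule.torsionBySet A (W ⧸ Λ) (p : Set A)) := by
      rw [hr]
      exact pow_pos (zero_lt_one.trans (hcard hp hp0)) r
    have := (Nat.card_pos_iff.mp hpos).2
    obtain ⟨a, hap, ha⟩ := Submodule.exists_mem_ne_zero_of_ne_bot hp0
    let Λ' := Λ ⊓ (Submodule.span K (t : Set W)).restrictScalars A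
    let f : W ⧸ Λ' →ₗ[A] W ⧸ Λ := Submodule.mapQ Λ' Λ LinearMap.id inf_le_left
    have hf : ∀ x ∈ Submodule.torsionBySet A (W ⧸ Λ') (p : Set A),
        f x ∈ Submodule.torsionBySet A (W ⧸ Λ) (p : Set A) := fun x hx => by
      rw [Submodule.mem_torsionBySet_iff] at hx ⊢
      intro b
      rw [← map_smul, hx b, map_zero]
    have hinj : Function.Injective (f.restrict hf) := by
      rw [injective_iff_map_eq_zero]
      rintro ⟨x, hx⟩ hfx
      rw [Subtype.ext_iff] at hfx
      obtain ⟨w, rfl⟩ := Submodule.mkQ_surjective _ x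
      have h2 : w ∈ Λ := (Submodule.Quotient.mk_eq_zero Λ).mp hfx
      have h3 := (Submodule.mem_torsionBySet_iff _ _).mp hx ⟨a, hap⟩
      rw [← map_smul, Submodule.mkQ_apply, Submodule.Quotient.mk_eq_zero] at h3
      have h4 : a • w ∈ (Submodule.span K (t : Set W)) := h3.2
      rw [← algebraMap_smul K a w] at h4
      have h5 := (Submodule.smul_mem_iff _ (by simpa using ha)).mp h4
      exact Subtype.ext ((Submodule.Quotient.mk_eq_zero Λ').mpr ⟨h2, h5⟩)
    have h2 := Nat.card_le_card_of_injective _ hinj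
    rw [hr] at h2
    have h3 := h1.symm.le.trans h2
    exact absurd ((Nat.pow_le_pow_iff_right (hcard hp hp0)).mp h3) (by omega)

end DiscreteSpan

open IntermediateField.algebraAdjoinAdjoin in
theorem IsCurveFunctionField.finiteDimensional_adjoin {k K : Type*} [Field k] [Field K]
    [Algebra k K] (hK : IsCurveFunctionField k K) {y : K} (hy : Transcendental k y) :
    FiniteDimensional (IntermediateField.adjoin k {y}) K := by
  have := hK.essFiniteType
  have halg := hK.isAlgebraic_adjoin hy
  have : Algebra.IsAlgebraic (IntermediateField.adjoin k {y}) K :=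
    IsFractionRing.comap_isAlgebraic_iff (A := Algebra.adjoin k {y}) |>.mp halg
  have : Algebra.EssFiniteType (IntermediateField.adjoin k {y}) K :=
    Algebra.EssFiniteType.of_comp k (IntermediateField.adjoin k {y}) K
  exact Algebra.finite_of_essFiniteType_of_isAlgebraic

/-- A module over a domain on which all nonzero elements act bijectively is a vector space over
the field of fractions. -/
theorem IsFractionRing.exists_module {A : Type*} (K : Type*) {W : Type*} [CommRing A] [IsDomain A]
    [Field K]
    [Algebra A K] [IsFractionRing A K] [AddCommGroup W] [Module A W]
    (h : ∀ a : A, a ≠ 0 → IsUnit (algebraMap A (Module.End A W) a)) :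
    ∃ _ : Module K W, IsScalarTower A K W := by
  have : IsLocalizedModule (nonZeroDivisors A) (LinearMap.id : W →ₗ[A] W) :=
    { map_units s := h s (nonZeroDivisors.ne_zero s.2)
      surj w := ⟨(w, 1), by simp⟩
      exists_of_eq h := ⟨1, by simpa using h⟩ }
  exact ⟨IsLocalizedModule.module (nonZeroDivisors A) (LinearMap.id : W →ₗ[A] W),
    IsLocalizedModule.isScalarTower_module (nonZeroDivisors A) (LinearMap.id : W →ₗ[A] W)⟩

/-! ### The action of A on the Lie algebra -/

namespace AndersonModule

section Lie

variable {k A L : Type*} [Field k] [CommRing A] [Algebra k A] [Field L]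
  [Algebra k L] [Algebra A L] {d : ℕ} (E : AndersonModule k A L d)

theorem lieAction_add (a b : A) : E.lieAction (a + b) = E.lieAction a + E.lieAction b := by
  ext i j
  simp [lieAction, E.map_add]

theorem lieAction_algebraMap (c : k) :
    E.lieAction (algebraMap k A c) = algebraMap L (Matrix (Fin d) (Fin d) L) (algebraMap k L c) := by
  ext i j
  rw [lieAction, Matrix.of_apply, E.map_const, MvPolynomial.coeff_C_mul, MvPolynomial.coeff_X,
    Matrix.algebraMap_matrix_apply]
  simp [Finsupp.single_left_inj]

/-- The chain rule at 0, checked on the generators of the motive; q-th powers contribute no linear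
terms on either side. -/
theorem coeff_single_smul [Finite k] (b : A) (j : Fin d) (m : E.Motive) :
    MvPolynomial.coeff (Finsupp.single j 1) (b • m).toPoly =
      ∑ l, MvPolynomial.coeff (Finsupp.single l 1) m.toPoly * E.lieAction b l j := by
  induction m using E.motive_induction with
  | hzero => simp [toPoly_zero]
  | hcoord i =>
    have : ∀ l, MvPolynomial.coeff (Finsupp.single l 1) (E.coord i).toPoly
        = if l = i then 1 else 0 := fun l => by
      change MvPolynomial.coeff (Finsupp.single l 1) (MvPolynomial.X i) = _
      rw [MvPolynomial.coeff_X]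
      simp [Finsupp.single_left_inj, eq_comm]
    simp only [this, ite_mul, one_mul, zero_mul, Finset.sum_ite_eq', Finset.mem_univ, if_true]
    rw [toPoly_smul]
    exact congrArg _ (MvPolynomial.bind₁_X_right _ _)
  | hfrob m _ =>
    rw [← frob_smul, coeff_single_frob]
    simp only [coeff_single_frob, zero_mul, Finset.sum_const_zero]
  | hsmul c m h =>
    rw [smul_comm, toPoly_smul', MvPolynomial.coeff_smul, h, smul_eq_mul, Finset.mul_sum]
    simp [toPoly_smul', mul_assoc]
  | hadd m n h1 h2 =>
    rw [smul_add, toPoly_add, MvPolynomial.coeff_add, h1, h2, ← Finset.sum_add_distrib]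
    simp [toPoly_add, add_mul]

theorem lieAction_mul [Finite k] (a b : A) :
    E.lieAction (a * b) = E.lieAction a * E.lieAction b := by
  ext i j
  have h := E.coeff_single_smul b j (a • E.coord i)
  have h1 : (a • E.coord i).toPoly = E.φ a i := MvPolynomial.bind₁_X_right _ _
  rw [smul_smul, mul_comm] at h
  have h2 : ((a * b) • E.coord i).toPoly = E.φ (a * b) i := MvPolynomial.bind₁_X_right _ _
  rw [h1, h2] at h
  exact h

/-- The derivative of `φ`. -/
def lieHom [Finite k] : A →+* Matrix (Fin d) (Fin d) L where
  toFun := E.lieAction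
  map_one' := by simpa using E.lieAction_algebraMap 1
  map_mul' := E.lieAction_mul
  map_zero' := by simpa using E.lieAction_algebraMap 0
  map_add' := E.lieAction_add

/-- Some power of `a` acts on the Lie algebra as a scalar. -/
theorem exists_lieAction_pow_eq [Finite k] (a : A) :
    ∃ n, n ≠ 0 ∧ E.lieAction (a ^ n) =
      algebraMap L (Matrix (Fin d) (Fin d) L) (algebraMap A L (a ^ n)) := by
  rcases isEmpty_or_nonempty (Fin d) with h | h
  · exact ⟨1, one_ne_zero, Subsingleton.elim _ _⟩
  obtain ⟨p, hp⟩ := CharP.exists k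
  have hpp : p.Prime := CharP.char_is_prime k p
  have := Fact.mk hpp
  have : CharP (Matrix (Fin d) (Fin d) L) p := charP_of_injective_algebraMap
    (algebraMap k (Matrix (Fin d) (Fin d) L)).injective p
  obtain ⟨m, hm⟩ := E.nilpotent a
  have hm' : (E.lieAction a - algebraMap L (Matrix (Fin d) (Fin d) L) (algebraMap A L a)) ^ m = 0 :=
    hm
  -- In characteristic p, the p^m-th power of dφ_a - ℓ(a) is the difference of the p^m-th powers. It
  -- vanishes because m < p^m.
  refine ⟨p ^ m, pow_ne_zero _ hpp.ne_zero, ?_⟩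
  have h1 := sub_pow_char_pow_of_commute (n := m) p
    (Algebra.commutes (algebraMap A L a) (E.lieAction a)).symm
  rw [pow_eq_zero_of_le (Nat.lt_pow_self hpp.one_lt).le hm', eq_comm, sub_eq_zero] at h1
  rw [_root_.map_pow, _root_.map_pow, ← h1]
  exact _root_.map_pow E.lieHom a _

/-- The Lie algebra `Lie E(F)`, on which `A` acts through the derivative of `φ`. -/
@[nolint unusedArguments]
def Lie (_E : AndersonModule k A L d) (F : Type*) : Type _ := Fin d → F

section Module

variable (F : Type*) [NormedField F] [Algebra L F]

instance : NormedAddCommGroup (E.Lie F) := inferInstanceAs (NormedAddCommGroup (Fin d → F))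

instance : NormedSpace F (E.Lie F) := inferInstanceAs (NormedSpace F (Fin d → F))

instance [Finite k] : Module A (E.Lie F) :=
  Module.compHom (Fin d → F) ((Matrix.toLinAlgEquiv' (R := F) (n := Fin d)).toRingHom.comp
    (((algebraMap L F).mapMatrix).comp E.lieHom))

variable {F}

theorem lie_smul_eq_mulVec [Finite k] (a : A) (w : E.Lie F) :
    a • w = (((E.lieAction a).map (algebraMap L F)).mulVec (w : Fin d → F) : Fin d → F) := by
  exact Matrix.toLin'_apply _ _

end Module

end Lie

end AndersonModule

/-! ### The exponential map and discreteness of its kernel -/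

namespace AndersonModule

section Exponential

variable {k A L : Type*} [Field k] [Finite k] [CommRing A] [Algebra k A] [Field L]
  [Algebra k L] [Algebra A L] {d : ℕ} (E : AndersonModule k A L d)
  {F : Type*} [NormedField F] [Algebra L F]

theorem add_pow_natCard_pow (k : Type*) [Field k] [Finite k] {S : Type*} [CommRing S] [Algebra k S]
    (x y : S) (n : ℕ) : (x + y) ^ Nat.card k ^ n = x ^ Nat.card k ^ n + y ^ Nat.card k ^ n := by
  induction n with
  | zero => simp
  | succ n ih => rw [pow_succ, pow_mul, pow_mul, pow_mul, ih, add_pow_natCard]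

variable {E} {e : (Fin d → F) → E.Points F}

theorem IsExponential.map_add [Algebra k F] (he : E.IsExponential e) (x y : Fin d → F) :
    e (x + y) = e x + e y := by
  obtain ⟨⟨c, -, hc⟩, -⟩ := he
  funext i
  refine (hc (x + y) i).unique ?_
  convert (hc x i).add (hc y i) using 1
  swap
  · rfl
  funext n
  have h : (fun j => (x + y) j ^ Nat.card k ^ n) =
      (fun j => x j ^ Nat.card k ^ n) + fun j => y j ^ Nat.card k ^ n :=
    funext fun j => add_pow_natCard_pow k (x j) (y j) n
  rw [h, Matrix.mulVec_add, Pi.add_apply]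

/-- The exponential map as a homomorphism of `A`-modules. -/
def expLinear [Algebra k F] (he : E.IsExponential e) : E.Lie F →ₗ[A] E.Points F where
  toFun := e
  map_add' := he.map_add
  map_smul' a x := by
    rw [lie_smul_eq_mulVec, RingHom.id_apply]
    exact (he.2 a x).symm

/-- Convergence at the standard basis vectors makes the entries of the c_n tend to 0, hence bounded.
For ‖x‖ ≤ 1 every term with n ≥ 1 is then at most C‖x‖², since q^n ≥ 2. -/
theorem IsExponential.exists_norm_sub_le [IsUltrametricDist F] (he : E.IsExponential e) :
    ∃ C : ℝ, 1 ≤ C ∧ ∀ (x : Fin d → F) (i : Fin d), ‖x‖ ≤ 1 → ‖e x i - x i‖ ≤ C * ‖x‖ ^ 2 := by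
  obtain ⟨⟨c, hc0, hc⟩, -⟩ := he
  have hq : 1 < Nat.card k := Finite.one_lt_card
  have hbd : ∀ i j, ∃ C : ℝ, ∀ n, ‖c n i j‖ ≤ C := fun i j => by
    have h1 := (hc (Pi.single j 1) i).summable.tendsto_atTop_zero
    have h2 : (fun n => (c n).mulVec
        (fun l => (Pi.single j 1 : Fin d → F) l ^ Nat.card k ^ n) i) = fun n => c n i j := by
      funext n
      have h3 : (fun l => (Pi.single j 1 : Fin d → F) l ^ Nat.card k ^ n) = Pi.single j 1 := by
        funext l
        rcases eq_or_ne l j with rfl | hl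
        · simp
        · simp [hl, (zero_lt_one.trans hq).ne']
      rw [h3, Matrix.mulVec_single_one, Matrix.col_apply]
    rw [h2] at h1
    obtain ⟨C, hC⟩ := h1.norm.bddAbove_range
    exact ⟨C, fun n => hC ⟨n, rfl⟩⟩
  choose B hB using hbd
  let C := 1 + ∑ i, ∑ j, |B i j|
  have hC : ∀ n i j, ‖c n i j‖ ≤ C := fun n i j => by
    calc ‖c n i j‖ ≤ |B i j| := (hB i j n).trans (le_abs_self _)
      _ ≤ ∑ j, |B i j| := Finset.single_le_sum (f := fun j => |B i j|)
        (fun _ _ => abs_nonneg _) (Finset.mem_univ j)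
      _ ≤ ∑ i, ∑ j, |B i j| := Finset.single_le_sum (f := fun i => ∑ j, |B i j|)
        (fun _ _ => Finset.sum_nonneg fun _ _ => abs_nonneg _) (Finset.mem_univ i)
      _ ≤ C := le_add_of_nonneg_left zero_le_one
  have hC1 : 1 ≤ C := le_add_of_nonneg_right
    (Finset.sum_nonneg fun _ _ => Finset.sum_nonneg fun _ _ => abs_nonneg _)
  refine ⟨C, hC1, fun x i hx => ?_⟩
  have h1 := hasSum_ite_sub_hasSum (hc x i) 0
  have h0 : (c 0).mulVec (fun j => x j ^ Nat.card k ^ 0) i = x i := by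
    rw [hc0, Matrix.one_mulVec, pow_zero, pow_one]
  rw [h0] at h1
  refine le_of_tendsto' h1.norm fun s => ?_
  refine IsUltrametricDist.norm_sum_le_of_forall_le_of_nonneg (by positivity) fun n _ => ?_
  split_ifs with hn
  · rw [norm_zero]
    positivity
  · change ‖∑ j, c n i j * x j ^ Nat.card k ^ n‖ ≤ _
    refine IsUltrametricDist.norm_sum_le_of_forall_le_of_nonneg (by positivity) fun j _ => ?_
    rw [norm_mul, norm_pow]
    refine mul_le_mul (hC n i j) ?_ (by positivity) (by positivity)
    calc ‖x j‖ ^ Nat.card k ^ n ≤ ‖x‖ ^ Nat.card k ^ n :=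
          pow_le_pow_left₀ (norm_nonneg _) (norm_le_pi_norm x j) _
      _ ≤ ‖x‖ ^ 2 := pow_le_pow_of_le_one (norm_nonneg _) hx
          (hq.trans_le (Nat.le_self_pow hn _))

/-- The period lattice is discrete. -/
theorem IsExponential.exists_forall_eq_zero [IsUltrametricDist F] (he : E.IsExponential e) :
    ∃ ε : ℝ, 0 < ε ∧ ∀ x : Fin d → F, e x = 0 → ‖x‖ < ε → x = 0 := by
  obtain ⟨C, hC, h⟩ := he.exists_norm_sub_le
  have hC0 : 0 < C := zero_lt_one.trans_le hC
  refine ⟨1 / C, by positivity, fun x hx hxε => ?_⟩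
  rw [lt_div_iff₀ hC0] at hxε
  have hx1 : ‖x‖ ≤ 1 := (le_mul_of_one_le_right (norm_nonneg x) hC).trans hxε.le
  have h1 : ‖x‖ ≤ C * ‖x‖ ^ 2 := (pi_norm_le_iff_of_nonneg (by positivity)).mpr fun i => by
    have h2 := h x i hx1
    rw [hx] at h2
    rwa [show (0 : E.Points F) i = (0 : F) from rfl, zero_sub, norm_neg] at h2
  by_contra hne
  have h3 : 0 < ‖x‖ := norm_pos_iff.mpr hne
  nlinarith

end Exponential

/-! ### Torsion of uniformizable modules -/

section Uniformizable

variable {k A L : Type*} [Field k] [Finite k] [CommRing A] [Algebra k A] [Field L]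
  [Algebra k L] [Algebra A L] {d : ℕ} {E : AndersonModule k A L d}
  {F : Type*} [NormedField F] [IsUltrametricDist F] [Algebra L F] [Algebra k F]
  [IsScalarTower k L F]

/-- The order of the `𝔭`-torsion of a uniformizable `E` is given by the same rank for all `𝔭`. -/
theorem IsUniformizable.natCard_torsion [IsDedekindDomain A] [Ring.HasFiniteQuotients A]
    (K : Type*) [Field K] [Algebra k K] [Algebra A K] [IsFractionRing A K] [IsScalarTower k A K]
    (hK : ∀ y : K, Transcendental k y → FiniteDimensional (IntermediateField.adjoin k {y}) K)
    [FaithfulSMul A L] [IsScalarTower k A L] {t : A} (ht : 1 < ‖algebraMap L F (algebraMap A L t)‖)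
    (hE : E.IsUniformizable F) {p : Ideal A} (hp : p.IsPrime) (hp0 : p ≠ ⊥) {r : ℕ}
    (hr : Nat.card (E.torsion F p) = Nat.card (A ⧸ p) ^ r) :
    ∀ p' : Ideal A, p'.IsPrime → p' ≠ ⊥ →
      Nat.card (E.torsion F p') = Nat.card (A ⧸ p') ^ r := by
  obtain ⟨e, he, hsurj⟩ := hE
  obtain ⟨ε, hε, hΛ⟩ := he.exists_forall_eq_zero
  -- The power t^n acts on the Lie algebra by a scalar, whose norm exceeds 1; it serves as T for the
  -- period lattice.
  obtain ⟨n, hn, hT⟩ := E.exists_lieAction_pow_eq t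
  have hτ : 1 < ‖algebraMap L F (algebraMap A L (t ^ n))‖ := by
    rw [_root_.map_pow, _root_.map_pow, norm_pow]
    exact one_lt_pow₀ ht hn
  have hscalar : ∀ (c : L) (a : A), E.lieAction a = algebraMap L _ c →
      ∀ w : E.Lie F, a • w = algebraMap L F c • w := fun c a ha w => by
    have h1 : (algebraMap L (Matrix (Fin d) (Fin d) L) c).map (algebraMap L F) =
        algebraMap F _ (algebraMap L F c) := by
      rw [Matrix.algebraMap_eq_diagonal, Matrix.algebraMap_eq_diagonal,
        Matrix.diagonal_map (_root_.map_zero _)]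
      rfl
    rw [lie_smul_eq_mulVec, ha, h1, Algebra.algebraMap_eq_smul_one]
    exact (Matrix.smul_mulVec _ _ _).trans (congrArg _ (Matrix.one_mulVec _))
  have hk : ∀ (c : k) (w : E.Lie F), algebraMap k A c • w = algebraMap k F c • w := fun c w => by
    rw [IsScalarTower.algebraMap_apply k L F]
    exact hscalar _ _ (E.lieAction_algebraMap c) w
  have hinj : Function.Injective (algebraMap A L) := FaithfulSMul.algebraMap_injective A L
  -- Every nonzero a acts invertibly on the Lie algebra, which thereby becomes a vector space over
  -- K.
  obtain ⟨_, _⟩ := IsFractionRing.exists_module (A := A) K (W := E.Lie F) fun a ha => by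
    rw [Module.End.isUnit_iff]
    have h1 : IsUnit ((E.lieAction a).map (algebraMap L F)) :=
      (E.isUnit_lieAction ((map_ne_zero_iff _ hinj).mpr ha)).map (algebraMap L F).mapMatrix
    have h2 : ⇑(algebraMap A (Module.End A (E.Lie F)) a) =
        ((E.lieAction a).map (algebraMap L F)).mulVec :=
      funext fun w => lie_smul_eq_mulVec E a w
    rw [h2]
    exact ⟨Matrix.mulVec_injective_of_isUnit h1, Matrix.mulVec_surjective_iff_isUnit.mpr h1⟩
  have htr : Transcendental k (algebraMap A K (t ^ n)) := transcendental_iff.mpr fun g hg => by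
    by_contra hg0
    rw [Polynomial.aeval_algebraMap_apply, map_eq_zero_iff _ (IsFractionRing.injective A K)] at hg
    have h1 := norm_aeval_eq_pow hτ hg0
    rw [Polynomial.aeval_algebraMap_apply, Polynomial.aeval_algebraMap_apply, hg,
      _root_.map_zero, _root_.map_zero, norm_zero] at h1
    exact (pow_pos (zero_lt_one.trans hτ) _).ne h1
  have := hK _ htr
  have key := exists_forall_natCard_torsionBySet_quotient (K := K) (F := F) (W := E.Lie F)
    (Λ := LinearMap.ker (expLinear he)) hτ (hscalar _ _ hT) hk hε (fun w hw => hΛ w hw) (r := r) hp hp0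
  let f : (E.Lie F ⧸ LinearMap.ker (expLinear he)) ≃ₗ[A] E.Points F :=
    (expLinear he).quotKerEquivOfSurjective hsurj
  have hcard : ∀ p : Ideal A, Nat.card (Submodule.torsionBySet A
      (E.Lie F ⧸ LinearMap.ker (expLinear he)) (p : Set A)) = Nat.card (E.torsion F p) := fun p =>
    Nat.card_congr <| f.toEquiv.subtypeEquiv fun x => by
      rw [Submodule.mem_torsionBySet_iff, Submodule.mem_torsionBySet_iff]
      refine forall_congr' fun a => ?_
      rw [← map_eq_zero_iff f f.injective, map_smul]
      rfl
  simp_rw [hcard] at key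
  exact key hr

end Uniformizable

end AndersonModule

/-- The dimension of a vector space over a finite field is determined by its order. -/
theorem Module.rank_eq_of_natCard_eq_pow {κ V : Type*} [Field κ] [Finite κ] [AddCommGroup V]
    [Module κ V] {r : ℕ} (h : Nat.card V = Nat.card κ ^ r) : Module.rank κ V = r := by
  have hpos : 0 < Nat.card V := by
    rw [h]
    exact pow_pos Nat.card_pos r
  have := (Nat.card_pos_iff.mp hpos).2
  rw [Module.natCard_eq_pow_finrank (K := κ)] at h
  rw [← Module.finrank_eq_rank, Nat.pow_right_injective (Finite.one_lt_card (α := κ)) h]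

theorem AndersonModule.torsionRank_eq_of_natCard_eq_pow {k A L : Type*} [Field k] [CommRing A]
    [Algebra k A] [Field L] [Algebra k L] [Algebra A L] {d : ℕ} (E : AndersonModule k A L d)
    (F : Type*) [Field F] [Algebra L F] {p : Ideal A} [p.IsMaximal] [Finite (A ⧸ p)] {r : ℕ}
    (h : Nat.card (E.torsion F p) = Nat.card (A ⧸ p) ^ r) : E.torsionRank F p = r := by
  let := Ideal.Quotient.field p
  exact Module.rank_eq_of_natCard_eq_pow h

end

/-! ### The theorem on torsion ranks -/

theorem theoremC {k K : Type*} [Field k] [Finite k] [Field K] [Algebra k K]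
    (hK : IsCurveFunctionField k K) (P : CurvePlace k K)
    (v : AbsoluteValue (AlgebraicClosure K) ℝ) (hv : LiesAbovePlace v P)
    (L : IntermediateField K (CInfty v)) (d : ℕ)
    (E : AndersonModule k (regularAway P) L d) :
    ∃ r : ℕ, E.motiveRank = r ∧
      {p : Ideal (regularAway P) | p.IsPrime ∧ p ≠ ⊥ ∧ E.torsionRank (CInfty v) p ≠ r}.Finite ∧
      (E.IsUniformizable (CInfty v) →
        ∀ p : Ideal (regularAway P), p.IsPrime → p ≠ ⊥ → E.torsionRank (CInfty v) p = r) := by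
  obtain ⟨_, _, _⟩ := hK.regularAway_structure P
  have := hK.isDomain_regularAway_tensorProduct P L
  have := CInfty.isUltrametricDist hv
  have := CInfty.isSepClosed hv
  obtain ⟨t, htP, ht⟩ := hK.exists_mem_regularAway_notMem P
  let t' : regularAway P := ⟨t, htP⟩
  have htr : Transcendental k t' := by
    have h1 := hK.transcendental_of_notMem P ht
    exact fun h => h1 (h.algebraMap (A := K))
  have hli : LinearIndependent k fun j : ℕ => t' ^ j := by
    have h1 := (Polynomial.basisMonomials k).linearIndependent.map'
      (Polynomial.aeval (R := k) t').toLinearMap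
      (LinearMap.ker_eq_bot.mpr (transcendental_iff_injective.mp htr))
    simpa [Function.comp_def] using h1
  have hinj : Function.Injective (algebraMap (regularAway P) L) := by
    rw [IsScalarTower.algebraMap_eq (regularAway P) K L]
    exact (algebraMap K L).injective.comp Subtype.val_injective
  have hquot : ∀ p : Ideal (regularAway P), p ≠ ⊥ → Finite (regularAway P ⧸ p) := fun p hp =>
    Ring.HasFiniteQuotients.finiteQuotient hp
  obtain ⟨r, f, hr, hf, hcard⟩ := E.exists_motiveRank_eq_and_natCard_torsion (t := t')
    hli (CInfty v)
  obtain ⟨b, hb, hunit⟩ := exists_isUnit_reduction htr (isIntegralElem_regularAway P ht) hf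
  have hgood : ∀ p : Ideal (regularAway P), p.IsPrime → p ≠ ⊥ → b ∉ p →
      Nat.card (E.torsion (CInfty v) p) = Nat.card (regularAway P ⧸ p) ^ r := fun p hp hp0 hbp => by
    obtain ⟨a, hap, ha⟩ := Submodule.exists_mem_ne_zero_of_ne_bot hp0
    exact hcard p (hquot p hp0) ⟨a, hap, (map_ne_zero_iff _ hinj).mpr ha⟩ (hunit p hp hp0 hbp)
  have hrank : ∀ p : Ideal (regularAway P), p.IsPrime → p ≠ ⊥ →
      Nat.card (E.torsion (CInfty v) p) = Nat.card (regularAway P ⧸ p) ^ r →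
      E.torsionRank (CInfty v) p = r := fun p hp hp0 h => by
    have := hp.isMaximal hp0
    have := hquot p hp0
    exact E.torsionRank_eq_of_natCard_eq_pow (CInfty v) h
  refine ⟨r, hr, ?_, fun hE p hp hp0 => ?_⟩
  -- Exceptional primes contain the nonzero element `b`, and only finitely many ideals do.
  · refine (Ring.HasFiniteQuotients.finite_setOfPred_mem _ hb).subset fun p hp => ?_
    by_contra hbp
    exact hp.2.2 (hrank p hp.1 hp.2.1 (hgood p hp.1 hp.2.1 hbp))
  -- One prime not containing `b` suffices to identify the rank of the period lattice with the rank
  -- of the motive.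
  · obtain ⟨p₀, hp₀, hp₀0, hbp₀⟩ := hK.exists_isPrime_notMem P hb
    have : FaithfulSMul (regularAway P) L := (faithfulSMul_iff_algebraMap_injective _ _).mpr hinj
    have h1 : 1 < ‖algebraMap L (CInfty v) (algebraMap (regularAway P) L t')‖ := by
      have h2 := (CInfty.norm_algebraMap_le_one hv (R := regularAway P) (r := t')).not.mpr ht
      rwa [not_le] at h2
    have : IsScalarTower k L (CInfty v) := IsScalarTower.of_algebraMap_eq fun _ => rfl
    have h3 := hE.natCard_torsion K (fun y hy => hK.finiteDimensional_adjoin hy) h1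
      hp₀ hp₀0 (hgood p₀ hp₀ hp₀0 hbp₀)
    exact hrank p hp hp0 (h3 p hp hp0)
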